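/- Conventions. $\mathrm{Ai}$ is the Airy function, $H=-\Delta+x$, and $K_{\mathrm{Ai}}$ and $e^{LH}K_{\mathrm{Ai}}$ are the operators on $L^2(\mathbb R)$ with kernels $\int_{-\infty}^0\mathrm{Ai}(x-\lambda)\mathrm{Ai}(y-\lambda)\,d\lambda$ and $\int_{-\infty}^0e^{\lambda L}\mathrm{Ai}(x-\lambda)\mathrm{Ai}(y-\lambda)\,d\lambda$. The Airy transform $A$ is the bounded operator on $L^2(\mathbb R)$ with kernel $A(x,\lambda)=\mathrm{Ai}(x-\lambda)$, and $\bar P_mf=f\mathbf 1_{(-\infty,m]}$ ($\bar P_\infty=I$). All Brownian motions and bridges have diffusion coefficient $2$ (variance $2t$ at time $t$), and $p(t,x)=(4\pi t)^{-1/2}e^{-x^2/4t}$. A function $g:\mathbb R\to\mathbb R\cup\{\infty\}$ is in $H^1_{\rm ext}$ if there is a countable (finite or infinite) collection of intervals $[a,b]$, $a\le b$, with $g\in H^1([a,b])$ for each of them and $g=\infty$ outside their union. For $L>0$, $\Theta^g_{-L,L}$ has kernel $$\Theta^g_{-L,L}(x_1,x_2)=e^{2L^3/3-Lx_1-Lx_2}\,p(2L,x_2-x_1)\,\mathbb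 P\big(b(t)\le g(t)\ \forall t\in[-L,L]\big),$$ where $b$ is a Brownian bridge from $x_1-L^2$ at time $-L$ to $x_2-L^2$ at time $L$; products with it are compositions of kernels. For $B$ a Brownian motion started at $y$ under $\mathbb P_y$ put $\tau_g=\inf\{t\ge0:B(t)\ge g(t)\}$ and $$\Psi^g(\lambda,y)=\mathrm{Ai}(y-\lambda)-\mathbb E_y\Big[e^{-\frac23\tau^3-(B(\tau)-\lambda)\tau}\,\mathrm{Ai}\big(B(\tau)-\lambda+\tau^2\big);\ \tau<\infty\Big],\qquad \tau=\tau_g.$$ With $g^{\pm}(t)=g(\pm t)$, $t\ge0$, the Brownian scattering operator is $\mathcal S^g=\Psi^{g^-}\bar P_{g(0)}(\Psi^{g^+})^*$; only $\bar P_0\mathcal S^g\bar P_0=(\bar P_0\Psi^{g^-}\bar P_{g(0)})(\bar P_0\Psi^{g^+}\bar P_{g(0)})^*$ is used. Theorem. Let $g\in H^1_{\rm ext}$ satisfy $g(t)\ge c-\kappa t^2$ for all $t\in\mathbb R$, with $c\in\mathbb R$ and $\kappa\in[0,3/4)$. Then the integrals defining the composition of the kernels of $e^{LH}K_{\mathrm{Ai}}$,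 $\Theta^g_{-L,L}$ and $e^{LH}K_{\mathrm{Ai}}$ converge, the kernels of $K_{\mathrm{Ai}}$, $A$, $e^{LH}K_{\mathrm{Ai}}\Theta^g_{-L,L}e^{LH}K_{\mathrm{Ai}}$ ($L>0$) and $\bar P_0\Psi^{g^\pm}\bar P_{g(0)}$ define bounded operators on $L^2(\mathbb R)$, the operators $K_{\mathrm{Ai}}-e^{LH}K_{\mathrm{Ai}}\Theta^g_{-L,L}e^{LH}K_{\mathrm{Ai}}$, $L>0$, and $K_{\mathrm{Ai}}-A\bar P_0\mathcal S^g\bar P_0A^*$ are trace class, and $$\lim_{L\to\infty}\big(K_{\mathrm{Ai}}-e^{LH}K_{\mathrm{Ai}}\Theta^g_{-L,L}e^{LH}K_{\mathrm{Ai}}\big)=K_{\mathrm{Ai}}-A\bar P_0\mathcal S^g\bar P_0A^*\quad\text{in trace class norm.}$$ Moreover, if $\{g<\infty\}$ is an interval containing $0$ on which $g$ is continuous, then for $y\le g(0)$ and $\lambda\in\mathbb R$ one may replace $B(\tau)$ by $g(\tau)$, i.e. $$\Psi^{h}(\lambda,y)=\mathrm{Ai}(y-\lambda)-\int_0^\infty\mathbb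 P_y(\tau_{h}\in dt)\,e^{-\frac23t^3-(h(t)-\lambda)t}\,\mathrm{Ai}\big(h(t)-\lambda+t^2\big)\qquad\text{for }h=g^+,\ g^-.$$ -/

import Mathlib

open MeasureTheory ProbabilityTheory Filter Topology
open scoped NNReal ENNReal InnerProductSpace

noncomputable section

namespace AiryHitting

/-! ### Trace class operators -/

section TraceClass

variable {H : Type*} [NormedAddCommGroup H] [InnerProductSpace ℂ H] [CompleteSpace H]

/-- The trace norm `Tr |T| = ∑ ⟨eᵢ, |T| eᵢ⟩` with `|T| = √(T* T)`, an extended nonnegative number.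
The sum runs over some Hilbert basis of `H`; its value does not depend on the basis because
`|T|` is positive. -/
def traceNorm (T : H →L[ℂ] H) : ℝ≥0∞ :=
  ∑' i, ENNReal.ofReal
    (⟪(exists_hilbertBasis ℂ H).choose_spec.choose i,
      CFC.abs T ((exists_hilbertBasis ℂ H).choose_spec.choose i)⟫_ℂ).re

/-- `T` is trace class. -/
def IsTraceClass (T : H →L[ℂ] H) : Prop := traceNorm T < ∞

end TraceClass

/-! ### Integral operators on `L²(ℝ)` -/

/-- The Hilbert space `L²(ℝ)`. -/
abbrev L2 : Type := Lp ℂ 2 (volume : Measure ℝ)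

/-- The bounded operator `T` on `L²(ℝ)` has the integral kernel `k`: for `f` in the dense subspace
of continuous compactly supported functions, `(T f)(x) = ∫ k(x,y) f(y) dy` for almost every `x`. -/
def HasKernel (k : ℝ → ℝ → ℝ) (T : L2 →L[ℂ] L2) : Prop :=
  ∀ (f : ℝ → ℂ) (hf : Continuous f) (hs : HasCompactSupport f),
    (∀ᵐ x, Integrable (fun y => k x y • f y)) ∧
    T ((hf.memLp_of_hasCompactSupport hs).toLp f) =ᵐ[volume] fun x => ∫ y, k x y • f y

/-- A kernel determines the bounded operator. -/
theorem HasKernel.unique {k : ℝ → ℝ → ℝ} {S T : L2 →L[ℂ] L2}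
    (hS : HasKernel k S) (hT : HasKernel k T) : S = T := by
  have hd : Dense {f : L2 | ∃ g : ℝ → ℂ, f =ᵐ[volume] g ∧ HasCompactSupport g ∧
      ContDiff ℝ (⊤ : ℕ∞) g} := Lp.dense_hasCompactSupport_contDiff (by norm_num)
  refine ContinuousLinearMap.coeFn_injective (Continuous.ext_on hd S.continuous T.continuous ?_)
  rintro f ⟨g, hfg, hs, hg⟩
  have hfe : f = (hg.continuous.memLp_of_hasCompactSupport hs).toLp g :=
    Lp.ext (hfg.trans (MemLp.coeFn_toLp _).symm)
  rw [hfe]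
  exact Lp.ext ((hS g hg.continuous hs).2.trans (hT g hg.continuous hs).2.symm)

/-- `k` is the kernel of a bounded operator on `L²(ℝ)`. -/
def IsBoundedKernel (k : ℝ → ℝ → ℝ) : Prop := ∃ T : L2 →L[ℂ] L2, HasKernel k T

open Classical in
/-- The bounded operator on `L²(ℝ)` with kernel `k` (and `0` if there is none). -/
def kernelOp (k : ℝ → ℝ → ℝ) : L2 →L[ℂ] L2 :=
  if h : IsBoundedKernel k then h.choose else 0

/-- Composition of integral kernels. -/
def kernelComp (k₁ k₂ : ℝ → ℝ → ℝ) (x y : ℝ) : ℝ := ∫ z, k₁ x z * k₂ z y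

/-- The integrals defining the composition of two kernels converge absolutely. -/
def Composable (k₁ k₂ : ℝ → ℝ → ℝ) : Prop := ∀ x y, Integrable fun z => k₁ x z * k₂ z y

/-! ### The Airy function, the Airy kernel and the Airy transform -/

/-- The Airy function `Ai(x) = (2πi)⁻¹ ∫ exp(u³/3 - x u) du`, along the line `Re u = 1`. -/
def airyAi (x : ℝ) : ℝ :=
  (2 * Real.pi)⁻¹ *
    (∫ s : ℝ, Complex.exp ((1 + s * Complex.I) ^ 3 / 3 - x * (1 + s * Complex.I))).re

/-- The Airy kernel `K_Ai`. -/
def airyKernel (x y : ℝ) : ℝ := ∫ l in Set.Iic (0 : ℝ), airyAi (x - l) * airyAi (y - l)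

/-- The kernel of `e^{tH} K_Ai`, where `H = -Δ + x` is the Airy Hamiltonian. -/
def expAiryKernel (t x y : ℝ) : ℝ :=
  ∫ l in Set.Iic (0 : ℝ), Real.exp (l * t) * airyAi (x - l) * airyAi (y - l)

/-- The kernel `A(x,λ) = Ai(x - λ)` of the Airy transform. -/
def airyTransformKernel (x l : ℝ) : ℝ := airyAi (x - l)

/-! ### The class of functions `g` -/

/-- `f ∈ H¹([a,b])`: `f` is absolutely continuous on `[a,b]` with derivative in `L²([a,b])`. -/
def IsH1On (f : ℝ → ℝ) (a b : ℝ) : Prop :=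
  ∃ f' : ℝ → ℝ, MemLp f' 2 (volume.restrict (Set.Icc a b)) ∧
    ∀ t ∈ Set.Icc a b, f t = f a + ∫ s in a..t, f' s

/-- `g ∈ H¹_ext(ℝ)`: there is a countable collection of compact intervals `[a,b]`, `a ≤ b`, such
that `g` is in `H¹([a,b])` for each of them, and `g = ∞` outside their union. -/
def IsH1Ext (g : ℝ → EReal) : Prop :=
  ∃ S : Set (ℝ × ℝ), S.Countable ∧
    (∀ p ∈ S, p.1 ≤ p.2 ∧
      ∃ f : ℝ → ℝ, IsH1On f p.1 p.2 ∧ ∀ t ∈ Set.Icc p.1 p.2, g t = (f t : EReal)) ∧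
    ∀ t, (∀ p ∈ S, t ∉ Set.Icc p.1 p.2) → g t = ⊤

section Brownian

variable {Ω : Type*} [MeasurableSpace Ω]

/-! ### The operators `Θ^g_{-L,L}` and `e^{LH} K_Ai Θ^g_{-L,L} e^{LH} K_Ai`

`W` is a standard Brownian motion, so `√2 W` has diffusion coefficient `2`. -/

/-- The Brownian bridge with diffusion coefficient `2` from `x` at time `a` to `y` at time `b`,
evaluated at time `t ∈ [a,b]`. -/
def bridge (W : ℝ≥0 → Ω → ℝ) (a x b y t : ℝ) (ω : Ω) : ℝ :=
  x + (t - a) / (b - a) * (y - x) +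
    √2 * (W (t - a).toNNReal ω - (t - a) / (b - a) * W (b - a).toNNReal ω)

/-- The heat kernel `p(t,x) = (4πt)^{-1/2} e^{-x²/4t}`. -/
def heatKernel (t x : ℝ) : ℝ := (√(4 * Real.pi * t))⁻¹ * Real.exp (-x ^ 2 / (4 * t))

/-- The kernel of `Θ^g_{-L,L}`. -/
def thetaKernel (P : Measure Ω) (W : ℝ≥0 → Ω → ℝ) (g : ℝ → EReal) (L x₁ x₂ : ℝ) : ℝ :=
  Real.exp (2 * L ^ 3 / 3 - L * x₁ - L * x₂) * heatKernel (2 * L) (x₂ - x₁) *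
    P.real {ω | ∀ t ∈ Set.Icc (-L) L,
      (bridge W (-L) (x₁ - L ^ 2) L (x₂ - L ^ 2) t ω : EReal) ≤ g t}

/-- The kernel of `e^{LH} K_Ai Θ^g_{-L,L} e^{LH} K_Ai`. -/
def scatLKernel (P : Measure Ω) (W : ℝ≥0 → Ω → ℝ) (g : ℝ → EReal) (L : ℝ) : ℝ → ℝ → ℝ :=
  kernelComp (expAiryKernel L) (kernelComp (thetaKernel P W g L) (expAiryKernel L))

/-! ### The Brownian scattering operator -/

/-- Times at which `y + √2 W` lies at or above `g`. -/
def hitTimes (W : ℝ≥0 → Ω → ℝ) (g : ℝ → EReal) (y : ℝ) (ω : Ω) : Set ℝ :=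
  {t | 0 ≤ t ∧ g t ≤ ((y + √2 * W t.toNNReal ω : ℝ) : EReal)}

/-- The hitting time `τ_g = inf {t ≥ 0 : B(t) ≥ g(t)}` for `B = y + √2 W`, on the event
`τ_g < ∞`, i.e. when `hitTimes` is nonempty. -/
def hitTime (W : ℝ≥0 → Ω → ℝ) (g : ℝ → EReal) (y : ℝ) (ω : Ω) : ℝ :=
  sInf (hitTimes W g y ω)

/-- The backward heat flow of the Airy function,
`e^{-tΔ} A*(λ, z) = invHeatAiry t (z - λ)`. -/
def invHeatAiry (t x : ℝ) : ℝ := Real.exp (-2 * t ^ 3 / 3 - x * t) * airyAi (x + t ^ 2)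

/-- `Ψ^g(λ,y) = A*(λ,y) - E_y[e^{-τΔ} A*(λ, B(τ)) ; τ < ∞]` with `τ = τ_g`. -/
def psiKernel (P : Measure Ω) (W : ℝ≥0 → Ω → ℝ) (g : ℝ → EReal) (l y : ℝ) : ℝ :=
  airyAi (y - l) - ∫ ω in {ω | (hitTimes W g y ω).Nonempty},
    invHeatAiry (hitTime W g y ω) (y + √2 * W (hitTime W g y ω).toNNReal ω - l) ∂P

/-- The same with `g(τ)` in place of `B(τ)`:
`A*(λ,y) - ∫₀^∞ P_y(τ_g ∈ dt) e^{-tΔ} A*(λ, g(t))`. -/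
def psiKernelCurve (P : Measure Ω) (W : ℝ≥0 → Ω → ℝ) (g : ℝ → EReal) (l y : ℝ) : ℝ :=
  airyAi (y - l) - ∫ ω in {ω | (hitTimes W g y ω).Nonempty},
    invHeatAiry (hitTime W g y ω) ((g (hitTime W g y ω)).toReal - l) ∂P

open Classical in
/-- The kernel of `P̄₀ Ψ^g P̄_{g(0)}`, where `P̄_m` is multiplication by the indicator of
`(-∞, m]` (so `P̄_∞` is the identity). -/
def cutPsiKernel (P : Measure Ω) (W : ℝ≥0 → Ω → ℝ) (g : ℝ → EReal) (l y : ℝ) : ℝ :=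
  if l ≤ 0 ∧ (y : EReal) ≤ g 0 then psiKernel P W g l y else 0

/-- The operator `P̄₀ S^g P̄₀ = (P̄₀ Ψ^{g⁻} P̄_{g(0)}) (P̄₀ Ψ^{g⁺} P̄_{g(0)})*`, where
`S^g = Ψ^{g⁻} P̄_{g(0)} (Ψ^{g⁺})*` is the Brownian scattering operator, `g⁺(t) = g(t)`,
`g⁻(t) = g(-t)` for `t ≥ 0`. -/
def cutScattering (P : Measure Ω) (W : ℝ≥0 → Ω → ℝ) (g : ℝ → EReal) : L2 →L[ℂ] L2 :=
  kernelOp (cutPsiKernel P W fun t => g (-t)) ∘L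
    ContinuousLinearMap.adjoint (kernelOp (cutPsiKernel P W g))

end Brownian

/-- The operator `K_Ai`. -/
def airyOp : L2 →L[ℂ] L2 := kernelOp airyKernel

/-- The Airy transform `A`. -/
def airyTransform : L2 →L[ℂ] L2 := kernelOp airyTransformKernel

end AiryHitting

end

open MeasureTheory ProbabilityTheory Filter Topology
open scoped NNReal ENNReal InnerProductSpace

noncomputable section

namespace AiryHitting

/-! ### Contour integrals for the Airy function -/

/-- The integrand `exp(u³/3 - t u² - x u)` at `u = b + i s`. -/
def airyIntegrand (t x b s : ℝ) : ℂ :=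
  Complex.exp ((b + s * Complex.I) ^ 3 / 3 - t * (b + s * Complex.I) ^ 2 - x * (b + s * Complex.I))

lemma norm_airyIntegrand (t x b s : ℝ) :
    ‖airyIntegrand t x b s‖ =
      Real.exp (b ^ 3 / 3 - b ^ 2 * t - b * x) * Real.exp (-(b - t) * s ^ 2) := by
  have h : ((b + s * Complex.I) ^ 3 / 3 - t * (b + s * Complex.I) ^ 2 -
      x * (b + s * Complex.I) : ℂ) =
      ((b ^ 3 / 3 - b ^ 2 * t - b * x + -(b - t) * s ^ 2 : ℝ) : ℂ) +
      ((b ^ 2 * s - s ^ 3 / 3 - 2 * t * b * s - x * s : ℝ) : ℂ) * Complex.I := by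
    have h3 : Complex.I ^ 3 = -Complex.I := by rw [pow_succ, Complex.I_sq]; ring
    push_cast
    ring_nf
    rw [h3, Complex.I_sq]
    ring
  rw [airyIntegrand, Complex.norm_exp, h, ← Real.exp_add, Complex.add_re, Complex.ofReal_re,
    Complex.re_ofReal_mul, Complex.I_re, mul_zero, add_zero]

@[fun_prop]
lemma continuous_airyIntegrand {X : Type*} [TopologicalSpace X] {t x b s : X → ℝ}
    (ht : Continuous t) (hx : Continuous x) (hb : Continuous b) (hs : Continuous s) :
    Continuous fun p => airyIntegrand (t p) (x p) (b p) (s p) := by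
  unfold airyIntegrand
  fun_prop

lemma integrable_airyIntegrand {t b : ℝ} (x : ℝ) (h : t < b) :
    Integrable (airyIntegrand t x b) := by
  refine ((integrable_exp_neg_mul_sq (sub_pos.2 h)).const_mul
    (Real.exp (b ^ 3 / 3 - b ^ 2 * t - b * x))).mono' ?_ ?_
  · exact (continuous_airyIntegrand continuous_const continuous_const continuous_const
      continuous_id).aestronglyMeasurable
  · exact Eventually.of_forall fun s => (norm_airyIntegrand t x b s).le

/-- The contour integral `∫ exp(u³/3 - t u² - x u) ds` along `u = b + i s`. -/
def airyInt (t x b : ℝ) : ℂ := ∫ s : ℝ, airyIntegrand t x b s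

lemma hasDerivAt_airyInt_zero {b : ℝ} (x : ℝ) (hb : 0 < b) :
    HasDerivAt (airyInt 0 x) 0 b := by
  set D : ℝ → ℝ → ℂ := fun c s => airyIntegrand 0 x c s * ((c + s * Complex.I) ^ 2 - x) with hD
  have hd1 : ∀ c s : ℝ, HasDerivAt (fun c : ℝ => airyIntegrand 0 x c s) (D c s) c := by
    intro c s
    have h1 : HasDerivAt (fun c : ℝ => (c : ℂ) + s * Complex.I) 1 c :=
      (Complex.ofRealCLM.hasDerivAt (x := c)).add_const _
    have h2 := ((((h1.pow 3).div_const 3).sub ((h1.pow 2).const_mul ((0 : ℝ) : ℂ))).sub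
      (h1.const_mul (x : ℂ))).cexp
    refine HasDerivAt.congr_deriv h2 ?_
    symm
    change airyIntegrand 0 x c s * _ = airyIntegrand 0 x c s * _
    push_cast
    ring
  have hd2 : ∀ s : ℝ, HasDerivAt (fun s : ℝ => airyIntegrand 0 x b s) (D b s * Complex.I) s := by
    intro s
    have h1 : HasDerivAt (fun s : ℝ => (b : ℂ) + s * Complex.I) Complex.I s := by
      simpa using ((Complex.ofRealCLM.hasDerivAt (x := s)).mul_const Complex.I).const_add (b : ℂ)
    have h2 := ((((h1.pow 3).div_const 3).sub ((h1.pow 2).const_mul ((0 : ℝ) : ℂ))).sub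
      (h1.const_mul (x : ℂ))).cexp
    refine HasDerivAt.congr_deriv h2 ?_
    symm
    change airyIntegrand 0 x b s * _ * _ = airyIntegrand 0 x b s * _
    push_cast
    ring
  set K : ℝ := Real.exp ((2 * b) ^ 3 / 3 + 2 * b * |x|) with hK
  set bound : ℝ → ℝ := fun s =>
    K * (((2 * b) ^ 2 + |x|) * Real.exp (-(b / 2) * s ^ 2) + s ^ 2 * Real.exp (-(b / 2) * s ^ 2))
  have hbi : Integrable bound := by
    refine Integrable.const_mul (((integrable_exp_neg_mul_sq (by positivity)).const_mul _).add ?_) _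
    have := integrable_rpow_mul_exp_neg_mul_sq (b := b / 2) (by positivity) (s := 2) (by norm_num)
    simpa using this
  have hbound : ∀ s : ℝ, ∀ c ∈ Set.Ioo (b / 2) (2 * b), ‖D c s‖ ≤ bound s := by
    intro s c hc
    have hc0 : 0 < c := by linarith [hc.1]
    have n1 : ‖airyIntegrand 0 x c s‖ ≤ K * Real.exp (-(b / 2) * s ^ 2) := by
      rw [norm_airyIntegrand, hK]
      gcongr
      · have : c ^ 3 ≤ (2 * b) ^ 3 := by gcongr; exact hc.2.le
        have h2 : -(c * x) ≤ 2 * b * |x| := by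
          calc -(c * x) = c * (-x) := by ring
            _ ≤ c * |x| := by gcongr; exact neg_le_abs x
            _ ≤ 2 * b * |x| := by gcongr; exact hc.2.le
        linarith
      · linarith [hc.1]
    have n2 : ‖((c + s * Complex.I) ^ 2 - x : ℂ)‖ ≤ ((2 * b) ^ 2 + |x|) + s ^ 2 := by
      refine (norm_sub_le _ _).trans ?_
      have : ‖(c + s * Complex.I : ℂ)‖ ^ 2 = c ^ 2 + s ^ 2 := by
        rw [Complex.sq_norm, Complex.normSq_add_mul_I]
      rw [norm_pow, this, Complex.norm_real, Real.norm_eq_abs]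
      have : c ^ 2 ≤ (2 * b) ^ 2 := by gcongr; exact hc.2.le
      linarith
    calc ‖D c s‖ = ‖airyIntegrand 0 x c s‖ * ‖((c + s * Complex.I) ^ 2 - x : ℂ)‖ := norm_mul _ _
      _ ≤ (K * Real.exp (-(b / 2) * s ^ 2)) * (((2 * b) ^ 2 + |x|) + s ^ 2) := by gcongr
      _ = bound s := by simp only [bound]; ring
  have hDc : ∀ c, Continuous (D c) := by
    intro c
    simp only [hD]
    fun_prop
  have key := hasDerivAt_integral_of_dominated_loc_of_deriv_le (μ := volume)
    (F := fun c s => airyIntegrand 0 x c s) (F' := D) (bound := bound)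
    (Ioo_mem_nhds (by linarith : b / 2 < b) (by linarith : b < 2 * b))
    (Eventually.of_forall fun c => Continuous.aestronglyMeasurable (by fun_prop))
    (integrable_airyIntegrand x hb) (hDc b).aestronglyMeasurable
    (Eventually.of_forall hbound) hbi (Eventually.of_forall fun s c _ => hd1 c s)
  have h0 : ∫ s, D b s = 0 := by
    have := integral_eq_zero_of_hasDerivAt_of_integrable hd2 (key.1.mul_const _)
      (integrable_airyIntegrand x hb)
    rw [integral_mul_const] at this
    simpa using this
  rw [h0] at key
  exact key.2

lemma airyInt_zero_eq {a b : ℝ} (x : ℝ) (ha : 0 < a) (hb : 0 < b) :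
    airyInt 0 x a = airyInt 0 x b := by
  refine isOpen_Ioi.is_const_of_deriv_eq_zero (s := Set.Ioi (0 : ℝ)) isPreconnected_Ioi
    (fun c hc => ((hasDerivAt_airyInt_zero x hc).differentiableAt).differentiableWithinAt)
    (fun c hc => (hasDerivAt_airyInt_zero x hc).deriv) ha hb

lemma airyIntegrand_shift (t x b s : ℝ) :
    airyIntegrand t x b s =
      Real.exp (-2 * t ^ 3 / 3 - x * t) * airyIntegrand 0 (x + t ^ 2) (b - t) s := by
  unfold airyIntegrand
  rw [Complex.ofReal_exp, ← Complex.exp_add]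
  congr 1
  push_cast
  ring

lemma airyInt_shift (t x b : ℝ) :
    airyInt t x b = Real.exp (-2 * t ^ 3 / 3 - x * t) * airyInt 0 (x + t ^ 2) (b - t) := by
  unfold airyInt
  rw [← integral_const_mul]
  exact integral_congr_ae (Eventually.of_forall fun s => airyIntegrand_shift t x b s)

lemma conj_airyInt (t x b : ℝ) : (starRingEnd ℂ) (airyInt t x b) = airyInt t x b := by
  unfold airyInt
  rw [← integral_conj, ← integral_neg_eq_self]
  refine integral_congr_ae (Eventually.of_forall fun s => ?_)
  simp only [airyIntegrand, ← Complex.exp_conj]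
  congr 1
  simp [Complex.conj_ofNat]

lemma airyAi_eq {b : ℝ} (x : ℝ) (hb : 0 < b) :
    airyAi x = (2 * Real.pi)⁻¹ * (airyInt 0 x b).re := by
  rw [airyInt_zero_eq x hb one_pos, airyAi, airyInt]
  simp [airyIntegrand]

/-- The contour integral representation of the backward heat flow of the Airy function. -/
lemma invHeatAiry_eq {t b : ℝ} (x : ℝ) (h : t < b) :
    invHeatAiry t x = (2 * Real.pi)⁻¹ * (airyInt t x b).re := by
  rw [airyInt_shift, invHeatAiry, airyAi_eq _ (sub_pos.2 h), Complex.re_ofReal_mul]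
  ring

lemma ofReal_invHeatAiry {t b : ℝ} (x : ℝ) (h : t < b) :
    (invHeatAiry t x : ℂ) = (2 * Real.pi)⁻¹ * airyInt t x b := by
  rw [invHeatAiry_eq x h]
  push_cast
  rw [Complex.conj_eq_iff_re.1 (conj_airyInt t x b)]

lemma abs_invHeatAiry_le {t b : ℝ} (x : ℝ) (h : 1 / 8 ≤ b - t) :
    |invHeatAiry t x| ≤ Real.exp (b ^ 3 / 3 - b ^ 2 * t - b * x) := by
  have hbt : t < b := by linarith
  rw [invHeatAiry_eq x hbt, abs_mul]
  have h1 : |(airyInt t x b).re| ≤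
      Real.exp (b ^ 3 / 3 - b ^ 2 * t - b * x) * √(Real.pi / (b - t)) := by
    refine (Complex.abs_re_le_norm _).trans ((norm_integral_le_integral_norm _).trans ?_)
    simp_rw [norm_airyIntegrand]
    rw [integral_const_mul, integral_gaussian]
  have hpi := Real.pi_gt_three
  have h2 : √(Real.pi / (b - t)) ≤ 2 * Real.pi := by
    rw [Real.sqrt_le_left (by positivity)]
    rw [div_le_iff₀ (by linarith)]
    nlinarith
  rw [abs_of_pos (by positivity)]
  calc (2 * Real.pi)⁻¹ * |(airyInt t x b).re|
      ≤ (2 * Real.pi)⁻¹ * (Real.exp (b ^ 3 / 3 - b ^ 2 * t - b * x) * (2 * Real.pi)) := by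
        gcongr
        exact h1.trans (by gcongr)
    _ = _ := by field_simp

lemma invHeatAiry_zero (x : ℝ) : invHeatAiry 0 x = airyAi x := by simp [invHeatAiry]

lemma abs_airyAi_le (x : ℝ) : |airyAi x| ≤ 2 * Real.exp (-x) := by
  have h := abs_invHeatAiry_le (t := 0) (b := 1) x (by norm_num)
  rw [invHeatAiry_zero] at h
  refine h.trans ?_
  rw [show (1 : ℝ) ^ 3 / 3 - 1 ^ 2 * 0 - 1 * x = 1 / 3 + -x by ring, Real.exp_add]
  gcongr
  have := Real.exp_bound' (x := 1 / 3) (by norm_num) (by norm_num) (n := 2) (by norm_num)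
  norm_num [Finset.sum_range_succ] at this
  linarith

lemma abs_airyAi_le_eighth (x : ℝ) : |airyAi x| ≤ 2 * Real.exp (-x / 8) := by
  have h := abs_invHeatAiry_le (t := 0) (b := 1 / 8) x (by norm_num)
  rw [invHeatAiry_zero] at h
  refine h.trans ?_
  rw [show ((1 : ℝ) / 8) ^ 3 / 3 - (1 / 8) ^ 2 * 0 - 1 / 8 * x = 1 / 1536 + -x / 8 by ring,
    Real.exp_add]
  gcongr
  have := Real.exp_bound' (x := 1 / 1536) (by norm_num) (by norm_num) (n := 2) (by norm_num)
  norm_num [Finset.sum_range_succ] at this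
  linarith

lemma continuous_airyAi : Continuous airyAi := by
  have h : Continuous fun x : ℝ => airyInt 0 x 1 := by
    refine continuous_iff_continuousAt.2 fun x₀ => ?_
    refine continuousAt_of_dominated (bound := fun s : ℝ =>
      Real.exp (1 + |x₀| + 1) * Real.exp (-s ^ 2)) ?_ ?_ ?_ ?_
    · exact Eventually.of_forall fun x => Continuous.aestronglyMeasurable (by fun_prop)
    · filter_upwards [Metric.ball_mem_nhds x₀ one_pos] with x hx
      refine Eventually.of_forall fun s => ?_
      rw [norm_airyIntegrand]
      rw [Metric.mem_ball, Real.dist_eq] at hx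
      have h1 := (abs_le.1 hx.le).1
      have h2 := neg_abs_le x₀
      gcongr
      · linarith
      · simp
    · simpa using (integrable_exp_neg_mul_sq (b := 1) one_pos).const_mul (Real.exp (1 + |x₀| + 1))
    · exact Eventually.of_forall fun s => Continuous.continuousAt (by fun_prop)
  have h2 : airyAi = fun x => (2 * Real.pi)⁻¹ * (airyInt 0 x 1).re :=
    funext fun x => airyAi_eq x one_pos
  rw [h2]
  exact continuous_const.mul (Complex.continuous_re.comp h)

@[fun_prop]
lemma Continuous.airyAi {X : Type*} [TopologicalSpace X] {f : X → ℝ} (hf : Continuous f) :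
    Continuous fun x => airyAi (f x) := continuous_airyAi.comp hf

@[fun_prop]
lemma Continuous.invHeatAiry {X : Type*} [TopologicalSpace X] {t f : X → ℝ} (ht : Continuous t)
    (hf : Continuous f) : Continuous fun x => invHeatAiry (t x) (f x) := by
  unfold AiryHitting.invHeatAiry
  fun_prop

@[fun_prop]
lemma Measurable.airyAi {X : Type*} [MeasurableSpace X] {f : X → ℝ} (hf : Measurable f) :
    Measurable fun x => airyAi (f x) := continuous_airyAi.measurable.comp hf

@[fun_prop]
lemma Measurable.invHeatAiry {X : Type*} [MeasurableSpace X] {t f : X → ℝ} (ht : Measurable t)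
    (hf : Measurable f) : Measurable fun x => invHeatAiry (t x) (f x) := by
  unfold AiryHitting.invHeatAiry
  fun_prop

lemma abs_invHeatAiry_add_one_le (t x : ℝ) :
    |invHeatAiry t x| ≤ Real.exp ((t + 1) ^ 3 / 3 - (t + 1) ^ 2 * t - (t + 1) * x) :=
  abs_invHeatAiry_le x (by norm_num)

lemma integrable_invHeatAiry_gaussian (t x : ℝ) (v : ℝ≥0) :
    Integrable (fun z => invHeatAiry t (x + √2 * z)) (gaussianReal 0 v) := by
  refine ((integrable_exp_mul_gaussianReal (-((t + 1) * √2))).const_mul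
    (Real.exp ((t + 1) ^ 3 / 3 - (t + 1) ^ 2 * t - (t + 1) * x))).mono' ?_ ?_
  · exact Continuous.aestronglyMeasurable (by fun_prop)
  · refine Eventually.of_forall fun z => (abs_invHeatAiry_add_one_le _ _).trans (le_of_eq ?_)
    rw [← Real.exp_add]
    ring_nf

/-- The heat semigroup acts on the backward heat flow of the Airy function. -/
lemma integral_invHeatAiry_gaussian (t x : ℝ) (v : ℝ≥0) :
    ∫ z, invHeatAiry (t + v) (x + √2 * z) ∂(gaussianReal 0 v) = invHeatAiry t x := by
  set b : ℝ := t + v + 1 with hb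
  have hv : (0 : ℝ) ≤ v := v.2
  have h1 : t + v < b := by linarith
  have h2 : t < b := by linarith
  have hfact : ∀ s z : ℝ, airyIntegrand (t + v) (x + √2 * z) b s =
      airyIntegrand (t + v) x b s * Complex.exp (-(√2 * (b + s * Complex.I)) * z) := by
    intro s z
    unfold airyIntegrand
    rw [← Complex.exp_add]
    congr 1
    push_cast
    ring
  have hmgf : ∀ s : ℝ, ∫ z : ℝ, Complex.exp (-(√2 * (b + s * Complex.I)) * z) ∂(gaussianReal 0 v)
      = Complex.exp (v * (b + s * Complex.I) ^ 2) := by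
    intro s
    have := complexMGF_id_gaussianReal (μ := 0) (v := v) (-(√2 * (b + s * Complex.I)))
    rw [complexMGF] at this
    simp only [id] at this
    rw [this]
    congr 1
    have h2 : (√2 : ℂ) ^ 2 = 2 := by
      rw [← Complex.ofReal_pow, Real.sq_sqrt (by norm_num)]; norm_num
    rw [neg_sq, mul_pow, h2]
    push_cast
    ring
  have hintg : Integrable (fun p : ℝ × ℝ => airyIntegrand (t + v) (x + √2 * p.1) b p.2)
      ((gaussianReal 0 v).prod volume) := by
    refine (((integrable_exp_mul_gaussianReal (μ := 0) (v := v) (-(b * √2))).mul_prod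
      (integrable_exp_neg_mul_sq (sub_pos.2 h1))).const_mul
      (Real.exp (b ^ 3 / 3 - b ^ 2 * (t + v) - b * x))).mono' ?_ ?_
    · exact Continuous.aestronglyMeasurable (by fun_prop)
    · refine Eventually.of_forall fun p => le_of_eq ?_
      rw [norm_airyIntegrand]
      simp only [← Real.exp_add]
      congr 1
      ring
  have hC : (∫ z, (invHeatAiry (t + v) (x + √2 * z) : ℂ) ∂(gaussianReal 0 v)) =
      invHeatAiry t x := by
    simp_rw [ofReal_invHeatAiry _ h1]
    rw [ofReal_invHeatAiry _ h2, integral_const_mul]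
    congr 1
    unfold airyInt
    rw [integral_integral_swap hintg]
    refine integral_congr_ae (Eventually.of_forall fun s => ?_)
    simp only
    simp_rw [hfact s]
    rw [integral_const_mul, hmgf]
    unfold airyIntegrand
    rw [← Complex.exp_add]
    congr 1
    push_cast
    ring
  rw [integral_complex_ofReal] at hC
  exact_mod_cast hC

/-! ### Hilbert–Schmidt operators and the trace norm -/

section HilbertSchmidt

variable {H : Type*} [NormedAddCommGroup H] [InnerProductSpace ℂ H] [CompleteSpace H]

variable (H) in
/-- The Hilbert basis used in the definition of the trace norm. -/
abbrev stdBasis : HilbertBasis (exists_hilbertBasis ℂ H).choose ℂ H :=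
  (exists_hilbertBasis ℂ H).choose_spec.choose

/-- The square of the Hilbert–Schmidt norm. -/
def hsSq (T : H →L[ℂ] H) : ℝ≥0∞ := ∑' i, ‖T (stdBasis H i)‖ₑ ^ 2

/-- The trace norm of `T`, in its dual form, is at most `B`. -/
def NuclearBound (T : H →L[ℂ] H) (B : ℝ≥0∞) : Prop :=
  ∀ V : H →L[ℂ] H, ‖V‖ ≤ 1 → ∑' i, ‖⟪stdBasis H i, V (T (stdBasis H i))⟫_ℂ‖ₑ ≤ B

lemma tsum_enorm_inner_sq (x : H) : ∑' i, ‖⟪stdBasis H i, x⟫_ℂ‖ₑ ^ 2 = ‖x‖ₑ ^ 2 := by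
  have h := (stdBasis H).hasSum_inner_mul_inner x x
  have h2 : HasSum (fun i => ‖⟪stdBasis H i, x⟫_ℂ‖ ^ 2) (‖x‖ ^ 2) := by
    rw [← Complex.hasSum_ofReal]
    rw [inner_self_eq_norm_sq_to_K] at h
    have e : ∀ i, ⟪x, stdBasis H i⟫_ℂ * ⟪stdBasis H i, x⟫_ℂ =
        ((‖⟪stdBasis H i, x⟫_ℂ‖ ^ 2 : ℝ) : ℂ) := fun i => by
      rw [← inner_conj_symm x, ← Complex.normSq_eq_conj_mul_self, Complex.normSq_eq_norm_sq]
    simp_rw [e] at h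
    rw [Complex.ofReal_pow]
    exact h
  have h3 := ENNReal.ofReal_tsum_of_nonneg (fun i => by positivity) h2.summable
  rw [h2.tsum_eq] at h3
  simp_rw [ENNReal.ofReal_pow (norm_nonneg _), ofReal_norm] at h3
  exact h3.symm

lemma hsSq_adjoint (T : H →L[ℂ] H) : hsSq (ContinuousLinearMap.adjoint T) = hsSq T := by
  have h : ∀ S : H →L[ℂ] H, hsSq S =
      ∑' i, ∑' j, ‖⟪stdBasis H j, S (stdBasis H i)⟫_ℂ‖ₑ ^ 2 := fun S =>
    tsum_congr fun i => (tsum_enorm_inner_sq _).symm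
  rw [h, h, ENNReal.tsum_comm]
  refine tsum_congr fun i => tsum_congr fun j => ?_
  rw [ContinuousLinearMap.adjoint_inner_right, ← ofReal_norm, ← ofReal_norm, norm_inner_symm]

lemma hsSq_comp_le_left (U T : H →L[ℂ] H) (hU : ‖U‖ ≤ 1) : hsSq (U ∘L T) ≤ hsSq T := by
  refine ENNReal.tsum_le_tsum fun i => ?_
  gcongr
  have h := (U.le_opNorm (T (stdBasis H i))).trans (mul_le_of_le_one_left (norm_nonneg _) hU)
  simpa [← ofReal_norm] using ENNReal.ofReal_le_ofReal h

lemma hsSq_comp_le_right (T U : H →L[ℂ] H) (hU : ‖U‖ ≤ 1) : hsSq (T ∘L U) ≤ hsSq T := by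
  rw [← hsSq_adjoint, ContinuousLinearMap.adjoint_comp, ← hsSq_adjoint T]
  refine hsSq_comp_le_left _ _ ?_
  rwa [LinearIsometryEquiv.norm_map]

lemma NuclearBound.mono {T : H →L[ℂ] H} {B B' : ℝ≥0∞} (h : NuclearBound T B) (hB : B ≤ B') :
    NuclearBound T B' := fun V hV => (h V hV).trans hB

lemma NuclearBound.add {S T : H →L[ℂ] H} {B C : ℝ≥0∞} (hS : NuclearBound S B)
    (hT : NuclearBound T C) : NuclearBound (S + T) (B + C) := by
  intro V hV
  refine le_trans ?_ (add_le_add (hS V hV) (hT V hV))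
  rw [← ENNReal.tsum_add]
  refine ENNReal.tsum_le_tsum fun i => ?_
  rw [_root_.add_apply, map_add, inner_add_right]
  exact enorm_add_le _ _

lemma NuclearBound.neg {T : H →L[ℂ] H} {B : ℝ≥0∞} (hT : NuclearBound T B) :
    NuclearBound (-T) B := by
  intro V hV
  simpa using hT V hV

lemma NuclearBound.sub {S T : H →L[ℂ] H} {B C : ℝ≥0∞} (hS : NuclearBound S B)
    (hT : NuclearBound T C) : NuclearBound (S - T) (B + C) := by
  rw [sub_eq_add_neg]
  exact hS.add hT.neg

/-- The product of two Hilbert–Schmidt operators is trace class. -/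
lemma nuclearBound_comp (S R : H →L[ℂ] H) :
    NuclearBound (S ∘L R) (hsSq S ^ (1 / 2 : ℝ) * hsSq R ^ (1 / 2 : ℝ)) := by
  intro V hV
  have h1 : ∀ i, ‖⟪stdBasis H i, V ((S ∘L R) (stdBasis H i))⟫_ℂ‖ₑ ≤
      ‖ContinuousLinearMap.adjoint (V ∘L S) (stdBasis H i)‖ₑ * ‖R (stdBasis H i)‖ₑ := by
    intro i
    rw [show V ((S ∘L R) (stdBasis H i)) = (V ∘L S) (R (stdBasis H i)) from rfl,
      ← ContinuousLinearMap.adjoint_inner_left]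
    have h := norm_inner_le_norm (𝕜 := ℂ) (ContinuousLinearMap.adjoint (V ∘L S) (stdBasis H i))
      (R (stdBasis H i))
    have h' := ENNReal.ofReal_le_ofReal h
    rwa [ENNReal.ofReal_mul (norm_nonneg _), ofReal_norm, ofReal_norm, ofReal_norm] at h'
  refine (ENNReal.tsum_le_tsum h1).trans ?_
  rw [ENNReal.tsum_eq_iSup_sum]
  refine iSup_le fun s => ?_
  refine (ENNReal.inner_le_Lp_mul_Lq s _ _ Real.HolderConjugate.two_two).trans ?_
  gcongr
  · calc ∑ i ∈ s, ‖ContinuousLinearMap.adjoint (V ∘L S) (stdBasis H i)‖ₑ ^ (2 : ℝ)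
        ≤ hsSq (ContinuousLinearMap.adjoint (V ∘L S)) := by
          simp_rw [ENNReal.rpow_two]
          exact ENNReal.sum_le_tsum s
      _ ≤ hsSq S := by rw [hsSq_adjoint]; exact hsSq_comp_le_left V S hV
  · simp_rw [ENNReal.rpow_two]
    exact ENNReal.sum_le_tsum s

lemma exists_approx_polar (T : H →L[ℂ] H) {ε : ℝ} (hε : 0 < ε) :
    ∃ V : H →L[ℂ] H, ‖V‖ ≤ 1 ∧ ‖CFC.abs T - V * T‖ ≤ ε := by
  set a : H →L[ℂ] H := CFC.abs T with ha
  have ha0 : 0 ≤ a := CFC.abs_nonneg T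
  have hsa : IsSelfAdjoint a := IsSelfAdjoint.of_nonneg ha0
  have hspec : ∀ x ∈ spectrum ℝ a, 0 ≤ x := fun x hx => spectrum_nonneg_of_nonneg ha0 hx
  have hcont : ContinuousOn (fun x : ℝ => (x + ε)⁻¹) (spectrum ℝ a) := by
    refine ContinuousOn.inv₀ (by fun_prop) fun x hx => ?_
    have := hspec x hx
    positivity
  set C : H →L[ℂ] H := cfc (fun x : ℝ => (x + ε)⁻¹) a with hC
  have hCsa : star C = C := (cfc_predicate (p := IsSelfAdjoint) (fun x : ℝ => (x + ε)⁻¹) a)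
  have hid : cfc (fun x : ℝ => x) a = a := cfc_id' ℝ a
  have haC : a * C = cfc (fun x : ℝ => x * (x + ε)⁻¹) a := by
    rw [cfc_mul (fun x => x) _ a continuousOn_id hcont, hid]
  have hCa : C * a = a * C := by
    rw [haC, hC]
    nth_rewrite 2 [← hid]
    rw [← cfc_mul _ (fun x => x) a hcont continuousOn_id]
    simp_rw [mul_comm]
  have haCn : ‖a * C‖ ≤ 1 := by
    rw [haC]
    refine norm_cfc_le zero_le_one fun x hx => ?_
    have := hspec x hx
    rw [Real.norm_eq_abs, abs_of_nonneg (by positivity), ← div_eq_mul_inv,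
      div_le_one (by positivity)]
    linarith
  have hTT : star T * T = a * a := (CFC.abs_mul_abs T).symm
  refine ⟨C * star T, ?_, ?_⟩
  · have h1 : ‖C * star T‖ * ‖C * star T‖ = ‖(C * a) * (a * C)‖ := by
      rw [← CStarRing.norm_self_mul_star, star_mul, star_star, hCsa]
      congr 1
      calc C * star T * (T * C) = C * (star T * T) * C := by noncomm_ring
        _ = (C * a) * (a * C) := by rw [hTT]; noncomm_ring
    have h2 : ‖(C * a) * (a * C)‖ ≤ 1 := by
      refine (norm_mul_le _ _).trans ?_
      rw [hCa]
      exact mul_le_one₀ haCn (norm_nonneg _) haCn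
    nlinarith [norm_nonneg (C * star T)]
  · have h1 : a - C * star T * T = cfc (fun x : ℝ => x - x * (x + ε)⁻¹ * x) a := by
      rw [mul_assoc, hTT, ← mul_assoc, hCa]
      have c1 : ContinuousOn (fun x : ℝ => x * (x + ε)⁻¹) (spectrum ℝ a) := continuousOn_id.mul hcont
      have c2 : ContinuousOn (fun x : ℝ => x * (x + ε)⁻¹ * x) (spectrum ℝ a) :=
        c1.mul continuousOn_id
      rw [cfc_sub (fun x => x) _ a continuousOn_id c2,
        cfc_mul _ (fun x => x) a c1 continuousOn_id, hid, ← haC]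
    rw [h1]
    refine norm_cfc_le hε.le fun x hx => ?_
    have := hspec x hx
    have e : x - x * (x + ε)⁻¹ * x = ε * x / (x + ε) := by field_simp; ring
    rw [e, Real.norm_eq_abs, abs_of_nonneg (by positivity), div_le_iff₀ (by positivity)]
    nlinarith

lemma NuclearBound.traceNorm_le {T : H →L[ℂ] H} {B : ℝ≥0∞} (h : NuclearBound T B) :
    traceNorm T ≤ B := by
  unfold traceNorm
  rw [ENNReal.tsum_eq_iSup_sum]
  refine iSup_le fun s => ?_
  refine ENNReal.le_of_forall_pos_le_add fun δ hδ _ => ?_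
  obtain ⟨V, hV, hVT⟩ := exists_approx_polar T (ε := δ / (s.card + 1)) (by positivity)
  have h1 : ∀ i, ENNReal.ofReal (⟪stdBasis H i, CFC.abs T (stdBasis H i)⟫_ℂ).re ≤
      ‖⟪stdBasis H i, V (T (stdBasis H i))⟫_ℂ‖ₑ + ENNReal.ofReal (δ / (s.card + 1)) := by
    intro i
    rw [← ofReal_norm, ← ENNReal.ofReal_add (norm_nonneg _) (by positivity)]
    refine ENNReal.ofReal_le_ofReal ?_
    have e : CFC.abs T (stdBasis H i) =
        V (T (stdBasis H i)) + (CFC.abs T - V * T) (stdBasis H i) := by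
      simp
    rw [e, inner_add_right, Complex.add_re]
    gcongr
    · exact Complex.re_le_norm _
    · refine (Complex.re_le_norm _).trans ((norm_inner_le_norm _ _).trans ?_)
      have hn : ‖stdBasis H i‖ = 1 := (stdBasis H).orthonormal.1 i
      rw [hn, one_mul]
      refine (ContinuousLinearMap.le_opNorm _ _).trans ?_
      rw [hn, mul_one]
      exact hVT
  refine (Finset.sum_le_sum fun i _ => h1 i).trans ?_
  rw [Finset.sum_add_distrib]
  gcongr
  · exact (ENNReal.sum_le_tsum s).trans (h V hV)
  · rw [Finset.sum_const, nsmul_eq_mul, ← ENNReal.ofReal_natCast, ← ENNReal.ofReal_mul (by positivity),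
      ← ENNReal.ofReal_coe_nnreal]
    refine ENNReal.ofReal_le_ofReal ?_
    rw [mul_div_assoc', div_le_iff₀ (by positivity)]
    have : (0 : ℝ) ≤ δ := δ.2
    nlinarith

end HilbertSchmidt

/-! ### Multiplication operators on `L²(ℝ)` -/

lemma memLp_bounded_mul {φ : ℝ → ℂ} (hφ : Measurable φ) (hb : ∀ x, ‖φ x‖ ≤ 1) (f : L2) :
    MemLp (fun x => φ x * f x) 2 volume := by
  refine (Lp.memLp f).of_le (hφ.aestronglyMeasurable.mul (Lp.memLp f).1) ?_
  refine Eventually.of_forall fun x => ?_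
  rw [norm_mul]
  exact mul_le_of_le_one_left (norm_nonneg _) (hb x)

/-- Multiplication by a measurable function bounded by `1`. -/
def mulOp (φ : ℝ → ℂ) (hφ : Measurable φ) (hb : ∀ x, ‖φ x‖ ≤ 1) : L2 →L[ℂ] L2 :=
  LinearMap.mkContinuous
    { toFun := fun f => (memLp_bounded_mul hφ hb f).toLp _
      map_add' := fun f g => by
        ext1
        filter_upwards [MemLp.coeFn_toLp (memLp_bounded_mul hφ hb (f + g)), Lp.coeFn_add f g,
          Lp.coeFn_add ((memLp_bounded_mul hφ hb f).toLp _) ((memLp_bounded_mul hφ hb g).toLp _),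
          MemLp.coeFn_toLp (memLp_bounded_mul hφ hb f),
          MemLp.coeFn_toLp (memLp_bounded_mul hφ hb g)] with x h1 h2 h3 h4 h5
        rw [h1, h2, h3, Pi.add_apply, Pi.add_apply, h4, h5, mul_add]
      map_smul' := fun c f => by
        ext1
        filter_upwards [MemLp.coeFn_toLp (memLp_bounded_mul hφ hb (c • f)), Lp.coeFn_smul c f,
          Lp.coeFn_smul c ((memLp_bounded_mul hφ hb f).toLp _),
          MemLp.coeFn_toLp (memLp_bounded_mul hφ hb f)] with x h1 h2 h3 h4
        rw [h1, h2, RingHom.id_apply, h3, Pi.smul_apply, Pi.smul_apply, h4, smul_eq_mul,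
          smul_eq_mul]
        ring } 1
    (fun f => by
      rw [one_mul]
      refine Lp.norm_le_norm_of_ae_le ?_
      filter_upwards [MemLp.coeFn_toLp (memLp_bounded_mul hφ hb f)] with x hx
      change ‖((memLp_bounded_mul hφ hb f).toLp _ : L2) x‖ ≤ _
      rw [hx, norm_mul]
      exact mul_le_of_le_one_left (norm_nonneg _) (hb x))

section mulOp

variable {φ : ℝ → ℂ} {hφ : Measurable φ} {hb : ∀ x, ‖φ x‖ ≤ 1}

lemma coeFn_mulOp (f : L2) : mulOp φ hφ hb f =ᵐ[volume] fun x => φ x * f x :=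
  MemLp.coeFn_toLp (memLp_bounded_mul hφ hb f)

lemma norm_mulOp_le : ‖mulOp φ hφ hb‖ ≤ 1 := LinearMap.mkContinuous_norm_le _ zero_le_one _

lemma norm_mulOp_apply (h1 : ∀ x, ‖φ x‖ = 1) (f : L2) : ‖mulOp φ hφ hb f‖ = ‖f‖ := by
  refine le_antisymm (Lp.norm_le_norm_of_ae_le ?_) (Lp.norm_le_norm_of_ae_le ?_) <;>
  · filter_upwards [coeFn_mulOp (hφ := hφ) (hb := hb) f] with x hx
    rw [hx, norm_mul, h1, one_mul]

end mulOp

/-- The projection `P̄₀`, multiplication by the indicator of `(-∞, 0]`. -/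
def cutOp : L2 →L[ℂ] L2 :=
  mulOp ((Set.Iic (0 : ℝ)).indicator 1) (measurable_one.indicator measurableSet_Iic) (fun x => by
    by_cases h : x ∈ Set.Iic (0 : ℝ) <;> simp [h])

lemma coeFn_cutOp (f : L2) : cutOp f =ᵐ[volume] (Set.Iic (0 : ℝ)).indicator f := by
  filter_upwards [coeFn_mulOp (hφ := measurable_one.indicator measurableSet_Iic)
    (φ := (Set.Iic (0 : ℝ)).indicator 1) (hb := fun x => by
    by_cases h : x ∈ Set.Iic (0 : ℝ) <;> simp [h]) f] with x hx
  unfold cutOp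
  rw [hx]
  by_cases h : x ∈ Set.Iic (0 : ℝ) <;> simp [h]

lemma cutOp_comp_cutOp : cutOp ∘L cutOp = cutOp := by
  ext1 f
  ext1
  filter_upwards [coeFn_cutOp (cutOp f), coeFn_cutOp f] with x h1 h2
  rw [ContinuousLinearMap.comp_apply, h1, h2]
  by_cases h : x ∈ Set.Iic (0 : ℝ) <;> simp [h, h2]

lemma adjoint_cutOp : ContinuousLinearMap.adjoint cutOp = cutOp := by
  symm
  rw [ContinuousLinearMap.eq_adjoint_iff]
  intro f g
  rw [L2.inner_def, L2.inner_def]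
  refine integral_congr_ae ?_
  filter_upwards [coeFn_cutOp f, coeFn_cutOp g] with x h1 h2
  rw [h1, h2]
  by_cases h : x ∈ Set.Iic (0 : ℝ) <;> simp [h]

/-- Multiplication by `e^{-|y|/4}`. -/
def weightOp : L2 →L[ℂ] L2 :=
  mulOp (fun y => (Real.exp (-|y| / 4) : ℂ)) (by fun_prop) (fun y => by
    rw [Complex.norm_real, Real.norm_eq_abs, abs_of_pos (Real.exp_pos _), Real.exp_le_one_iff]
    have := abs_nonneg y
    linarith)

lemma coeFn_weightOp (f : L2) :
    weightOp f =ᵐ[volume] fun y => Real.exp (-|y| / 4) • f y := coeFn_mulOp f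

/-! ### Integral operators with dominated kernels -/

/-- The measurable kernel `k` is dominated by a product of square integrable functions. -/
structure IsDominatedKernel (k : ℝ → ℝ → ℝ) (u v : ℝ → ℝ) : Prop where
  measurable : Measurable (Function.uncurry k)
  left : MemLp u 2 volume
  right : MemLp v 2 volume
  bound : ∀ x y, |k x y| ≤ u x * v y

namespace IsDominatedKernel

variable {k : ℝ → ℝ → ℝ} {u v : ℝ → ℝ}

lemma swap (h : IsDominatedKernel k u v) : IsDominatedKernel (fun x y => k y x) v u where
  measurable := h.measurable.comp measurable_swap
  left := h.right
  right := h.left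
  bound x y := by rw [mul_comm]; exact h.bound y x

lemma integrable_right_mul (h : IsDominatedKernel k u v) (f : L2) :
    Integrable (fun y => |v y| * ‖f y‖) :=
  (h.right.norm.integrable_mul (Lp.memLp f).norm)

lemma norm_smul_le (h : IsDominatedKernel k u v) (f : L2) (x y : ℝ) :
    ‖k x y • f y‖ ≤ |u x| * (|v y| * ‖f y‖) := by
  rw [norm_smul, ← mul_assoc, ← abs_mul]
  gcongr
  exact (h.bound x y).trans (le_abs_self _)

lemma integrable (h : IsDominatedKernel k u v) (f : L2) (x : ℝ) :
    Integrable (fun y => k x y • f y) := by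
  refine ((h.integrable_right_mul f).const_mul |u x|).mono' ?_
    (Eventually.of_forall fun y => h.norm_smul_le f x y)
  exact (h.measurable.of_uncurry_left).aestronglyMeasurable.smul (Lp.memLp f).1

lemma stronglyMeasurable (h : IsDominatedKernel k u v) (f : L2) :
    StronglyMeasurable (fun x => ∫ y, k x y • f y) := by
  refine StronglyMeasurable.integral_prod_right (f := fun x y => k x y • f y) ?_
  exact h.measurable.stronglyMeasurable.smul
    ((Lp.stronglyMeasurable f).comp_measurable measurable_snd)

lemma norm_integral_le (h : IsDominatedKernel k u v) (f : L2) (x : ℝ) :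
    ‖∫ y, k x y • f y‖ ≤ |u x| * ∫ y, |v y| * ‖f y‖ := by
  rw [← integral_const_mul]
  exact norm_integral_le_of_norm_le ((h.integrable_right_mul f).const_mul _)
    (Eventually.of_forall fun y => h.norm_smul_le f x y)

lemma memLp (h : IsDominatedKernel k u v) (f : L2) :
    MemLp (fun x => ∫ y, k x y • f y) 2 volume := by
  refine (h.left.norm.mul_const (∫ y, |v y| * ‖f y‖)).of_le
    (h.stronglyMeasurable f).aestronglyMeasurable ?_
  refine Eventually.of_forall fun x => (h.norm_integral_le f x).trans (le_abs_self _)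

lemma integral_right_mul_le (h : IsDominatedKernel k u v) (f : L2) :
    ∫ y, |v y| * ‖f y‖ ≤ ‖h.right.norm.toLp‖ * ‖f‖ := by
  have hf := (Lp.memLp f).norm
  have e : ∫ y, |v y| * ‖f y‖ = ⟪h.right.norm.toLp, hf.toLp⟫_ℝ := by
    rw [L2.inner_def]
    refine integral_congr_ae ?_
    filter_upwards [h.right.norm.coeFn_toLp, hf.coeFn_toLp] with y h1 h2
    rw [h1, h2]
    simp [mul_comm]
  have hn : ‖hf.toLp‖ = ‖f‖ := by
    rw [Lp.norm_toLp, Lp.norm_def, eLpNorm_norm]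
  rw [e, ← hn]
  exact real_inner_le_norm _ _

/-- The integral operator with a dominated kernel. -/
def op (h : IsDominatedKernel k u v) : L2 →L[ℂ] L2 :=
  LinearMap.mkContinuous
    { toFun := fun f => (h.memLp f).toLp _
      map_add' := fun f g => by
        ext1
        filter_upwards [(h.memLp (f + g)).coeFn_toLp, Lp.coeFn_add ((h.memLp f).toLp _)
          ((h.memLp g).toLp _), (h.memLp f).coeFn_toLp, (h.memLp g).coeFn_toLp] with x h1 h3 h4 h5
        rw [h1, h3, Pi.add_apply, h4, h5, ← integral_add (h.integrable f x) (h.integrable g x)]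
        refine integral_congr_ae ?_
        filter_upwards [Lp.coeFn_add f g] with y hy
        rw [hy, Pi.add_apply, smul_add]
      map_smul' := fun c f => by
        ext1
        filter_upwards [(h.memLp (c • f)).coeFn_toLp, Lp.coeFn_smul c ((h.memLp f).toLp _),
          (h.memLp f).coeFn_toLp] with x h1 h3 h4
        rw [h1, RingHom.id_apply, h3, Pi.smul_apply, h4, ← integral_smul]
        refine integral_congr_ae ?_
        filter_upwards [Lp.coeFn_smul c f] with y hy
        rw [hy, Pi.smul_apply, smul_comm] }
    (‖h.left.norm.toLp‖ * ‖h.right.norm.toLp‖)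
    (fun f => by
      change ‖(h.memLp f).toLp _‖ ≤ _
      have : ‖(h.memLp f).toLp _‖ ≤ (∫ y, |v y| * ‖f y‖) * ‖h.left.norm.toLp‖ := by
        refine Lp.norm_le_mul_norm_of_ae_le_mul ?_
        filter_upwards [(h.memLp f).coeFn_toLp, h.left.norm.coeFn_toLp] with x h1 h2
        rw [h1, h2, mul_comm, norm_norm]
        exact h.norm_integral_le f x
      refine this.trans ?_
      have := h.integral_right_mul_le f
      calc _ ≤ (‖h.right.norm.toLp‖ * ‖f‖) * ‖h.left.norm.toLp‖ := by gcongr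
        _ = _ := by ring)

lemma coeFn_op (h : IsDominatedKernel k u v) (f : L2) :
    h.op f =ᵐ[volume] fun x => ∫ y, k x y • f y := (h.memLp f).coeFn_toLp

lemma integrable_prod (h : IsDominatedKernel k u v) (f g : L2) :
    Integrable (fun p : ℝ × ℝ => ⟪f p.1, k p.1 p.2 • g p.2⟫_ℂ) := by
  have h1 : Integrable (fun p : ℝ × ℝ => (|u p.1| * ‖f p.1‖) * (|v p.2| * ‖g p.2‖)) :=
    (h.swap.integrable_right_mul f).mul_prod (h.integrable_right_mul g)
  refine h1.mono' ?_ (Eventually.of_forall fun p => ?_)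
  · refine AEStronglyMeasurable.inner ?_ ?_
    · exact ((Lp.stronglyMeasurable f).comp_measurable measurable_fst).aestronglyMeasurable
    · exact h.measurable.aestronglyMeasurable.smul
        ((Lp.stronglyMeasurable g).comp_measurable measurable_snd).aestronglyMeasurable
  · refine (norm_inner_le_norm _ _).trans ?_
    calc _ ≤ ‖f p.1‖ * (|u p.1| * (|v p.2| * ‖g p.2‖)) := by
          gcongr
          exact h.norm_smul_le g _ _
      _ = _ := by ring

lemma adjoint_op (h : IsDominatedKernel k u v) :
    ContinuousLinearMap.adjoint h.op = h.swap.op := by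
  symm
  rw [ContinuousLinearMap.eq_adjoint_iff]
  intro f g
  have e1 : ⟪h.swap.op f, g⟫_ℂ = ∫ y, ∫ x, ⟪f x, k x y • g y⟫_ℂ := by
    rw [L2.inner_def]
    refine integral_congr_ae ?_
    filter_upwards [h.swap.coeFn_op f] with y hy
    rw [hy, ← inner_conj_symm, ← integral_inner (h.swap.integrable f y), ← integral_conj]
    refine integral_congr_ae (Eventually.of_forall fun x => ?_)
    simp only
    rw [inner_conj_symm, RCLike.real_smul_eq_coe_smul (K := ℂ),
      RCLike.real_smul_eq_coe_smul (K := ℂ), inner_smul_left, inner_smul_right]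
    simp
  have e2 : ⟪f, h.op g⟫_ℂ = ∫ x, ∫ y, ⟪f x, k x y • g y⟫_ℂ := by
    rw [L2.inner_def]
    refine integral_congr_ae ?_
    filter_upwards [h.coeFn_op g] with x hx
    rw [hx, integral_inner (h.integrable g x)]
  rw [e1, e2]
  exact (integral_integral_swap (h.integrable_prod f g)).symm

lemma hasKernel_op (h : IsDominatedKernel k u v) : HasKernel k h.op := by
  intro f hf hs
  have e : ∀ x, (fun y => k x y • (hf.memLp_of_hasCompactSupport (p := 2) (μ := volume) hs).toLp f y)
      =ᵐ[volume] fun y => k x y • f y := fun x => by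
    filter_upwards [(hf.memLp_of_hasCompactSupport (p := 2) (μ := volume) hs).coeFn_toLp] with y hy
    rw [hy]
  refine ⟨Eventually.of_forall fun x => (h.integrable _ x).congr (e x), ?_⟩
  filter_upwards [h.coeFn_op _] with x hx
  rw [hx]
  exact integral_congr_ae (e x)

lemma op_sub {k₁ k₂ : ℝ → ℝ → ℝ} {u₁ v₁ u₂ v₂ u v : ℝ → ℝ} (h₁ : IsDominatedKernel k₁ u₁ v₁)
    (h₂ : IsDominatedKernel k₂ u₂ v₂) (h : IsDominatedKernel (fun x y => k₁ x y - k₂ x y) u v) :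
    h₁.op - h₂.op = h.op := by
  ext1 f
  ext1
  rw [_root_.sub_apply]
  filter_upwards [Lp.coeFn_sub (h₁.op f) (h₂.op f), h₁.coeFn_op f, h₂.coeFn_op f,
    h.coeFn_op f] with x h3 h4 h5 h6
  rw [h3, Pi.sub_apply, h4, h5, h6, ← integral_sub (h₁.integrable f x) (h₂.integrable f x)]
  simp_rw [sub_smul]

/-- The Hilbert–Schmidt norm of an integral operator is at most the `L²` norm of its kernel. -/
lemma hsSq_op_le (h : IsDominatedKernel k u v) :
    hsSq h.op ≤ ∫⁻ x, ∫⁻ y, ‖k x y‖ₑ ^ 2 := by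
  have hk : ∀ x, MemLp (fun y => (k x y : ℂ)) 2 volume := fun x => by
    refine (h.right.norm.const_mul (|u x|)).of_le ?_ (Eventually.of_forall fun y => ?_)
    · exact (Complex.measurable_ofReal.comp h.measurable.of_uncurry_left).aestronglyMeasurable
    · rw [Complex.norm_real, Real.norm_eq_abs]
      refine (h.bound x y).trans ((le_abs_self _).trans ?_)
      rw [abs_mul, Real.norm_eq_abs, Real.norm_eq_abs, abs_mul, abs_abs, abs_abs]
  have hin : ∀ x (f : L2), ∫ y, k x y • f y = ⟪(hk x).toLp, f⟫_ℂ := fun x f => by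
    rw [L2.inner_def]
    refine integral_congr_ae ?_
    filter_upwards [(hk x).coeFn_toLp] with y hy
    rw [hy, RCLike.inner_apply, Complex.conj_ofReal, Complex.real_smul, mul_comm]
  unfold hsSq
  rw [ENNReal.tsum_eq_iSup_sum]
  refine iSup_le fun s => ?_
  have h1 : ∀ f : L2, ‖h.op f‖ₑ ^ 2 = ∫⁻ x, ‖⟪(hk x).toLp, f⟫_ℂ‖ₑ ^ 2 := fun f => by
    rw [Lp.enorm_def, eLpNorm_eq_lintegral_rpow_enorm_toReal (by norm_num) (by norm_num)]
    simp only [ENNReal.toReal_ofNat, ENNReal.rpow_two]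
    rw [← ENNReal.rpow_natCast, ← ENNReal.rpow_mul]
    norm_num
    refine lintegral_congr_ae ?_
    filter_upwards [h.coeFn_op f] with x hx
    rw [hx, hin]
  simp_rw [h1]
  rw [← lintegral_finsetSum']
  · refine lintegral_mono fun x => ?_
    have hB := (stdBasis L2).orthonormal.sum_inner_products_le ((hk x).toLp) (s := s)
    have h2 : ‖(hk x).toLp‖ₑ ^ 2 = ∫⁻ y, ‖k x y‖ₑ ^ 2 := by
      rw [Lp.enorm_toLp, eLpNorm_eq_lintegral_rpow_enorm_toReal (by norm_num) (by norm_num)]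
      simp only [ENNReal.toReal_ofNat, ENNReal.rpow_two]
      rw [← ENNReal.rpow_natCast, ← ENNReal.rpow_mul]
      norm_num
      refine lintegral_congr fun y => ?_
      rw [← ofReal_norm, ← ofReal_norm, Complex.norm_real]
    rw [← h2]
    have h3 := ENNReal.ofReal_le_ofReal hB
    rw [ENNReal.ofReal_sum_of_nonneg (fun i _ => by positivity)] at h3
    simp_rw [ENNReal.ofReal_pow (norm_nonneg _), ofReal_norm] at h3
    refine le_trans (le_of_eq ?_) h3
    refine Finset.sum_congr rfl fun i _ => ?_
    rw [← ofReal_norm, ← ofReal_norm, norm_inner_symm]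
  · intro i _
    simp_rw [← hin]
    exact (h.stronglyMeasurable _).measurable.enorm.pow_const 2 |>.aemeasurable

end IsDominatedKernel

section

open scoped ContDiff FourierTransform

/-! ### Integral operators tested against smooth functions -/

/-- A real smooth compactly supported function. -/
structure IsTest (χ : ℝ → ℝ) : Prop where
  smooth : ContDiff ℝ ∞ χ
  supp : HasCompactSupport χ

namespace IsTest

variable {χ : ℝ → ℝ}

lemma ofReal_smooth (h : IsTest χ) : ContDiff ℝ ∞ fun x => (χ x : ℂ) :=
  Complex.ofRealCLM.contDiff.comp h.smooth

lemma ofReal_supp (h : IsTest χ) : HasCompactSupport fun x => (χ x : ℂ) :=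
  h.supp.comp_left (g := fun x : ℝ => (x : ℂ)) Complex.ofReal_zero

/-- A test function as an element of `L²(ℝ)`. -/
def toL2 (h : IsTest χ) : L2 :=
  (h.ofReal_smooth.continuous.memLp_of_hasCompactSupport h.ofReal_supp).toLp _

lemma coeFn_toL2 (h : IsTest χ) : h.toL2 =ᵐ[volume] fun x => (χ x : ℂ) := MemLp.coeFn_toLp _

lemma inner_toL2 (h : IsTest χ) (f : L2) : ⟪h.toL2, f⟫_ℂ = ∫ x, χ x • f x := by
  rw [L2.inner_def]
  refine integral_congr_ae ?_
  filter_upwards [h.coeFn_toL2] with y hy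
  rw [hy, RCLike.inner_apply, Complex.conj_ofReal, Complex.real_smul, mul_comm]

lemma toL2_eq_schwartz (h : IsTest χ) :
    h.toL2 = (h.ofReal_supp.toSchwartzMap h.ofReal_smooth).toLp 2 volume := by
  ext1
  filter_upwards [h.coeFn_toL2,
    (h.ofReal_supp.toSchwartzMap h.ofReal_smooth).coeFn_toLp 2 volume] with x h1 h2
  rw [h1, h2]
  rfl

lemma integrable_mul (h : IsTest χ) {w : ℝ → ℝ} (hw : Continuous w) :
    Integrable fun x => χ x * w x :=
  (h.smooth.continuous.mul hw).integrable_of_hasCompactSupport h.supp.mul_right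

end IsTest

lemma ae_eq_of_forall_test {f g : ℝ → ℂ} (hf : LocallyIntegrable f) (hg : LocallyIntegrable g)
    (h : ∀ χ, IsTest χ → ∫ x, χ x • f x = ∫ x, χ x • g x) : f =ᵐ[volume] g :=
  ae_eq_of_integral_contDiff_smul_eq hf hg fun χ h1 h2 => h χ ⟨h1, h2⟩

lemma locallyIntegrable_L2 (f : L2) : LocallyIntegrable f volume :=
  (Lp.memLp f).locallyIntegrable (by norm_num)

/-- The bounded operator `T` is given by the kernel `k`, which is dominated by `U(x) V(y)`, on test
functions. -/
structure HasTestKernel (k : ℝ → ℝ → ℝ) (U V : ℝ → ℝ) (T : L2 →L[ℂ] L2) : Prop where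
  cont : Continuous (Function.uncurry k)
  contU : Continuous U
  contV : Continuous V
  posU : ∀ x, 0 ≤ U x
  posV : ∀ x, 0 ≤ V x
  bound : ∀ x y, |k x y| ≤ U x * V y
  eq : ∀ χ f (hχ : IsTest χ) (hf : IsTest f),
    ⟪hχ.toL2, T hf.toL2⟫_ℂ = ((∫ x, ∫ y, χ x * k x y * f y : ℝ) : ℂ)

namespace HasTestKernel

variable {k : ℝ → ℝ → ℝ} {U V : ℝ → ℝ} {T : L2 →L[ℂ] L2}

lemma integrable_test (h : HasTestKernel k U V T) {χ f : ℝ → ℝ} (hχ : IsTest χ) (hf : IsTest f) :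
    Integrable fun p : ℝ × ℝ => χ p.1 * k p.1 p.2 * f p.2 := by
  refine (((hχ.integrable_mul h.contU).norm).mul_prod
    ((hf.integrable_mul h.contV).norm)).mono' ?_ (Eventually.of_forall fun p => ?_)
  · have := h.cont
    have h1 := hχ.smooth.continuous
    have h2 := hf.smooth.continuous
    refine Continuous.aestronglyMeasurable ?_
    exact ((h1.comp continuous_fst).mul h.cont).mul (h2.comp continuous_snd)
  · simp only [norm_mul, Real.norm_eq_abs, abs_of_nonneg (h.posU _), abs_of_nonneg (h.posV _)]
    calc _ ≤ |χ p.1| * (U p.1 * V p.2) * |f p.2| := by gcongr; exact h.bound _ _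
      _ = _ := by ring

lemma adjoint (h : HasTestKernel k U V T) :
    HasTestKernel (fun x y => k y x) V U (ContinuousLinearMap.adjoint T) where
  cont := h.cont.comp continuous_swap
  contU := h.contV
  contV := h.contU
  posU := h.posV
  posV := h.posU
  bound x y := by rw [mul_comm]; exact h.bound y x
  eq χ f hχ hf := by
    rw [ContinuousLinearMap.adjoint_inner_right, ← inner_conj_symm, h.eq f χ hf hχ,
      Complex.conj_ofReal, integral_integral_swap (h.integrable_test hf hχ)]
    congr 1
    refine integral_congr_ae (Eventually.of_forall fun x => integral_congr_ae
      (Eventually.of_forall fun y => ?_))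
    simp only
    ring

lemma measurable_kernel (h : HasTestKernel k U V T) : Measurable (Function.uncurry k) :=
  h.cont.measurable

lemma integrable (h : HasTestKernel k U V T) {F : ℝ → ℂ} (hF : AEStronglyMeasurable F)
    (hV : Integrable fun y => V y * ‖F y‖) (x : ℝ) : Integrable fun y => k x y • F y := by
  refine (hV.const_mul (U x)).mono' ?_ (Eventually.of_forall fun y => ?_)
  · exact (h.measurable_kernel.of_uncurry_left).aestronglyMeasurable.smul hF
  · rw [norm_smul, ← mul_assoc]
    gcongr
    exact h.bound x y

lemma norm_integral_le (h : HasTestKernel k U V T) {F : ℝ → ℂ}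
    (hV : Integrable fun y => V y * ‖F y‖) (x : ℝ) :
    ‖∫ y, k x y • F y‖ ≤ U x * ∫ y, V y * ‖F y‖ := by
  rw [← integral_const_mul]
  refine norm_integral_le_of_norm_le (hV.const_mul _) (Eventually.of_forall fun y => ?_)
  rw [norm_smul, ← mul_assoc]
  gcongr
  exact h.bound x y

lemma integrable_prod (h : HasTestKernel k U V T) {F : ℝ → ℂ} (hF : StronglyMeasurable F)
    (hV : Integrable fun y => V y * ‖F y‖) {χ : ℝ → ℝ} (hχ : IsTest χ) :
    Integrable fun p : ℝ × ℝ => χ p.1 • k p.1 p.2 • F p.2 := by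
  refine ((hχ.integrable_mul h.contU).norm.mul_prod hV).mono' ?_ (Eventually.of_forall fun p => ?_)
  · refine StronglyMeasurable.aestronglyMeasurable ?_
    exact (hχ.smooth.continuous.comp continuous_fst).stronglyMeasurable.smul
      (h.cont.stronglyMeasurable.smul (hF.comp_measurable measurable_snd))
  · rw [norm_smul, norm_smul, norm_mul, Real.norm_eq_abs, Real.norm_eq_abs, Real.norm_eq_abs,
      abs_of_nonneg (h.posU _)]
    calc _ ≤ |χ p.1| * ((U p.1 * V p.2) * ‖F p.2‖) := by gcongr; exact h.bound _ _
      _ = _ := by ring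

lemma locallyIntegrable_integral (h : HasTestKernel k U V T) {F : ℝ → ℂ}
    (hF : StronglyMeasurable F) (hV : Integrable fun y => V y * ‖F y‖) :
    LocallyIntegrable fun x => ∫ y, k x y • F y := by
  have hc : LocallyIntegrable (fun x => U x * ∫ y, V y * ‖F y‖) volume :=
    (h.contU.mul continuous_const).locallyIntegrable
  refine hc.mono ?_ (Eventually.of_forall fun x =>
    (h.norm_integral_le hV x).trans (le_abs_self _))
  refine (StronglyMeasurable.integral_prod_right (f := fun x y => k x y • F y)
    ?_).aestronglyMeasurable
  exact h.cont.stronglyMeasurable.smul (hF.comp_measurable measurable_snd)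

lemma coeFn_adjoint_test (h : HasTestKernel k U V T) {χ : ℝ → ℝ} (hχ : IsTest χ) :
    ContinuousLinearMap.adjoint T hχ.toL2 =ᵐ[volume] fun y => ∫ x, k x y • (χ x : ℂ) := by
  have hi : Integrable fun y => U y * ‖(χ y : ℂ)‖ := by
    refine (hχ.integrable_mul h.contU).norm.congr (Eventually.of_forall fun y => ?_)
    simp only [norm_mul, Complex.norm_real, Real.norm_eq_abs, abs_of_nonneg (h.posU _)]
    ring
  refine ae_eq_of_forall_test (locallyIntegrable_L2 _)
    (h.adjoint.locallyIntegrable_integral (F := fun x => (χ x : ℂ))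
      hχ.ofReal_smooth.continuous.stronglyMeasurable hi) fun f hf => ?_
  rw [← hf.inner_toL2, h.adjoint.eq f χ hf hχ, ← integral_complex_ofReal]
  refine integral_congr_ae (Eventually.of_forall fun x => ?_)
  simp only
  rw [← integral_smul, ← integral_complex_ofReal]
  refine integral_congr_ae (Eventually.of_forall fun y => ?_)
  simp only [Complex.real_smul]
  push_cast
  ring

/-- The integral representation of `T F` for all `F` for which the integral makes sense. -/
lemma coeFn_apply (h : HasTestKernel k U V T) (F : L2) (hV : Integrable fun y => V y * ‖F y‖) :
    T F =ᵐ[volume] fun x => ∫ y, k x y • F y := by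
  refine ae_eq_of_forall_test (locallyIntegrable_L2 _)
    (h.locallyIntegrable_integral (Lp.stronglyMeasurable F) hV) fun χ hχ => ?_
  rw [← hχ.inner_toL2, ← ContinuousLinearMap.adjoint_inner_left, L2.inner_def]
  have e1 : ∫ y, ⟪ContinuousLinearMap.adjoint T hχ.toL2 y, F y⟫_ℂ =
      ∫ y, ∫ x, χ x • k x y • F y := by
    refine integral_congr_ae ?_
    filter_upwards [h.coeFn_adjoint_test hχ] with y hy
    have hr : ∫ x, k x y • (χ x : ℂ) = ((∫ x, χ x * k x y : ℝ) : ℂ) := by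
      rw [← integral_complex_ofReal]
      refine integral_congr_ae (Eventually.of_forall fun x => ?_)
      simp only [Complex.real_smul]
      push_cast
      ring
    rw [hy, hr, RCLike.inner_apply, Complex.conj_ofReal]
    simp_rw [smul_smul]
    rw [integral_smul_const, Complex.real_smul, mul_comm]
  rw [e1, ← integral_integral_swap (h.integrable_prod (Lp.stronglyMeasurable F) hV hχ)]
  refine integral_congr_ae (Eventually.of_forall fun x => ?_)
  exact integral_smul _ _

lemma hasKernel (h : HasTestKernel k U V T) : HasKernel k T := by
  intro f hf hs
  have hV : Integrable fun y => V y * ‖f y‖ := by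
    refine (h.contV.mul hf.norm).integrable_of_hasCompactSupport ?_
    exact hs.norm.mul_left
  have hae := (hf.memLp_of_hasCompactSupport (p := 2) (μ := volume) hs).coeFn_toLp
  refine ⟨Eventually.of_forall fun x => h.integrable hf.aestronglyMeasurable hV x, ?_⟩
  have := h.coeFn_apply ((hf.memLp_of_hasCompactSupport (p := 2) (μ := volume) hs).toLp f)
    (hV.congr (by filter_upwards [hae] with y hy; rw [hy]))
  filter_upwards [this] with x hx
  rw [hx]
  refine integral_congr_ae ?_
  filter_upwards [hae] with y hy
  rw [hy]

end HasTestKernel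

lemma HasKernel.kernelOp_eq {k : ℝ → ℝ → ℝ} {T : L2 →L[ℂ] L2} (h : HasKernel k T) :
    kernelOp k = T := by
  have hb : IsBoundedKernel k := ⟨T, h⟩
  unfold kernelOp
  rw [dif_pos hb]
  exact hb.choose_spec.unique h

/-! ### The Airy transform -/

/-- The symbol `e^{i(2πk)³/3}` of the Airy transform. -/
def airySymbol (k : ℝ) : ℂ := Complex.exp (((2 * Real.pi * k) ^ 3 / 3 : ℝ) * Complex.I)

lemma norm_airySymbol (k : ℝ) : ‖airySymbol k‖ = 1 := Complex.norm_exp_ofReal_mul_I _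

@[fun_prop]
lemma continuous_airySymbol : Continuous airySymbol := by unfold airySymbol; fun_prop

/-- The Airy transform as a Fourier multiplier. -/
def airyA : L2 →L[ℂ] L2 :=
  ((Lp.fourierTransformₗᵢ ℝ ℂ).symm : L2 →L[ℂ] L2) ∘L
    mulOp airySymbol continuous_airySymbol.measurable (fun k => (norm_airySymbol k).le) ∘L
    ((Lp.fourierTransformₗᵢ ℝ ℂ) : L2 →L[ℂ] L2)

lemma norm_airyA_apply (f : L2) : ‖airyA f‖ = ‖f‖ := by
  unfold airyA
  simp only [ContinuousLinearMap.comp_apply]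
  erw [LinearIsometryEquiv.norm_map, norm_mulOp_apply norm_airySymbol,
    LinearIsometryEquiv.norm_map]

lemma adjoint_airyA_comp_airyA : ContinuousLinearMap.adjoint airyA ∘L airyA = 1 :=
  (ContinuousLinearMap.norm_map_iff_adjoint_comp_self airyA).1 norm_airyA_apply

lemma norm_airyA_le : ‖airyA‖ ≤ 1 :=
  ContinuousLinearMap.opNorm_le_bound _ zero_le_one fun f => by rw [norm_airyA_apply, one_mul]

lemma norm_adjoint_airyA_le : ‖ContinuousLinearMap.adjoint airyA‖ ≤ 1 := by
  rw [LinearIsometryEquiv.norm_map]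
  exact norm_airyA_le

lemma integral_airySymbol_regularized {ε : ℝ} (hε : 0 < ε) (x : ℝ) :
    ∫ k : ℝ, airySymbol k * Real.exp (-ε * (2 * Real.pi * k) ^ 2) *
      Complex.exp ((2 * Real.pi * k * x : ℝ) * Complex.I) = invHeatAiry (-ε) x := by
  rw [ofReal_invHeatAiry x (by linarith : -ε < 0), airyInt]
  have h := Measure.integral_comp_mul_left (fun s => airyIntegrand (-ε) x 0 s) (-(2 * Real.pi))
  have h2 : |(-(2 * Real.pi))⁻¹| = (2 * Real.pi)⁻¹ := by
    rw [inv_neg, abs_neg, abs_of_pos (by positivity)]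
  rw [h2] at h
  rw [Complex.real_smul] at h
  push_cast at h ⊢
  rw [← h]
  refine integral_congr_ae (Eventually.of_forall fun k => ?_)
  simp only [airyIntegrand, airySymbol, ← Complex.exp_add]
  congr 1
  have h3 : Complex.I ^ 3 = -Complex.I := by rw [pow_succ, Complex.I_sq]; ring
  push_cast
  ring_nf
  rw [h3, Complex.I_sq]
  ring

end

section

open scoped ContDiff FourierTransform

/-- The integral `∫ χ(x) e^{2πikx} dx`. -/
def testFourier (χ : ℝ → ℝ) (k : ℝ) : ℂ :=
  ∫ x, χ x * Complex.exp ((2 * Real.pi * k * x : ℝ) * Complex.I)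

lemma IsTest.fourier_toL2 {χ : ℝ → ℝ} (h : IsTest χ) :
    Lp.fourierTransformₗᵢ ℝ ℂ h.toL2 =ᵐ[volume] fun k => testFourier χ (-k) := by
  have e : Lp.fourierTransformₗᵢ ℝ ℂ h.toL2 =
      (𝓕 (h.ofReal_supp.toSchwartzMap h.ofReal_smooth)).toLp 2 volume := by
    rw [h.toL2_eq_schwartz]
    exact SchwartzMap.toLp_fourier_eq _
  rw [e]
  filter_upwards [SchwartzMap.coeFn_toLp (𝓕 (h.ofReal_supp.toSchwartzMap h.ofReal_smooth)) 2
    volume] with k hk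
  rw [hk, SchwartzMap.fourier_coe, Real.fourier_real_eq, testFourier]
  refine integral_congr_ae (Eventually.of_forall fun x => ?_)
  simp only [Circle.smul_def, Real.fourierChar_apply, smul_eq_mul]
  rw [mul_comm]
  change (χ x : ℂ) * _ = _
  congr 3
  push_cast
  ring

lemma IsTest.conj_testFourier {χ : ℝ → ℝ} (k : ℝ) :
    (starRingEnd ℂ) (testFourier χ k) = testFourier χ (-k) := by
  unfold testFourier
  rw [← integral_conj]
  refine integral_congr_ae (Eventually.of_forall fun x => ?_)
  simp only [map_mul, Complex.conj_ofReal, ← Complex.exp_conj, Complex.conj_I]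
  congr 2
  push_cast
  ring

lemma IsTest.integrable_testFourier_mul {χ f : ℝ → ℝ} (hχ : IsTest χ) (hf : IsTest f) :
    Integrable fun k => testFourier χ k * airySymbol k * testFourier f (-k) := by
  have h1 := (Lp.memLp (Lp.fourierTransformₗᵢ ℝ ℂ hχ.toL2))
  have h2 := (Lp.memLp (mulOp airySymbol continuous_airySymbol.measurable
    (fun k => (norm_airySymbol k).le) (Lp.fourierTransformₗᵢ ℝ ℂ hf.toL2)))
  refine (h1.star.integrable_mul h2).congr ?_
  filter_upwards [hχ.fourier_toL2, hf.fourier_toL2, coeFn_mulOp (φ := airySymbol)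
    (hφ := continuous_airySymbol.measurable) (hb := fun k => (norm_airySymbol k).le)
    (Lp.fourierTransformₗᵢ ℝ ℂ hf.toL2)] with k h3 h4 h5
  simp only [Pi.mul_apply, Pi.star_apply]
  rw [h5, h3, h4, ← mul_assoc, ← starRingEnd_apply, IsTest.conj_testFourier, neg_neg]

lemma inner_airyA {χ f : ℝ → ℝ} (hχ : IsTest χ) (hf : IsTest f) :
    ⟪hχ.toL2, airyA hf.toL2⟫_ℂ =
      ∫ k, testFourier χ k * airySymbol k * testFourier f (-k) := by
  have e : ⟪hχ.toL2, airyA hf.toL2⟫_ℂ = ⟪Lp.fourierTransformₗᵢ ℝ ℂ hχ.toL2,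
      mulOp airySymbol continuous_airySymbol.measurable (fun k => (norm_airySymbol k).le)
        (Lp.fourierTransformₗᵢ ℝ ℂ hf.toL2)⟫_ℂ := by
    rw [← (Lp.fourierTransformₗᵢ ℝ ℂ).inner_map_map hχ.toL2]
    congr 1
    exact (Lp.fourierTransformₗᵢ ℝ ℂ).apply_symm_apply _
  rw [e, L2.inner_def]
  refine integral_congr_ae ?_
  filter_upwards [hχ.fourier_toL2, hf.fourier_toL2, coeFn_mulOp (φ := airySymbol)
    (hφ := continuous_airySymbol.measurable) (hb := fun k => (norm_airySymbol k).le)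
    (Lp.fourierTransformₗᵢ ℝ ℂ hf.toL2)] with k h3 h4 h5
  rw [h5, h3, h4, RCLike.inner_apply, IsTest.conj_testFourier, neg_neg]
  ring

lemma integral_testFourier_regularized {χ f : ℝ → ℝ} (hχ : IsTest χ) (hf : IsTest f) {ε : ℝ}
    (hε : 0 < ε) :
    ∫ k : ℝ, testFourier χ k * airySymbol k * testFourier f (-k) *
        Real.exp (-ε * (2 * Real.pi * k) ^ 2) =
      ((∫ p : ℝ × ℝ, χ p.1 * invHeatAiry (-ε) (p.1 - p.2) * f p.2 : ℝ) : ℂ) := by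
  have hχi : Integrable χ := hχ.smooth.continuous.integrable_of_hasCompactSupport hχ.supp
  have hfi : Integrable f := hf.smooth.continuous.integrable_of_hasCompactSupport hf.supp
  have hχc := hχ.smooth.continuous
  have hfc := hf.smooth.continuous
  have e1 : ∀ k : ℝ, testFourier χ k * airySymbol k * testFourier f (-k) *
      Real.exp (-ε * (2 * Real.pi * k) ^ 2) = ∫ p : ℝ × ℝ, (χ p.1 * f p.2 : ℝ) *
        (airySymbol k * Real.exp (-ε * (2 * Real.pi * k) ^ 2) *
          Complex.exp ((2 * Real.pi * k * (p.1 - p.2) : ℝ) * Complex.I)) := by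
    intro k
    have c : testFourier χ k * airySymbol k * testFourier f (-k) *
        Real.exp (-ε * (2 * Real.pi * k) ^ 2) = testFourier χ k * testFourier f (-k) *
        (airySymbol k * Real.exp (-ε * (2 * Real.pi * k) ^ 2)) := by ring
    rw [c, testFourier, testFourier, ← integral_prod_mul, ← integral_mul_const]
    refine integral_congr_ae (Eventually.of_forall fun p => ?_)
    simp only
    have : Complex.exp ((2 * Real.pi * k * (p.1 - p.2) : ℝ) * Complex.I) =
        Complex.exp ((2 * Real.pi * k * p.1 : ℝ) * Complex.I) *
        Complex.exp ((2 * Real.pi * -k * p.2 : ℝ) * Complex.I) := by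
      rw [← Complex.exp_add]
      congr 1
      push_cast
      ring
    rw [this]
    push_cast
    ring
  simp_rw [e1]
  have hgauss : Integrable fun k : ℝ => Real.exp (-ε * (2 * Real.pi * k) ^ 2) := by
    have := integrable_exp_neg_mul_sq (b := ε * (2 * Real.pi) ^ 2) (by positivity)
    refine this.congr (Eventually.of_forall fun k => ?_)
    simp only
    congr 1
    ring
  rw [integral_integral_swap, ← integral_complex_ofReal]
  · refine integral_congr_ae (Eventually.of_forall fun p => ?_)
    simp only
    rw [integral_const_mul, integral_airySymbol_regularized hε]
    push_cast
    ring
  · refine (hgauss.mul_prod (hχi.norm.mul_prod hfi.norm)).mono' ?_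
      (Eventually.of_forall fun p => le_of_eq ?_)
    · refine Continuous.aestronglyMeasurable ?_
      unfold Function.uncurry
      fun_prop
    · simp only [Function.uncurry, norm_mul, Complex.norm_real, norm_airySymbol,
        Complex.norm_exp_ofReal_mul_I, Real.norm_eq_abs, Real.abs_exp]
      ring

lemma integral_test_airyAi {χ f : ℝ → ℝ} (hχ : IsTest χ) (hf : IsTest f) :
    ∫ k, testFourier χ k * airySymbol k * testFourier f (-k) =
      ((∫ p : ℝ × ℝ, χ p.1 * airyAi (p.1 - p.2) * f p.2 : ℝ) : ℂ) := by
  have hχc := hχ.smooth.continuous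
  have hfc := hf.smooth.continuous
  have hl : Tendsto (fun ε : ℝ => ∫ k : ℝ, testFourier χ k * airySymbol k * testFourier f (-k) *
        Real.exp (-ε * (2 * Real.pi * k) ^ 2)) (𝓝[>] 0)
      (𝓝 (∫ k, testFourier χ k * airySymbol k * testFourier f (-k))) := by
    refine tendsto_integral_filter_of_dominated_convergence
      (fun k => ‖testFourier χ k * airySymbol k * testFourier f (-k)‖) ?_ ?_
      (hχ.integrable_testFourier_mul hf).norm ?_
    · refine Eventually.of_forall fun ε => (hχ.integrable_testFourier_mul hf).1.mul ?_
      exact Continuous.aestronglyMeasurable (by fun_prop)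
    · filter_upwards [self_mem_nhdsWithin] with ε hε
      refine Eventually.of_forall fun k => ?_
      rw [norm_mul _ (_ : ℂ), Complex.norm_real, Real.norm_eq_abs, Real.abs_exp]
      refine mul_le_of_le_one_right (norm_nonneg _) ?_
      rw [Real.exp_le_one_iff]
      have : 0 ≤ ε * (2 * Real.pi * k) ^ 2 := mul_nonneg (le_of_lt hε) (sq_nonneg _)
      linarith
    · refine Eventually.of_forall fun k => ?_
      have : Continuous fun ε : ℝ => testFourier χ k * airySymbol k * testFourier f (-k) *
        Real.exp (-ε * (2 * Real.pi * k) ^ 2) := by fun_prop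
      have h := this.tendsto 0
      simp only [neg_zero, zero_mul, Real.exp_zero, Complex.ofReal_one, mul_one] at h
      exact h.mono_left nhdsWithin_le_nhds
  have hr : Tendsto (fun ε : ℝ => ∫ p : ℝ × ℝ, χ p.1 * invHeatAiry (-ε) (p.1 - p.2) * f p.2)
      (𝓝[>] 0) (𝓝 (∫ p : ℝ × ℝ, χ p.1 * airyAi (p.1 - p.2) * f p.2)) := by
    refine tendsto_integral_filter_of_dominated_convergence
      (fun p => ‖χ p.1 * Real.exp (2 - p.1)‖ * ‖f p.2 * Real.exp p.2‖) ?_ ?_ ?_ ?_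
    · exact Eventually.of_forall fun ε => Continuous.aestronglyMeasurable (by fun_prop)
    · filter_upwards [Ioo_mem_nhdsGT (zero_lt_one (α := ℝ))] with ε hε
      refine Eventually.of_forall fun p => ?_
      have h1 := abs_invHeatAiry_le (t := -ε) (b := 1) (p.1 - p.2) (by linarith [hε.1])
      have h2 : |invHeatAiry (-ε) (p.1 - p.2)| ≤ Real.exp (2 - p.1) * Real.exp p.2 := by
        refine h1.trans ?_
        rw [← Real.exp_add, Real.exp_le_exp]
        linarith [hε.2]
      simp only [norm_mul, Real.norm_eq_abs, Real.abs_exp]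
      calc _ ≤ |χ p.1| * (Real.exp (2 - p.1) * Real.exp p.2) * |f p.2| := by gcongr
        _ = _ := by ring
    · exact (hχ.integrable_mul (w := fun x => Real.exp (2 - x)) (by fun_prop)).norm.mul_prod
        (hf.integrable_mul (w := fun x => Real.exp x) (by fun_prop)).norm
    · refine Eventually.of_forall fun p => ?_
      have : Continuous fun ε : ℝ => χ p.1 * invHeatAiry (-ε) (p.1 - p.2) * f p.2 := by fun_prop
      have h := this.tendsto 0
      simp only [neg_zero, invHeatAiry_zero] at h
      exact h.mono_left nhdsWithin_le_nhds
  refine tendsto_nhds_unique hl ?_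
  refine ((Complex.continuous_ofReal.tendsto _).comp hr).congr' ?_
  filter_upwards [self_mem_nhdsWithin] with ε hε
  exact (integral_testFourier_regularized hχ hf hε).symm

lemma hasTestKernel_airyA : HasTestKernel airyTransformKernel (fun x => 2 * Real.exp (-x / 8))
    (fun y => Real.exp (y / 8)) airyA where
  cont := by unfold airyTransformKernel Function.uncurry; fun_prop
  contU := by fun_prop
  contV := by fun_prop
  posU x := by positivity
  posV x := by positivity
  bound x y := by
    refine (abs_airyAi_le_eighth _).trans (le_of_eq ?_)
    rw [mul_assoc, ← Real.exp_add]
    ring_nf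
  eq χ f hχ hf := by
    rw [inner_airyA, integral_test_airyAi hχ hf]
    congr 1
    refine integral_prod (fun p : ℝ × ℝ => χ p.1 * airyAi (p.1 - p.2) * f p.2) ?_
    have h1 := hχ.smooth.continuous
    have h2 := hf.smooth.continuous
    refine ((hχ.integrable_mul (w := fun x => 2 * Real.exp (-x / 8)) (by fun_prop)).norm.mul_prod
      (hf.integrable_mul (w := fun y => Real.exp (y / 8)) (by fun_prop)).norm).mono'
      (Continuous.aestronglyMeasurable (by fun_prop)) (Eventually.of_forall fun p => ?_)
    simp only [norm_mul, Real.norm_eq_abs, Real.abs_exp, abs_two]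
    have : |airyAi (p.1 - p.2)| ≤ 2 * (Real.exp (-p.1 / 8) * Real.exp (p.2 / 8)) := by
      refine (abs_airyAi_le_eighth _).trans (le_of_eq ?_)
      rw [← Real.exp_add]
      ring_nf
    calc _ ≤ |χ p.1| * (2 * (Real.exp (-p.1 / 8) * Real.exp (p.2 / 8))) * |f p.2| := by gcongr
      _ = _ := by ring

lemma airyTransform_eq : airyTransform = airyA := hasTestKernel_airyA.hasKernel.kernelOp_eq

end

/-! ### Brownian motions with everywhere continuous paths -/

section Brownian

variable {Ω : Type*} [MeasurableSpace Ω] {P : Measure Ω} {W : ℝ≥0 → Ω → ℝ}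

/-- A Brownian motion all of whose paths are continuous and start at `0`. -/
structure IsContBM (W : ℝ≥0 → Ω → ℝ) (P : Measure Ω) : Prop where
  bm : IsPreBrownianReal W P
  meas : ∀ t, Measurable (W t)
  cont : ∀ ω, Continuous (W · ω)
  zero : ∀ ω, W 0 ω = 0

lemma exists_isContBM (hW : IsBrownianReal W P) :
    ∃ W' : ℝ≥0 → Ω → ℝ, IsContBM W' P ∧ ∀ᵐ ω ∂P, ∀ t, W t ω = W' t ω := by
  set d := TopologicalSpace.denseSeq ℝ≥0
  have hae : ∀ᵐ ω ∂P, (∀ n, W (d n) ω = (hW.aemeasurable (d n)).mk _ ω) ∧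
      Continuous (W · ω) ∧ W 0 ω = 0 := by
    filter_upwards [ae_all_iff.2 fun n => (hW.aemeasurable (d n)).ae_eq_mk, hW.cont,
      hW.eval_zero_ae_eq_zero] with ω h1 h2 h3
    exact ⟨h1, h2, h3⟩
  obtain ⟨N, hN, hNm, hN0⟩ := exists_measurable_superset_of_null (ae_iff.1 hae)
  have hgood : ∀ ω ∉ N, (∀ n, W (d n) ω = (hW.aemeasurable (d n)).mk _ ω) ∧
      Continuous (W · ω) ∧ W 0 ω = 0 := fun ω hω => by
    by_contra h
    exact hω (hN h)
  have heq : ∀ᵐ ω ∂P, ∀ t, W t ω = Nᶜ.indicator (W t) ω := by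
    have : ∀ᵐ ω ∂P, ω ∉ N := measure_eq_zero_iff_ae_notMem.1 hN0
    filter_upwards [this] with ω hω t
    rw [Set.indicator_of_mem (by exact hω)]
  have hcont : ∀ ω, Continuous fun t => Nᶜ.indicator (W t) ω := by
    intro ω
    by_cases hω : ω ∈ N
    · simp only [Set.indicator_of_notMem (show ω ∉ Nᶜ by simpa using hω)]
      exact continuous_const
    · simp only [Set.indicator_of_mem (show ω ∈ Nᶜ from hω)]
      exact (hgood ω hω).2.1
  refine ⟨fun t => Nᶜ.indicator (W t), ⟨?_, ?_, hcont, ?_⟩, heq⟩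
  · exact hW.toIsPreBrownianReal.congr fun t => by
      filter_upwards [heq] with ω hω using hω t
  · intro t
    have hd : ∀ n, Measurable (Nᶜ.indicator (W (d n))) := by
      intro n
      have : Nᶜ.indicator (W (d n)) = Nᶜ.indicator ((hW.aemeasurable (d n)).mk _) := by
        ext ω
        by_cases hω : ω ∈ N
        · simp [hω]
        · rw [Set.indicator_of_mem (by exact hω), Set.indicator_of_mem (by exact hω)]
          exact (hgood ω hω).1 n
      rw [this]
      exact (hW.aemeasurable (d n)).measurable_mk.indicator hNm.compl
    obtain ⟨x, hx, hlim⟩ := mem_closure_iff_seq_limit.1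
      (TopologicalSpace.denseRange_denseSeq ℝ≥0 t)
    choose j hj using hx
    refine measurable_of_tendsto_metrizable (fun n => hd (j n)) ?_
    rw [tendsto_pi_nhds]
    intro ω
    have := ((hcont ω).tendsto t).comp hlim
    refine this.congr fun n => ?_
    simp only [Function.comp_apply, d, hj n]
  · intro ω
    by_cases hω : ω ∈ N
    · simp [hω]
    · simpa [hω] using (hgood ω hω).2.2

lemma IsContBM.measurable_uncurry (hW : IsContBM W P) :
    Measurable fun p : ℝ≥0 × Ω => W p.1 p.2 :=
  measurable_uncurry_of_continuous_of_measurable (u := W) hW.cont hW.meas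

/-! ### Barriers and hitting sets -/

/-- `g` is real and continuous on each interval of a countable collection of compact intervals, and
infinite elsewhere. -/
def GoodBarrier (g : ℝ → EReal) : Prop :=
  ∃ S : Set (ℝ × ℝ), S.Countable ∧
    (∀ p ∈ S, ∃ f : ℝ → ℝ, ContinuousOn f (Set.Icc p.1 p.2) ∧
      ∀ t ∈ Set.Icc p.1 p.2, g t = (f t : EReal)) ∧
    ∀ t, (∀ p ∈ S, t ∉ Set.Icc p.1 p.2) → g t = ⊤

lemma IsH1On.continuousOn {f : ℝ → ℝ} {a b : ℝ} (h : IsH1On f a b) :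
    ContinuousOn f (Set.Icc a b) := by
  obtain ⟨f', hf', hf⟩ := h
  have hi : IntegrableOn f' (Set.Icc a b) := hf'.integrable (by norm_num)
  refine ContinuousOn.congr (f := fun t => f a + ∫ s in a..t, f' s) ?_ hf
  refine continuousOn_const.add ?_
  exact intervalIntegral.continuousOn_primitive hi |>.congr fun t ht =>
    intervalIntegral.integral_of_le ht.1

lemma IsH1Ext.goodBarrier {g : ℝ → EReal} (h : IsH1Ext g) : GoodBarrier g := by
  obtain ⟨S, hS, h1, h2⟩ := h
  refine ⟨S, hS, fun p hp => ?_, h2⟩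
  obtain ⟨-, f, hf, hfg⟩ := h1 p hp
  exact ⟨f, hf.continuousOn, hfg⟩

lemma GoodBarrier.comp_neg {g : ℝ → EReal} (h : GoodBarrier g) : GoodBarrier fun t => g (-t) := by
  obtain ⟨S, hS, h1, h2⟩ := h
  refine ⟨(fun p : ℝ × ℝ => (-p.2, -p.1)) '' S, hS.image _, ?_, fun t ht => h2 _ fun p hp => ?_⟩
  · rintro _ ⟨p, hp, rfl⟩
    obtain ⟨f, hf, hfg⟩ := h1 p hp
    have hm : ∀ t ∈ Set.Icc (-p.2) (-p.1), -t ∈ Set.Icc p.1 p.2 := fun t ht =>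
      ⟨by linarith [ht.2], by linarith [ht.1]⟩
    exact ⟨fun t => f (-t), hf.comp continuousOn_neg hm, fun t ht => hfg _ (hm t ht)⟩
  · intro h
    exact ht _ ⟨p, hp, rfl⟩ ⟨by linarith [h.2], by linarith [h.1]⟩

open Classical in
/-- The barrier `g` cut off outside `[-L, L]`. -/
def cutBarrier (L : ℝ) (g : ℝ → EReal) (t : ℝ) : EReal := if |t| ≤ L then g t else ⊤

lemma GoodBarrier.cutBarrier {g : ℝ → EReal} (h : GoodBarrier g) (L : ℝ) :
    GoodBarrier (cutBarrier L g) := by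
  obtain ⟨S, hS, h1, h2⟩ := h
  refine ⟨(fun p : ℝ × ℝ => (max p.1 (-L), min p.2 L)) '' S, hS.image _, ?_, fun t ht => ?_⟩
  · rintro _ ⟨p, hp, rfl⟩
    obtain ⟨f, hf, hfg⟩ := h1 p hp
    have hs : Set.Icc (max p.1 (-L)) (min p.2 L) ⊆ Set.Icc p.1 p.2 :=
      Set.Icc_subset_Icc (le_max_left _ _) (min_le_left _ _)
    refine ⟨f, hf.mono hs, fun t ht => ?_⟩
    have : |t| ≤ L := abs_le.2 ⟨(le_max_right _ _).trans ht.1, ht.2.trans (min_le_right _ _)⟩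
    rw [AiryHitting.cutBarrier, if_pos this]
    exact hfg t (hs ht)
  · unfold AiryHitting.cutBarrier
    split_ifs with htL
    · refine h2 t fun p hp hpt => ht _ ⟨p, hp, rfl⟩ ?_
      rw [abs_le] at htL
      exact ⟨max_le hpt.1 htL.1, le_min hpt.2 htL.2⟩
    · rfl

lemma measurableSet_exists_le {X : Type*} [MeasurableSpace X] {w : X → ℝ → ℝ} {f : ℝ → ℝ}
    {K : Set ℝ} (hK : IsCompact K) (hf : ContinuousOn f K) (hc : ∀ x, Continuous (w x))
    (hm : ∀ s ∈ K, Measurable fun x => w x s) :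
    MeasurableSet {x | ∃ s ∈ K, f s ≤ w x s} := by
  rcases K.eq_empty_or_nonempty with rfl | hne
  · simp
  have : Nonempty K := hne.to_subtype
  set d := TopologicalSpace.denseSeq K
  have e : {x | ∃ s ∈ K, f s ≤ w x s} =
      ⋂ n : ℕ, ⋃ j : ℕ, {x | f (d j) - 1 / ((n : ℝ) + 1) < w x (d j)} := by
    ext x
    simp only [Set.mem_ofPred_eq, Set.mem_iInter, Set.mem_iUnion]
    constructor
    · rintro ⟨s, hs, hfs⟩ n
      have hcont : Continuous fun s : K => f s - w x s :=
        (continuousOn_iff_continuous_domRestrict.1 hf).sub ((hc x).comp continuous_subtype_val)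
      have hopen : IsOpen {s : K | f s - w x s < 1 / ((n : ℝ) + 1)} :=
        isOpen_lt hcont continuous_const
      have hmem : (⟨s, hs⟩ : K) ∈ {s : K | f s - w x s < 1 / ((n : ℝ) + 1)} := by
        have : (0 : ℝ) < 1 / ((n : ℝ) + 1) := by positivity
        simp only [Set.mem_ofPred_eq]
        linarith
      obtain ⟨j, hj⟩ := (TopologicalSpace.denseRange_denseSeq K).exists_mem_open hopen
        ⟨_, hmem⟩
      refine ⟨j, ?_⟩
      simp only [Set.mem_ofPred_eq] at hj
      linarith
    · intro h
      obtain ⟨s, hs, hmin⟩ := hK.exists_isMinOn hne (hf.sub (hc x).continuousOn)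
      refine ⟨s, hs, ?_⟩
      by_contra hlt
      push Not at hlt
      obtain ⟨n, hn⟩ := exists_nat_one_div_lt (sub_pos.2 hlt)
      obtain ⟨j, hj⟩ := h n
      have : f s - w x s ≤ f (d j) - w x (d j) := hmin (d j).2
      linarith
  rw [e]
  exact MeasurableSet.iInter fun n => MeasurableSet.iUnion fun j =>
    measurableSet_lt measurable_const (hm _ (d j).2)

/-- The event that a continuous random path hits a good barrier in a compact time interval is
measurable. -/
lemma GoodBarrier.measurableSet_hit {g : ℝ → EReal} (hg : GoodBarrier g) {X : Type*}
    [MeasurableSpace X] {w : X → ℝ → ℝ} {a b : ℝ} (hc : ∀ x, Continuous (w x))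
    (hm : ∀ s ∈ Set.Icc a b, Measurable fun x => w x s) :
    MeasurableSet {x | ∃ s ∈ Set.Icc a b, g s ≤ (w x s : EReal)} := by
  obtain ⟨S, hS, h1, h2⟩ := hg
  choose! f hf hfg using h1
  have e : {x | ∃ s ∈ Set.Icc a b, g s ≤ (w x s : EReal)} =
      ⋃ p ∈ S, {x | ∃ s ∈ Set.Icc a b ∩ Set.Icc p.1 p.2, f p s ≤ w x s} := by
    ext x
    simp only [Set.mem_ofPred_eq, Set.mem_iUnion, exists_prop]
    constructor
    · rintro ⟨s, hs, hgs⟩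
      by_cases hS : ∀ p ∈ S, s ∉ Set.Icc p.1 p.2
      · rw [h2 s hS, top_le_iff] at hgs
        exact absurd hgs (EReal.coe_ne_top _)
      · push Not at hS
        obtain ⟨p, hp, hps⟩ := hS
        refine ⟨p, hp, s, ⟨hs, hps⟩, ?_⟩
        rwa [hfg p hp s hps, EReal.coe_le_coe_iff] at hgs
    · rintro ⟨p, hp, s, ⟨hs, hps⟩, h⟩
      refine ⟨s, hs, ?_⟩
      rwa [hfg p hp s hps, EReal.coe_le_coe_iff]
  rw [e]
  refine MeasurableSet.biUnion hS fun p hp => ?_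
  exact measurableSet_exists_le (isCompact_Icc.inter isCompact_Icc)
    ((hf p hp).mono Set.inter_subset_right) hc fun s hs => hm s hs.1

lemma GoodBarrier.measurableSet_hit_strict {g : ℝ → EReal} (hg : GoodBarrier g) {X : Type*}
    [MeasurableSpace X] {w : X → ℝ → ℝ} {a b : ℝ} (hc : ∀ x, Continuous (w x))
    (hm : ∀ s ∈ Set.Icc a b, Measurable fun x => w x s) :
    MeasurableSet {x | ∃ s ∈ Set.Icc a b, g s < (w x s : EReal)} := by
  have e : {x | ∃ s ∈ Set.Icc a b, g s < (w x s : EReal)} =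
      ⋃ n : ℕ, {x | ∃ s ∈ Set.Icc a b, g s ≤ ((w x s - 1 / ((n : ℝ) + 1) : ℝ) : EReal)} := by
    ext x
    simp only [Set.mem_ofPred_eq, Set.mem_iUnion]
    constructor
    · rintro ⟨s, hs, h⟩
      obtain ⟨r, hr1, hr2⟩ := EReal.lt_iff_exists_real_btwn.1 h
      rw [EReal.coe_lt_coe_iff] at hr2
      obtain ⟨n, hn⟩ := exists_nat_one_div_lt (sub_pos.2 hr2)
      refine ⟨n, s, hs, hr1.le.trans ?_⟩
      rw [EReal.coe_le_coe_iff]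
      linarith
    · rintro ⟨n, s, hs, h⟩
      refine ⟨s, hs, h.trans_lt ?_⟩
      rw [EReal.coe_lt_coe_iff]
      have : (0 : ℝ) < 1 / ((n : ℝ) + 1) := by positivity
      linarith
  rw [e]
  refine MeasurableSet.iUnion fun n => hg.measurableSet_hit (w := fun x s =>
    w x s - 1 / ((n : ℝ) + 1)) (fun x => (hc x).sub continuous_const) fun s hs =>
    (hm s hs).sub_const _

lemma GoodBarrier.measurableSet_hit_lt {g : ℝ → EReal} (hg : GoodBarrier g) {X : Type*}
    [MeasurableSpace X] {w : X → ℝ → ℝ} {a b : ℝ} (hc : ∀ x, Continuous (w x))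
    (hm : ∀ s ∈ Set.Ico a b, Measurable fun x => w x s) :
    MeasurableSet {x | ∃ s ∈ Set.Ico a b, g s ≤ (w x s : EReal)} := by
  have e : {x | ∃ s ∈ Set.Ico a b, g s ≤ (w x s : EReal)} =
      ⋃ n : ℕ, {x | ∃ s ∈ Set.Icc a (b - 1 / ((n : ℝ) + 1)), g s ≤ (w x s : EReal)} := by
    ext x
    simp only [Set.mem_ofPred_eq, Set.mem_iUnion]
    constructor
    · rintro ⟨s, hs, h⟩
      obtain ⟨n, hn⟩ := exists_nat_one_div_lt (sub_pos.2 hs.2)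
      exact ⟨n, s, ⟨hs.1, by linarith⟩, h⟩
    · rintro ⟨n, s, hs, h⟩
      have : (0 : ℝ) < 1 / ((n : ℝ) + 1) := by positivity
      exact ⟨s, ⟨hs.1, by linarith [hs.2]⟩, h⟩
  rw [e]
  refine MeasurableSet.iUnion fun n => hg.measurableSet_hit hc fun s hs => hm s ⟨hs.1, ?_⟩
  have : (0 : ℝ) < 1 / ((n : ℝ) + 1) := by positivity
  linarith [hs.2]

/-! ### The Markov property -/

/-- The `σ`-algebra of the past of `W` up to time `t`. -/
@[reducible]
def pastAlgebra (W : ℝ≥0 → Ω → ℝ) (t : ℝ≥0) : MeasurableSpace Ω :=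
  MeasurableSpace.comap (fun ω (s : Set.Iic t) => W s ω) inferInstance

lemma measurable_pastAlgebra (W : ℝ≥0 → Ω → ℝ) {s t : ℝ≥0} (h : s ≤ t) :
    Measurable[pastAlgebra W t] (W s) := by
  have h1 : Measurable[pastAlgebra W t] (fun ω (s : Set.Iic t) => W s ω) :=
    comap_measurable _
  exact (measurable_pi_apply (⟨s, h⟩ : Set.Iic t)).comp h1

lemma pastAlgebra_mono (W : ℝ≥0 → Ω → ℝ) {s t : ℝ≥0} (h : s ≤ t) :
    pastAlgebra W s ≤ pastAlgebra W t := by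
  refine Measurable.comap_le ?_
  refine @measurable_pi_lambda _ _ _ (pastAlgebra W t) _ _ fun r => ?_
  exact measurable_pastAlgebra W (le_trans r.2 h)

lemma IsContBM.pastAlgebra_le (hW : IsContBM W P) (t : ℝ≥0) :
    pastAlgebra W t ≤ ‹MeasurableSpace Ω› :=
  Measurable.comap_le (measurable_pi_lambda _ fun s => hW.meas s)

lemma IsContBM.setIntegral_markov [IsProbabilityMeasure P] (hW : IsContBM W P) {t T : ℝ≥0}
    (htT : t ≤ T) {A : Set Ω} (hA : MeasurableSet[pastAlgebra W t] A) {Φ : ℝ → ℝ}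
    (hΦ : Measurable Φ) (hi : Integrable (fun ω => Φ (W T ω)) P) :
    Integrable (fun ω => ∫ z, Φ (W t ω + z) ∂(gaussianReal 0 (T - t))) P ∧
    ∫ ω in A, Φ (W T ω) ∂P =
      ∫ ω in A, ∫ z, Φ (W t ω + z) ∂(gaussianReal 0 (T - t)) ∂P := by
  obtain ⟨A', hA', rfl⟩ := hA
  set X : Ω → (Set.Iic t → ℝ) := fun ω s => W s ω
  set Y : Ω → ℝ := fun ω => W T ω - W t ω
  have hX : Measurable X := measurable_pi_lambda _ fun s => hW.meas s
  have hY : Measurable Y := (hW.meas T).sub (hW.meas t)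
  have hT : t + (T - t) = T := add_tsub_cancel_of_le htT
  have hind : IndepFun X Y P := by
    have := (hW.bm.indepFun_shift t).symm.comp (φ := id)
      (ψ := fun w : ℝ≥0 → ℝ => w (T - t)) measurable_id (measurable_pi_apply (T - t) : Measurable fun w : ℝ≥0 → ℝ => w (T - t))
    simpa [Function.comp_def, hT] using this
  have hlaw : P.map Y = gaussianReal 0 (T - t) := by
    have := ((hW.bm.shift t).hasLaw_eval (T - t)).map_eq
    simpa [hT] using this
  have hmap : P.map (fun ω => (X ω, Y ω)) = (P.map X).prod (gaussianReal 0 (T - t)) := by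
    rw [(indepFun_iff_map_prod_eq_prod_map_map hX.aemeasurable hY.aemeasurable).1 hind, hlaw]
  have : IsProbabilityMeasure (P.map X) := Measure.isProbabilityMeasure_map hX.aemeasurable
  set t' : Set.Iic t := ⟨t, Set.self_mem_Iic⟩
  have hG : Measurable fun p : (Set.Iic t → ℝ) × ℝ => Φ (p.1 t' + p.2) :=
    hΦ.comp (((measurable_pi_apply t').comp measurable_fst).add measurable_snd)
  have hXY : ∀ ω, X ω t' + Y ω = W T ω := fun ω => by simp [X, Y, t']
  have hGi : Integrable (fun p : (Set.Iic t → ℝ) × ℝ => Φ (p.1 t' + p.2))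
      ((P.map X).prod (gaussianReal 0 (T - t))) := by
    rw [← hmap, integrable_map_measure hG.aestronglyMeasurable (hX.prodMk hY).aemeasurable]
    refine hi.congr (Eventually.of_forall fun ω => ?_)
    simp only [Function.comp_apply, hXY]
  have hI := hGi.integral_prod_left
  refine ⟨?_, ?_⟩
  · exact (integrable_map_measure hI.1 hX.aemeasurable).1 hI
  have e1 : ∫ ω in X ⁻¹' A', Φ (W T ω) ∂P =
      ∫ p, (A' ×ˢ Set.univ).indicator (fun p => Φ (p.1 t' + p.2)) p
        ∂((P.map X).prod (gaussianReal 0 (T - t))) := by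
    rw [← hmap, integral_map (hX.prodMk hY).aemeasurable
      (hG.indicator (hA'.prod MeasurableSet.univ)).aestronglyMeasurable,
      ← integral_indicator (hX hA')]
    refine integral_congr_ae (Eventually.of_forall fun ω => ?_)
    by_cases h : X ω ∈ A'
    · have h' : (X ω, Y ω) ∈ A' ×ˢ (Set.univ : Set ℝ) := ⟨h, trivial⟩
      simp only [Set.indicator_of_mem h', Set.indicator_of_mem (show ω ∈ X ⁻¹' A' from h), hXY]
    · have h' : (X ω, Y ω) ∉ A' ×ˢ (Set.univ : Set ℝ) := fun h' => h h'.1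
      simp only [Set.indicator_of_notMem h', Set.indicator_of_notMem (show ω ∉ X ⁻¹' A' from h)]
  have e2 : ∫ ω in X ⁻¹' A', ∫ z, Φ (W t ω + z) ∂(gaussianReal 0 (T - t)) ∂P =
      ∫ x in A', ∫ z, Φ (x t' + z) ∂(gaussianReal 0 (T - t)) ∂(P.map X) := by
    rw [setIntegral_map hA' hI.1 hX.aemeasurable]
  rw [e1, e2, integral_prod _ (hGi.indicator (hA'.prod MeasurableSet.univ)),
    ← integral_indicator hA']
  refine integral_congr_ae (Eventually.of_forall fun x => ?_)
  by_cases h : x ∈ A'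
  · have h' : ∀ z, (x, z) ∈ A' ×ˢ (Set.univ : Set ℝ) := fun z => ⟨h, trivial⟩
    simp only [Set.indicator_of_mem h, Set.indicator_of_mem (h' _)]
  · have h' : ∀ z, (x, z) ∉ A' ×ˢ (Set.univ : Set ℝ) := fun z h' => h h'.1
    simp only [Set.indicator_of_notMem h, Set.indicator_of_notMem (h' _), integral_zero]

end Brownian

/-! ### Optional stopping -/

lemma tendsto_integral_of_sq_bound {Ω : Type*} [MeasurableSpace Ω] {μ : Measure Ω}
    [IsFiniteMeasure μ] {f : ℕ → Ω → ℝ} {f₀ : Ω → ℝ} {C : ℝ} (hf : ∀ᶠ n in atTop, MemLp (f n) 2 μ)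
    (hf₀ : MemLp f₀ 2 μ) (hC : ∀ᶠ n in atTop, ∫ ω, f n ω ^ 2 ∂μ ≤ C) (hC₀ : ∫ ω, f₀ ω ^ 2 ∂μ ≤ C)
    (hlim : ∀ᵐ ω ∂μ, Tendsto (fun n => f n ω) atTop (𝓝 (f₀ ω))) :
    Tendsto (fun n => ∫ ω, f n ω ∂μ) atTop (𝓝 (∫ ω, f₀ ω ∂μ)) := by
  have hC0 : 0 ≤ C := le_trans (integral_nonneg fun ω => sq_nonneg _) hC₀
  rw [Metric.tendsto_atTop']
  intro ε hε
  set K : ℝ := (8 * C + 1) / ε with hK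
  have hKpos : 0 < K := by positivity
  have hmin : Tendsto (fun n => ∫ ω, min |f n ω - f₀ ω| K ∂μ) atTop (𝓝 0) := by
    have : Tendsto (fun n => ∫ ω, min |f n ω - f₀ ω| K ∂μ) atTop (𝓝 (∫ _, (0 : ℝ) ∂μ)) := by
      refine tendsto_integral_filter_of_dominated_convergence (fun _ => K) ?_ ?_
        (integrable_const K) ?_
      · filter_upwards [hf] with n hn
        exact ((hn.1.sub hf₀.1).norm.inf aestronglyMeasurable_const)
      · refine Eventually.of_forall fun n => Eventually.of_forall fun ω => ?_
        rw [Real.norm_eq_abs, abs_of_nonneg (le_min (abs_nonneg _) hKpos.le)]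
        exact min_le_right _ _
      · filter_upwards [hlim] with ω hω
        have h1 : Tendsto (fun n => |f n ω - f₀ ω|) atTop (𝓝 |f₀ ω - f₀ ω|) :=
          (hω.sub_const _).abs
        have h2 := h1.min (tendsto_const_nhds (x := K))
        simpa [hKpos.le] using h2
    simpa using this
  have hev := (tendsto_order.1 hmin).2 (ε / 2) (by positivity)
  obtain ⟨N, hN⟩ := eventually_atTop.1 (hev.and (hf.and hC))
  refine ⟨N, fun n hn => ?_⟩
  obtain ⟨h1, h2, h3⟩ := hN n hn.le
  rw [Real.dist_eq, ← integral_sub (h2.integrable (by norm_num)) (hf₀.integrable (by norm_num))]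
  have hd := h2.sub hf₀
  have hmi : Integrable (fun ω => min |f n ω - f₀ ω| K) μ := by
    refine Integrable.mono' (integrable_const K) (hd.1.norm.inf aestronglyMeasurable_const) ?_
    refine Eventually.of_forall fun ω => ?_
    rw [Real.norm_eq_abs, abs_of_nonneg (le_min (abs_nonneg _) hKpos.le)]
    exact min_le_right _ _
  have hsum : Integrable (fun ω => 2 / K * (f n ω ^ 2 + f₀ ω ^ 2)) μ :=
    (h2.integrable_sq.add hf₀.integrable_sq).const_mul _
  calc |∫ ω, f n ω - f₀ ω ∂μ| ≤ ∫ ω, |f n ω - f₀ ω| ∂μ := abs_integral_le_integral_abs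
    _ ≤ ∫ ω, (min |f n ω - f₀ ω| K + 2 / K * (f n ω ^ 2 + f₀ ω ^ 2)) ∂μ := by
        refine integral_mono (hd.integrable (by norm_num)).abs (hmi.add hsum) fun ω => ?_
        simp only
        rcases le_total |f n ω - f₀ ω| K with h | h
        · rw [min_eq_left h]
          have : 0 ≤ 2 / K * (f n ω ^ 2 + f₀ ω ^ 2) := by positivity
          linarith
        · rw [min_eq_right h]
          have h5 : |f n ω - f₀ ω| ≤ (f n ω - f₀ ω) ^ 2 / K := by
            rw [le_div_iff₀ hKpos, ← sq_abs, sq]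
            gcongr
          have h6 : (f n ω - f₀ ω) ^ 2 / K ≤ 2 / K * (f n ω ^ 2 + f₀ ω ^ 2) := by
            rw [div_mul_eq_mul_div]
            gcongr
            nlinarith [sq_nonneg (f n ω + f₀ ω)]
          linarith
    _ = ∫ ω, min |f n ω - f₀ ω| K ∂μ + 2 / K * (∫ ω, f n ω ^ 2 ∂μ + ∫ ω, f₀ ω ^ 2 ∂μ) := by
        rw [integral_add hmi hsum, integral_const_mul,
          integral_add h2.integrable_sq hf₀.integrable_sq]
    _ < ε / 2 + 2 / K * (C + C) + 0 := by
        have : 2 / K * (∫ ω, f n ω ^ 2 ∂μ + ∫ ω, f₀ ω ^ 2 ∂μ) ≤ 2 / K * (C + C) := by gcongr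
        linarith
    _ ≤ ε := by
        have : 2 / K * (C + C) ≤ ε / 2 := by
          rw [hK, div_div_eq_mul_div, div_mul_eq_mul_div, div_le_iff₀ (by positivity)]
          nlinarith
        linarith

section Brownian

variable {Ω : Type*} [MeasurableSpace Ω] {P : Measure Ω} {W : ℝ≥0 → Ω → ℝ}

/-- The random time `σ` is optional for `W` up to time `T`. -/
structure IsOptionalTime (W : ℝ≥0 → Ω → ℝ) (T : ℝ≥0) (σ : Ω → ℝ) : Prop where
  nonneg : ∀ ω, 0 ≤ σ ω
  meas : ∀ t : ℝ≥0, t ≤ T → MeasurableSet[pastAlgebra W t] {ω | σ ω < t}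

/-- The time `s` rounded up to the grid of mesh `T / n`. -/
def gridTime (T : ℝ≥0) (n : ℕ) (s : ℝ) : ℝ≥0 := ((⌊n * s / T⌋₊ + 1 : ℕ) : ℝ≥0) / n * T

lemma lt_gridTime {T : ℝ≥0} (hT : 0 < T) {n : ℕ} (hn : 0 < n) (s : ℝ) :
    s < gridTime T n s := by
  have hT' : (0 : ℝ) < T := hT
  have hn' : (0 : ℝ) < n := by exact_mod_cast hn
  have h := Nat.lt_floor_add_one (n * s / T : ℝ)
  rw [div_lt_iff₀ hT'] at h
  unfold gridTime
  push_cast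
  rw [div_mul_eq_mul_div, lt_div_iff₀ hn']
  linarith

lemma gridTime_le {T : ℝ≥0} (hT : 0 < T) {n : ℕ} (hn : 0 < n) {s : ℝ} (hs : 0 ≤ s) :
    (gridTime T n s : ℝ) ≤ s + T / n := by
  have hT' : (0 : ℝ) < T := hT
  have hn' : (0 : ℝ) < n := by exact_mod_cast hn
  have h := Nat.floor_le (a := (n * s / T : ℝ)) (by positivity)
  rw [le_div_iff₀ hT'] at h
  unfold gridTime
  push_cast
  rw [div_mul_eq_mul_div, div_le_iff₀ hn', add_mul s, div_mul_cancel₀ _ hn'.ne']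
  linarith

lemma tendsto_gridTime {T : ℝ≥0} (hT : 0 < T) {s : ℝ} (hs : 0 ≤ s) :
    Tendsto (fun n => gridTime T n s) atTop (𝓝 s.toNNReal) := by
  rw [← NNReal.tendsto_coe, Real.coe_toNNReal s hs]
  have h2 : Tendsto (fun n : ℕ => s + (T : ℝ) / n) atTop (𝓝 (s + 0)) :=
    tendsto_const_nhds.add (tendsto_const_div_atTop_nhds_zero_nat _)
  rw [add_zero] at h2
  refine tendsto_of_tendsto_of_tendsto_of_le_of_le' tendsto_const_nhds h2 ?_ ?_
  · filter_upwards [eventually_gt_atTop 0] with n hn using (lt_gridTime hT hn s).le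
  · filter_upwards [eventually_gt_atTop 0] with n hn using gridTime_le hT hn hs

lemma measurable_gridTime (T : ℝ≥0) (n : ℕ) : Measurable (gridTime T n) := by
  unfold gridTime
  have : Measurable fun s : ℝ => ⌊n * s / T⌋₊ :=
    Nat.measurable_floor.comp ((measurable_const.mul measurable_id).div_const _)
  have h2 : Measurable fun s : ℝ => ((⌊n * s / T⌋₊ + 1 : ℕ) : ℝ≥0) :=
    (measurable_from_nat (f := fun k : ℕ => ((k + 1 : ℕ) : ℝ≥0))).comp this
  exact (h2.div_const _).mul_const _

/-- The event that `σ` lies in the `k`-th cell of the grid of mesh `T / n`. -/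
def gridCell (T : ℝ≥0) (n k : ℕ) (σ : Ω → ℝ) : Set Ω :=
  {ω | σ ω < (((k + 1 : ℕ) : ℝ≥0) / n * T : ℝ≥0)} \ {ω | σ ω < ((k : ℝ≥0) / n * T : ℝ≥0)}

lemma mem_gridCell_iff {T : ℝ≥0} (hT : 0 < T) {n : ℕ} (hn : 0 < n) {σ : Ω → ℝ}
    {ω : Ω} (hσ : 0 ≤ σ ω) (k : ℕ) : ω ∈ gridCell T n k σ ↔ ⌊n * σ ω / T⌋₊ = k := by
  have hT' : (0 : ℝ) < T := hT
  have hn' : (0 : ℝ) < n := by exact_mod_cast hn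
  rw [Nat.floor_eq_iff (by positivity), le_div_iff₀ hT', div_lt_iff₀ hT', gridCell, Set.mem_sdiff]
  simp only [Set.mem_ofPred_eq, not_lt]
  push_cast
  rw [div_mul_eq_mul_div, div_mul_eq_mul_div, lt_div_iff₀ hn', div_le_iff₀ hn', and_comm,
    mul_comm (n : ℝ)]

lemma grid_le {T : ℝ≥0} {n k : ℕ} (hn : 0 < n) (hk : k ≤ n) :
    ((k : ℝ≥0) / n * T : ℝ≥0) ≤ T := by
  refine mul_le_of_le_one_left zero_le ?_
  rw [div_le_one (by exact_mod_cast hn)]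
  exact_mod_cast hk

lemma IsOptionalTime.measurableSet_gridCell {T : ℝ≥0} {σ : Ω → ℝ} (hσ : IsOptionalTime W T σ)
    {n k : ℕ} (hn : 0 < n) (hk : k < n) :
    MeasurableSet[pastAlgebra W (((k + 1 : ℕ) : ℝ≥0) / n * T)] (gridCell T n k σ) := by
  have h1 := hσ.meas _ (grid_le (T := T) hn hk)
  have h2 := hσ.meas _ (grid_le (T := T) hn hk.le)
  refine MeasurableSet.diff h1 (pastAlgebra_mono W ?_ _ h2)
  gcongr
  exact Nat.le_succ k

lemma setOf_lt_eq_iUnion_gridCell {T : ℝ≥0} (hT : 0 < T) {n : ℕ} (hn : 0 < n) {σ : Ω → ℝ}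
    (hσ : ∀ ω, 0 ≤ σ ω) : {ω | σ ω < T} = ⋃ k ∈ Finset.range n, gridCell T n k σ := by
  have hT' : (0 : ℝ) < T := hT
  have hn' : (0 : ℝ) < n := by exact_mod_cast hn
  ext ω
  simp only [Set.mem_iUnion, mem_gridCell_iff hT hn (hσ ω), Finset.mem_range, exists_prop,
    exists_eq_right', Set.mem_ofPred_eq]
  rw [Nat.floor_lt (by have := hσ ω; positivity), div_lt_iff₀ hT']
  exact (mul_lt_mul_iff_right₀ hn').symm

/-- Optional stopping on a finite grid of times. -/
lemma IsOptionalTime.setIntegral_gridTime [IsProbabilityMeasure P] (hW : IsContBM W P) {T : ℝ≥0}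
    (hT : 0 < T) {σ : Ω → ℝ} (hσ : IsOptionalTime W T σ) {F : ℝ → ℝ → ℝ}
    (hFm : Measurable (F T)) (hi : Integrable (fun ω => F T (W T ω)) P)
    (hmart : ∀ t : ℝ≥0, t ≤ T → ∀ x, ∫ z, F T (x + z) ∂(gaussianReal 0 (T - t)) = F t x)
    {n : ℕ} (hn : 0 < n) :
    IntegrableOn (fun ω => F (gridTime T n (σ ω)) (W (gridTime T n (σ ω)) ω)) {ω | σ ω < T} P ∧
    ∫ ω in {ω | σ ω < T}, F (gridTime T n (σ ω)) (W (gridTime T n (σ ω)) ω) ∂P =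
      ∫ ω in {ω | σ ω < T}, F T (W T ω) ∂P := by
  have hcm : ∀ k ∈ Finset.range n, MeasurableSet (gridCell T n k σ) := fun k hk =>
    hW.pastAlgebra_le _ _ (hσ.measurableSet_gridCell hn (Finset.mem_range.1 hk))
  have hM := fun k (hk : k ∈ Finset.range n) => hW.setIntegral_markov
    (grid_le (T := T) hn (Finset.mem_range.1 hk))
    (hσ.measurableSet_gridCell hn (Finset.mem_range.1 hk)) hFm hi
  have hgt : ∀ k, ∀ ω ∈ gridCell T n k σ, F (gridTime T n (σ ω)) (W (gridTime T n (σ ω)) ω) =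
      F (((k + 1 : ℕ) : ℝ≥0) / n * T : ℝ≥0) (W (((k + 1 : ℕ) : ℝ≥0) / n * T) ω) := by
    intro k ω hω
    rw [mem_gridCell_iff hT hn (hσ.nonneg ω)] at hω
    rw [gridTime, hω]
  have hintg : ∀ k ∈ Finset.range n, IntegrableOn (fun ω => F (gridTime T n (σ ω))
      (W (gridTime T n (σ ω)) ω)) (gridCell T n k σ) P := by
    intro k hk
    have h1 := (hM k hk).1
    simp_rw [hmart _ (grid_le (T := T) hn (Finset.mem_range.1 hk))] at h1
    exact h1.integrableOn.congr_fun (fun ω hω => (hgt k ω hω).symm) (hcm k hk)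
  have hdisj : Set.Pairwise (Finset.range n : Set ℕ)
      (Function.onFun Disjoint fun k => gridCell T n k σ) := by
    intro j _ k _ hjk
    rw [Function.onFun, Set.disjoint_left]
    intro ω h1 h2
    rw [mem_gridCell_iff hT hn (hσ.nonneg ω)] at h1 h2
    exact hjk (h1.symm.trans h2)
  rw [setOf_lt_eq_iUnion_gridCell hT hn hσ.nonneg]
  refine ⟨integrableOn_finset_iUnion.2 hintg, ?_⟩
  rw [integral_biUnion_finset _ hcm hdisj hintg,
    integral_biUnion_finset _ hcm hdisj fun k _ => hi.integrableOn]
  refine Finset.sum_congr rfl fun k hk => ?_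
  rw [(hM k hk).2]
  refine setIntegral_congr_fun (hcm k hk) fun ω hω => ?_
  rw [hgt k ω hω, hmart _ (grid_le (T := T) hn (Finset.mem_range.1 hk))]

lemma IsOptionalTime.measurableSet_lt {T : ℝ≥0} {σ : Ω → ℝ} (hW : IsContBM W P)
    (hσ : IsOptionalTime W T σ) : MeasurableSet {ω | σ ω < T} :=
  hW.pastAlgebra_le _ _ (hσ.meas T le_rfl)

/-- The exponential martingale. -/
def expMart (θ t x : ℝ) : ℝ := Real.exp (θ * x - θ ^ 2 * t / 2)

lemma expMart_pos (θ t x : ℝ) : 0 < expMart θ t x := Real.exp_pos _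

lemma continuous_expMart (θ : ℝ) : Continuous (Function.uncurry (expMart θ)) := by
  unfold expMart Function.uncurry
  fun_prop

lemma integral_expMart_gaussian (θ : ℝ) {t T : ℝ≥0} (h : t ≤ T) (x : ℝ) :
    ∫ z, expMart θ T (x + z) ∂(gaussianReal 0 (T - t)) = expMart θ t x := by
  have e : ∀ z, expMart θ T (x + z) = Real.exp (θ * x - θ ^ 2 * T / 2) * Real.exp (θ * z) := by
    intro z
    rw [expMart, ← Real.exp_add]
    ring_nf
  simp_rw [e]
  rw [integral_const_mul]
  have h1 := congrFun (mgf_fun_id_gaussianReal (μ := 0) (v := T - t)) θ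
  rw [mgf] at h1
  rw [h1, expMart, ← Real.exp_add, NNReal.coe_sub h]
  ring_nf

lemma IsContBM.integrable_exp (hW : IsContBM W P) (θ : ℝ) (t : ℝ≥0) :
    Integrable (fun ω => Real.exp (θ * W t ω)) P := by
  have h := integrable_exp_mul_gaussianReal (μ := 0) (v := t) θ
  rw [← (hW.bm.hasLaw_eval t).map_eq] at h
  exact (integrable_map_measure (by fun_prop) (hW.meas t).aemeasurable).1 h

lemma IsContBM.integrable_expMart (hW : IsContBM W P) (θ : ℝ) (t : ℝ≥0) :
    Integrable (fun ω => expMart θ t (W t ω)) P := by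
  refine ((hW.integrable_exp θ t).const_mul (Real.exp (-(θ ^ 2 * t / 2)))).congr
    (Eventually.of_forall fun ω => ?_)
  simp only [expMart, ← Real.exp_add]
  ring_nf

lemma IsContBM.integral_expMart (hW : IsContBM W P) (θ : ℝ) (t : ℝ≥0) :
    ∫ ω, expMart θ t (W t ω) ∂P = 1 := by
  have h := integral_expMart_gaussian θ (zero_le (a := t)) 0
  rw [tsub_zero, ← (hW.bm.hasLaw_eval t).map_eq] at h
  rw [integral_map (hW.meas t).aemeasurable (by unfold expMart; fun_prop)] at h
  simpa [expMart] using h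

lemma IsOptionalTime.setIntegral_expMart_gridTime [IsProbabilityMeasure P] (hW : IsContBM W P)
    {T : ℝ≥0} (hT : 0 < T) {σ : Ω → ℝ} (hσ : IsOptionalTime W T σ) (θ : ℝ) {n : ℕ} (hn : 0 < n) :
    IntegrableOn (fun ω => expMart θ (gridTime T n (σ ω)) (W (gridTime T n (σ ω)) ω))
      {ω | σ ω < T} P ∧
    ∫ ω in {ω | σ ω < T}, expMart θ (gridTime T n (σ ω)) (W (gridTime T n (σ ω)) ω) ∂P ≤ 1 := by
  obtain ⟨h1, h2⟩ := hσ.setIntegral_gridTime hW hT (F := expMart θ)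
    (by unfold expMart; fun_prop) (hW.integrable_expMart θ T)
    (fun t ht x => integral_expMart_gaussian θ ht x) hn
  refine ⟨h1, ?_⟩
  rw [h2, ← hW.integral_expMart θ T]
  exact setIntegral_le_integral (hW.integrable_expMart θ T)
    (Eventually.of_forall fun ω => (expMart_pos _ _ _).le)

lemma IsContBM.tendsto_gridTime (hW : IsContBM W P) {T : ℝ≥0} (hT : 0 < T) {F : ℝ → ℝ → ℝ}
    (hF : Continuous (Function.uncurry F)) {s : ℝ} (hs : 0 ≤ s) (ω : Ω) :
    Tendsto (fun n => F (gridTime T n s) (W (gridTime T n s) ω)) atTop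
      (𝓝 (F s (W s.toNNReal ω))) := by
  have h1 := AiryHitting.tendsto_gridTime hT hs
  have h2 : Tendsto (fun n => (gridTime T n s : ℝ)) atTop (𝓝 s) := by
    have := (NNReal.tendsto_coe.2 h1)
    rwa [Real.coe_toNNReal s hs] at this
  have h3 := ((hW.cont ω).tendsto _).comp h1
  exact (hF.tendsto (s, W s.toNNReal ω)).comp (h2.prodMk_nhds h3)

lemma IsContBM.measurable_eval (hW : IsContBM W P) {F : ℝ → ℝ → ℝ}
    (hF : Continuous (Function.uncurry F)) {τ : Ω → ℝ≥0} (hτ : Measurable τ) :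
    Measurable fun ω => F (τ ω) (W (τ ω) ω) :=
  hF.measurable.comp ((measurable_coe_nnreal_real.comp hτ).prodMk
    (hW.measurable_uncurry.comp (hτ.prodMk measurable_id)))

lemma IsOptionalTime.lintegral_expMart_le [IsProbabilityMeasure P] (hW : IsContBM W P)
    {T : ℝ≥0} (hT : 0 < T) {σ : Ω → ℝ} (hσ : IsOptionalTime W T σ) (hσm : Measurable σ) (θ : ℝ) :
    ∫⁻ ω in {ω | σ ω < T}, ENNReal.ofReal (expMart θ (σ ω) (W (σ ω).toNNReal ω)) ∂P ≤ 1 := by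
  have hm : ∀ n, Measurable fun ω =>
      ENNReal.ofReal (expMart θ (gridTime T n (σ ω)) (W (gridTime T n (σ ω)) ω)) := fun n =>
    (hW.measurable_eval (continuous_expMart θ) ((measurable_gridTime T n).comp hσm)).ennreal_ofReal
  calc _ = ∫⁻ ω in {ω | σ ω < T}, liminf (fun n => ENNReal.ofReal
          (expMart θ (gridTime T n (σ ω)) (W (gridTime T n (σ ω)) ω))) atTop ∂P := by
        refine lintegral_congr fun ω => ?_
        exact ((ENNReal.continuous_ofReal.tendsto _).comp
          (hW.tendsto_gridTime hT (continuous_expMart θ) (hσ.nonneg ω) ω)).liminf_eq.symm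
    _ ≤ liminf (fun n => ∫⁻ ω in {ω | σ ω < T}, ENNReal.ofReal
          (expMart θ (gridTime T n (σ ω)) (W (gridTime T n (σ ω)) ω)) ∂P) atTop :=
        lintegral_liminf_le hm
    _ ≤ 1 := by
        refine liminf_le_of_frequently_le' ?_
        refine Eventually.frequently ?_
        filter_upwards [eventually_gt_atTop 0] with n hn
        obtain ⟨h1, h2⟩ := hσ.setIntegral_expMart_gridTime hW hT θ hn
        rw [← ofReal_integral_eq_lintegral_ofReal h1
          (Eventually.of_forall fun ω => (expMart_pos _ _ _).le)]
        exact ENNReal.ofReal_le_one.2 h2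

/-- Optional stopping for martingales `F(t, W_t)` whose square is dominated by an exponential
martingale. -/
theorem IsOptionalTime.setIntegral_eq [IsProbabilityMeasure P] (hW : IsContBM W P) {T : ℝ≥0}
    (hT : 0 < T) {σ : Ω → ℝ} (hσ : IsOptionalTime W T σ) (hσm : Measurable σ) {F : ℝ → ℝ → ℝ}
    (hF : Continuous (Function.uncurry F))
    (hmart : ∀ t : ℝ≥0, t ≤ T → ∀ x, ∫ z, F T (x + z) ∂(gaussianReal 0 (T - t)) = F t x)
    {θ K : ℝ} (hb : ∀ t : ℝ, 0 ≤ t → t ≤ T → ∀ x, F t x ^ 2 ≤ K * expMart θ t x) (hK : 0 ≤ K) :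
    ∫ ω in {ω | σ ω < T}, F (σ ω) (W (σ ω).toNNReal ω) ∂P =
      ∫ ω in {ω | σ ω < T}, F T (W T ω) ∂P := by
  have hσT := hσ.measurableSet_lt hW
  have hFT : Continuous (F T) := hF.comp (Continuous.prodMk_right (T : ℝ))
  have hi : Integrable (fun ω => F T (W T ω)) P := by
    have h2 : MemLp (fun ω => F T (W T ω)) 2 P := by
      refine (memLp_two_iff_integrable_sq (hFT.measurable.comp (hW.meas T)).aestronglyMeasurable).2 ?_
      refine ((hW.integrable_expMart θ T).const_mul K).mono'
        ((hFT.measurable.comp (hW.meas T)).pow_const 2).aestronglyMeasurable ?_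
      refine Eventually.of_forall fun ω => ?_
      rw [Real.norm_eq_abs, abs_of_nonneg (sq_nonneg _)]
      exact hb T T.2 le_rfl _
    exact h2.integrable (by norm_num)
  have hmn : ∀ n, Measurable fun ω => F (gridTime T n (σ ω)) (W (gridTime T n (σ ω)) ω) := fun n =>
    hW.measurable_eval hF ((measurable_gridTime T n).comp hσm)
  have hm0 : Measurable fun ω => F (σ ω) (W (σ ω).toNNReal ω) := by
    have := hW.measurable_eval hF hσm.real_toNNReal
    simpa [Real.coe_toNNReal _ (hσ.nonneg _)] using this
  have hle : ∀ n, 0 < n → ∀ ω ∈ {ω | σ ω < T}, (gridTime T n (σ ω) : ℝ) ≤ T := by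
    intro n hn ω hω
    rw [setOf_lt_eq_iUnion_gridCell hT hn hσ.nonneg] at hω
    simp only [Set.mem_iUnion, Finset.mem_range, exists_prop] at hω
    obtain ⟨k, hk, hωk⟩ := hω
    rw [mem_gridCell_iff hT hn (hσ.nonneg ω)] at hωk
    rw [gridTime, hωk]
    exact_mod_cast grid_le hn hk
  have hsqn : ∀ n, 0 < n → IntegrableOn (fun ω => F (gridTime T n (σ ω))
      (W (gridTime T n (σ ω)) ω) ^ 2) {ω | σ ω < T} P ∧
      ∫ ω in {ω | σ ω < T}, F (gridTime T n (σ ω)) (W (gridTime T n (σ ω)) ω) ^ 2 ∂P ≤ K := by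
    intro n hn
    obtain ⟨h1, h2⟩ := hσ.setIntegral_expMart_gridTime hW hT θ hn
    have hbd : ∀ ω ∈ {ω | σ ω < T}, F (gridTime T n (σ ω)) (W (gridTime T n (σ ω)) ω) ^ 2 ≤
        K * expMart θ (gridTime T n (σ ω)) (W (gridTime T n (σ ω)) ω) := fun ω hω =>
      hb _ (NNReal.coe_nonneg _) (hle n hn ω hω) _
    have hintg : IntegrableOn (fun ω => F (gridTime T n (σ ω))
      (W (gridTime T n (σ ω)) ω) ^ 2) {ω | σ ω < T} P := by
      refine (h1.const_mul K).mono' ((hmn n).pow_const 2).aestronglyMeasurable ?_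
      refine (ae_restrict_mem hσT).mono fun ω hω => ?_
      rw [Real.norm_eq_abs, abs_of_nonneg (sq_nonneg _)]
      exact hbd ω hω
    refine ⟨hintg, (setIntegral_mono_on hintg (h1.const_mul K) hσT hbd).trans ?_⟩
    rw [integral_const_mul]
    exact mul_le_of_le_one_right hK h2
  have hexp : IntegrableOn (fun ω => expMart θ (σ ω) (W (σ ω).toNNReal ω)) {ω | σ ω < T} P ∧
      ∫ ω in {ω | σ ω < T}, expMart θ (σ ω) (W (σ ω).toNNReal ω) ∂P ≤ 1 := by
    have hl := hσ.lintegral_expMart_le hW hT hσm θ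
    have hme : Measurable fun ω => expMart θ (σ ω) (W (σ ω).toNNReal ω) := by
      have := hW.measurable_eval (continuous_expMart θ) hσm.real_toNNReal
      simpa [Real.coe_toNNReal _ (hσ.nonneg _)] using this
    refine ⟨(lintegral_ofReal_ne_top_iff_integrable hme.aestronglyMeasurable
      (Eventually.of_forall fun ω => (expMart_pos _ _ _).le)).1
      (ne_top_of_le_ne_top ENNReal.one_ne_top hl), ?_⟩
    rw [integral_eq_lintegral_of_nonneg_ae (Eventually.of_forall fun ω => (expMart_pos _ _ _).le)
      hme.aestronglyMeasurable]
    exact ENNReal.toReal_le_of_le_ofReal zero_le_one (by simpa using hl)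
  have hsq0 : IntegrableOn (fun ω => F (σ ω) (W (σ ω).toNNReal ω) ^ 2) {ω | σ ω < T} P ∧
      ∫ ω in {ω | σ ω < T}, F (σ ω) (W (σ ω).toNNReal ω) ^ 2 ∂P ≤ K := by
    have hbd : ∀ ω ∈ {ω | σ ω < T}, F (σ ω) (W (σ ω).toNNReal ω) ^ 2 ≤
        K * expMart θ (σ ω) (W (σ ω).toNNReal ω) := fun ω hω =>
      hb _ (hσ.nonneg ω) (le_of_lt hω) _
    have hintg : IntegrableOn (fun ω => F (σ ω) (W (σ ω).toNNReal ω) ^ 2) {ω | σ ω < T} P := by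
      refine (hexp.1.const_mul K).mono' (hm0.pow_const 2).aestronglyMeasurable ?_
      refine (ae_restrict_mem hσT).mono fun ω hω => ?_
      rw [Real.norm_eq_abs, abs_of_nonneg (sq_nonneg _)]
      exact hbd ω hω
    refine ⟨hintg, (setIntegral_mono_on hintg (hexp.1.const_mul K) hσT hbd).trans ?_⟩
    rw [integral_const_mul]
    exact mul_le_of_le_one_right hK hexp.2
  refine tendsto_nhds_unique (tendsto_integral_of_sq_bound (C := K)
    (f := fun n ω => F (gridTime T n (σ ω)) (W (gridTime T n (σ ω)) ω)) ?_ ?_ ?_ hsq0.2 ?_)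
    (tendsto_const_nhds.congr' ?_)
  · filter_upwards [eventually_gt_atTop 0] with n hn
    exact (memLp_two_iff_integrable_sq (hmn n).aestronglyMeasurable).2 (hsqn n hn).1
  · exact (memLp_two_iff_integrable_sq hm0.aestronglyMeasurable).2 hsq0.1
  · filter_upwards [eventually_gt_atTop 0] with n hn using (hsqn n hn).2
  · exact Eventually.of_forall fun ω => hW.tendsto_gridTime hT hF (hσ.nonneg ω) ω
  · filter_upwards [eventually_gt_atTop 0] with n hn
    exact (hσ.setIntegral_gridTime hW hT hFT.measurable hi hmart hn).2.symm

end Brownian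

/-! ### The hitting term of `Ψ` -/

lemma exists_abs_invHeatAiry_parabola_le {c κ : ℝ} (hκ₀ : 0 ≤ κ) (hκ : κ < 3 / 4) :
    ∃ C : ℝ, 0 < C ∧ ∀ t x l : ℝ, 0 ≤ t → c - κ * t ^ 2 ≤ x → l ≤ 0 →
      |invHeatAiry t (x - l)| ≤ C * Real.exp (l - t - |x| / 2) := by
  set δ : ℝ := 3 / 4 - κ with hδ
  have hδ0 : 0 < δ := by linarith
  set D : ℝ := 1 / 3 + |c| with hD
  have hD0 : 0 < D := by positivity
  set B : ℝ := 1 + (κ / 2 + 3 * D / 2 + 1) / δ with hB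
  have hB1 : 1 ≤ B := by
    have : 0 ≤ (κ / 2 + 3 * D / 2 + 1) / δ := by positivity
    linarith
  set M : ℝ := κ / 2 * B ^ 2 + (3 * D / 2 + 1) * B + D + |c| / 2 with hM
  have hpoly : ∀ t : ℝ, 0 ≤ t →
      (3 * t / 2 + 1) * (-δ * t ^ 2 + 1 / 3 - c) + t + |c| / 2 + κ * t ^ 2 / 2 ≤ M := by
    intro t ht
    have h1 : (3 * t / 2 + 1) * (-δ * t ^ 2 + 1 / 3 - c) ≤
        -(3 / 2) * δ * t ^ 3 + (3 * t / 2 + 1) * D := by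
      have h2 : 1 / 3 - c ≤ D := by linarith [neg_abs_le c]
      have h3 : (3 * t / 2 + 1) * (1 / 3 - c) ≤ (3 * t / 2 + 1) * D := by gcongr
      have h4 : 0 ≤ δ * t ^ 2 := by positivity
      nlinarith
    rcases le_total t B with htB | htB
    · have h2 : 0 ≤ δ * t ^ 3 := by positivity
      have h3 : κ / 2 * t ^ 2 ≤ κ / 2 * B ^ 2 := by gcongr
      have h4 : (3 * D / 2 + 1) * t ≤ (3 * D / 2 + 1) * B := by gcongr
      linarith
    · have ht1 : 1 ≤ t := hB1.trans htB
      have h2 : (κ / 2 + 3 * D / 2 + 1) = δ * (B - 1) := by rw [hB]; field_simp; ring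
      have h3 : (3 * D / 2 + 1) * t ≤ (3 * D / 2 + 1) * t ^ 2 := by gcongr; nlinarith
      have h4 : (κ / 2 + 3 * D / 2 + 1) * t ^ 2 ≤ (3 / 2) * δ * t ^ 3 := by
        rw [h2]
        have : δ * (B - 1) * t ^ 2 ≤ δ * (3 / 2 * t) * t ^ 2 := by gcongr; linarith
        linarith
      have h5 : 0 ≤ κ / 2 * B ^ 2 := by positivity
      have h6 : 0 ≤ (3 * D / 2 + 1) * B := by positivity
      linarith
  refine ⟨Real.exp M, Real.exp_pos _, fun t x l ht hx hl => ?_⟩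
  refine (abs_invHeatAiry_le (b := 3 * t / 2 + 1) (x - l) (by linarith)).trans ?_
  rw [← Real.exp_add, Real.exp_le_exp]
  have hp := hpoly t ht
  set v : ℝ := x - (c - κ * t ^ 2) with hv
  have hv0 : 0 ≤ v := by linarith
  have hxv : x = c - κ * t ^ 2 + v := by rw [hv]; ring
  have hax : |x| ≤ |c| + κ * t ^ 2 + v := by
    rw [hxv]
    refine (abs_add_le _ _).trans ?_
    rw [abs_of_nonneg hv0]
    have := abs_sub c (κ * t ^ 2)
    rw [abs_of_nonneg (by positivity : (0 : ℝ) ≤ κ * t ^ 2)] at this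
    linarith
  have e : (3 * t / 2 + 1) ^ 3 / 3 - (3 * t / 2 + 1) ^ 2 * t - (3 * t / 2 + 1) * (x - l) =
      (3 * t / 2 + 1) * (-δ * t ^ 2 + 1 / 3 - c) - (3 * t / 2 + 1) * v + (3 * t / 2 + 1) * l := by
    rw [hxv, hδ]; ring
  rw [e]
  have h1 : 0 ≤ t * v := by positivity
  have h2 : t * l ≤ 0 := mul_nonpos_of_nonneg_of_nonpos ht hl
  nlinarith

section Brownian

variable {Ω : Type*} [MeasurableSpace Ω] {P : Measure Ω} {W : ℝ≥0 → Ω → ℝ} {g : ℝ → EReal}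

/-- The event that `y + √2 W` hits the barrier. -/
def hitEvent (W : ℝ≥0 → Ω → ℝ) (g : ℝ → EReal) (y : ℝ) : Set Ω :=
  {ω | (hitTimes W g y ω).Nonempty}

/-- The value of the backward heat flow of the Airy function at the hitting time. -/
def hitValue (W : ℝ≥0 → Ω → ℝ) (g : ℝ → EReal) (l y : ℝ) (ω : Ω) : ℝ :=
  invHeatAiry (hitTime W g y ω) (y + √2 * W (hitTime W g y ω).toNNReal ω - l)

/-- The hitting term of `Ψ`. -/
def hitKernel (P : Measure Ω) (W : ℝ≥0 → Ω → ℝ) (g : ℝ → EReal) (l y : ℝ) : ℝ :=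
  ∫ ω in hitEvent W g y, hitValue W g l y ω ∂P

lemma psiKernel_eq (l y : ℝ) : psiKernel P W g l y = airyAi (y - l) - hitKernel P W g l y := rfl

lemma hitTimes_bddBelow (y : ℝ) (ω : Ω) : BddBelow (hitTimes W g y ω) := ⟨0, fun _ h => h.1⟩

lemma hitTime_nonneg (y : ℝ) (ω : Ω) : 0 ≤ hitTime W g y ω :=
  Real.sInf_nonneg fun _ h => h.1

lemma IsContBM.continuous_path (hW : IsContBM W P) (y : ℝ) (ω : Ω) :
    Continuous fun s : ℝ => y + √2 * W s.toNNReal ω := by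
  have := (hW.cont ω).comp continuous_real_toNNReal
  exact continuous_const.add (continuous_const.mul this)

lemma hitTime_lt_iff {y : ℝ} {ω : Ω} (h : ω ∈ hitEvent W g y) (t : ℝ) :
    hitTime W g y ω < t ↔ ∃ s ∈ Set.Ico 0 t, g s ≤ ((y + √2 * W s.toNNReal ω : ℝ) : EReal) := by
  unfold hitTime
  rw [csInf_lt_iff (hitTimes_bddBelow y ω) h]
  constructor
  · rintro ⟨s, ⟨hs0, hs⟩, hst⟩
    exact ⟨s, ⟨hs0, hst⟩, hs⟩
  · rintro ⟨s, ⟨hs0, hst⟩, hs⟩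
    exact ⟨s, ⟨hs0, hs⟩, hst⟩

lemma IsContBM.measurable_path (hW : IsContBM W P) (s : ℝ) :
    Measurable fun p : ℝ × Ω => p.1 + √2 * W s.toNNReal p.2 :=
  measurable_fst.add (((hW.meas _).comp measurable_snd).const_mul _)

lemma IsContBM.measurableSet_hitEvent_prod (hW : IsContBM W P) (hg : GoodBarrier g) :
    MeasurableSet {p : ℝ × Ω | p.2 ∈ hitEvent W g p.1} := by
  have e : {p : ℝ × Ω | p.2 ∈ hitEvent W g p.1} =
      ⋃ n : ℕ, {p : ℝ × Ω | ∃ s ∈ Set.Icc (0 : ℝ) n,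
        g s ≤ ((p.1 + √2 * W s.toNNReal p.2 : ℝ) : EReal)} := by
    ext p
    simp only [Set.mem_iUnion, Set.mem_ofPred_eq, hitEvent, Set.Nonempty, hitTimes]
    constructor
    · rintro ⟨s, hs0, hs⟩
      obtain ⟨n, hn⟩ := exists_nat_ge s
      exact ⟨n, s, ⟨hs0, hn⟩, hs⟩
    · rintro ⟨n, s, hs0, hs⟩
      exact ⟨s, hs0.1, hs⟩
  rw [e]
  exact MeasurableSet.iUnion fun n => hg.measurableSet_hit
    (fun p => hW.continuous_path p.1 p.2) fun s _ => hW.measurable_path s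

lemma IsContBM.measurableSet_hitEvent (hW : IsContBM W P) (hg : GoodBarrier g) (y : ℝ) :
    MeasurableSet (hitEvent W g y) :=
  measurable_prodMk_left (hW.measurableSet_hitEvent_prod hg)

lemma IsContBM.measurable_hitTime_prod (hW : IsContBM W P) (hg : GoodBarrier g) :
    Measurable fun p : ℝ × Ω => hitTime W g p.1 p.2 := by
  refine measurable_of_Iio fun t => ?_
  rcases le_or_gt t 0 with ht | ht
  · convert MeasurableSet.empty
    ext p
    simpa using ht.trans (hitTime_nonneg p.1 p.2)
  have e : (fun p : ℝ × Ω => hitTime W g p.1 p.2) ⁻¹' Set.Iio t =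
      {p : ℝ × Ω | ∃ s ∈ Set.Ico (0 : ℝ) t, g s ≤ ((p.1 + √2 * W s.toNNReal p.2 : ℝ) : EReal)} ∪
        {p : ℝ × Ω | p.2 ∈ hitEvent W g p.1}ᶜ := by
    ext p
    simp only [Set.mem_preimage, Set.mem_Iio, Set.mem_union, Set.mem_compl_iff, Set.mem_ofPred_eq]
    by_cases h : p.2 ∈ hitEvent W g p.1
    · rw [hitTime_lt_iff h]
      simp [h]
    · simp only [h, not_false_eq_true, or_true, iff_true]
      have : hitTimes W g p.1 p.2 = ∅ := Set.not_nonempty_iff_eq_empty.1 h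
      rw [hitTime, this, Real.sInf_empty]
      exact ht
  rw [e]
  exact (hg.measurableSet_hit_lt (fun p => hW.continuous_path p.1 p.2)
    fun s _ => hW.measurable_path s).union (hW.measurableSet_hitEvent_prod hg).compl

lemma IsContBM.measurable_hitTime (hW : IsContBM W P) (hg : GoodBarrier g) (y : ℝ) :
    Measurable (hitTime W g y) :=
  Measurable.comp (g := fun p : ℝ × Ω => hitTime W g p.1 p.2) (f := fun ω => (y, ω))
    (hW.measurable_hitTime_prod hg) measurable_prodMk_left

lemma IsContBM.measurable_hitValue_prod (hW : IsContBM W P) (hg : GoodBarrier g) :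
    Measurable fun p : (ℝ × ℝ) × Ω => hitValue W g p.1.1 p.1.2 p.2 := by
  have h1 : Measurable fun p : (ℝ × ℝ) × Ω => hitTime W g p.1.2 p.2 :=
    Measurable.comp (g := fun p : ℝ × Ω => hitTime W g p.1 p.2)
      (f := fun p : (ℝ × ℝ) × Ω => (p.1.2, p.2)) (hW.measurable_hitTime_prod hg)
      ((measurable_snd.comp measurable_fst).prodMk measurable_snd)
  have h2 : Measurable fun p : (ℝ × ℝ) × Ω => W (hitTime W g p.1.2 p.2).toNNReal p.2 :=
    hW.measurable_uncurry.comp (h1.real_toNNReal.prodMk measurable_snd)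
  exact Measurable.invHeatAiry h1 (((measurable_snd.comp measurable_fst).add
    (h2.const_mul _)).sub (measurable_fst.comp measurable_fst))

lemma IsContBM.measurable_hitValue (hW : IsContBM W P) (hg : GoodBarrier g) (l y : ℝ) :
    Measurable (hitValue W g l y) :=
  Measurable.comp (g := fun p : (ℝ × ℝ) × Ω => hitValue W g p.1.1 p.1.2 p.2)
    (f := fun ω => ((l, y), ω)) (hW.measurable_hitValue_prod hg) measurable_prodMk_left

lemma hitKernel_eq_integral_indicator (hW : IsContBM W P) (hg : GoodBarrier g) (l y : ℝ) :
    hitKernel P W g l y = ∫ ω, (hitEvent W g y).indicator (hitValue W g l y) ω ∂P :=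
  (integral_indicator (hW.measurableSet_hitEvent hg y)).symm

lemma measurable_hitKernel [IsProbabilityMeasure P] (hW : IsContBM W P) (hg : GoodBarrier g) :
    Measurable (Function.uncurry (hitKernel P W g)) := by
  have e : Function.uncurry (hitKernel P W g) = fun q : ℝ × ℝ =>
      ∫ ω, (hitEvent W g q.2).indicator (hitValue W g q.1 q.2) ω ∂P := by
    ext q
    exact hitKernel_eq_integral_indicator hW hg q.1 q.2
  rw [e]
  have hm : Measurable fun p : (ℝ × ℝ) × Ω =>
      (hitEvent W g p.1.2).indicator (hitValue W g p.1.1 p.1.2) p.2 := by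
    have hs : MeasurableSet {p : (ℝ × ℝ) × Ω | p.2 ∈ hitEvent W g p.1.2} :=
      ((measurable_snd.comp measurable_fst).prodMk measurable_snd)
        (hW.measurableSet_hitEvent_prod hg)
    have := (hW.measurable_hitValue_prod hg).indicator hs
    convert this using 1
    ext p
    by_cases hp : p.2 ∈ hitEvent W g p.1.2
    · rw [Set.indicator_of_mem hp, Set.indicator_of_mem (by exact hp)]
    · rw [Set.indicator_of_notMem hp, Set.indicator_of_notMem (by exact hp)]
  exact (StronglyMeasurable.integral_prod_right (f := fun (q : ℝ × ℝ) ω =>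
    (hitEvent W g q.2).indicator (hitValue W g q.1 q.2) ω) hm.stronglyMeasurable).measurable

open Classical in
/-- The hitting time, with value `T + 1` if the barrier is not hit. -/
def stopTime (W : ℝ≥0 → Ω → ℝ) (g : ℝ → EReal) (y : ℝ) (T : ℝ≥0) (ω : Ω) : ℝ :=
  if ω ∈ hitEvent W g y then hitTime W g y ω else T + 1

lemma stopTime_lt_iff {y : ℝ} {T : ℝ≥0} {t : ℝ} (ht : t ≤ T) (ω : Ω) :
    stopTime W g y T ω < t ↔
      ∃ s ∈ Set.Ico 0 t, g s ≤ ((y + √2 * W s.toNNReal ω : ℝ) : EReal) := by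
  by_cases h : ω ∈ hitEvent W g y
  · rw [stopTime, if_pos h, hitTime_lt_iff h]
  · rw [stopTime, if_neg h]
    constructor
    · intro h2
      linarith
    · rintro ⟨s, hs, hgs⟩
      exact absurd ⟨s, hs.1, hgs⟩ h

lemma IsContBM.measurable_stopTime (hW : IsContBM W P) (hg : GoodBarrier g) (y : ℝ) (T : ℝ≥0) :
    Measurable (stopTime W g y T) :=
  Measurable.ite (hW.measurableSet_hitEvent hg y) (hW.measurable_hitTime hg y) measurable_const

lemma IsContBM.isOptionalTime_stopTime (hW : IsContBM W P) (hg : GoodBarrier g) (y : ℝ)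
    (T : ℝ≥0) : IsOptionalTime W T (stopTime W g y T) where
  nonneg ω := by
    unfold stopTime
    split_ifs
    · exact hitTime_nonneg y ω
    · positivity
  meas t ht := by
    simp_rw [stopTime_lt_iff (g := g) (NNReal.coe_le_coe.2 ht)]
    refine @GoodBarrier.measurableSet_hit_lt _ hg _ (pastAlgebra W t)
      (fun ω s => y + √2 * W s.toNNReal ω) 0 t (fun ω => hW.continuous_path y ω) fun s hs => ?_
    have h1 : Measurable[pastAlgebra W t] (W s.toNNReal) :=
      measurable_pastAlgebra W (Real.toNNReal_le_iff_le_coe.2 hs.2.le)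
    exact (h1.const_mul _).const_add _

lemma IsContBM.lintegral_hit_expMart_le [IsProbabilityMeasure P] (hW : IsContBM W P)
    (hg : GoodBarrier g) (y θ : ℝ) :
    ∫⁻ ω in hitEvent W g y, ENNReal.ofReal
      (expMart θ (hitTime W g y ω) (W (hitTime W g y ω).toNNReal ω)) ∂P ≤ 1 := by
  have e : hitEvent W g y = ⋃ n : ℕ, {ω | stopTime W g y ((n : ℝ≥0) + 1) ω < ((n : ℝ≥0) + 1 : ℝ≥0)} := by
    ext ω
    simp only [Set.mem_iUnion, Set.mem_ofPred_eq, stopTime_lt_iff le_rfl]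
    constructor
    · rintro ⟨s, hs0, hs⟩
      obtain ⟨n, hn⟩ := exists_nat_ge s
      refine ⟨n, s, ⟨hs0, ?_⟩, hs⟩
      push_cast
      linarith
    · rintro ⟨n, s, hs0, hs⟩
      exact ⟨s, hs0.1, hs⟩
  have hsub : ∀ n : ℕ, {ω | stopTime W g y ((n : ℝ≥0) + 1) ω < ((n : ℝ≥0) + 1 : ℝ≥0)} ⊆
      hitEvent W g y := fun n => by
    rw [e]
    exact Set.subset_iUnion
      (fun n : ℕ => {ω | stopTime W g y ((n : ℝ≥0) + 1) ω < ((n : ℝ≥0) + 1 : ℝ≥0)}) n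
  have hmono : Monotone fun n : ℕ =>
      {ω | stopTime W g y ((n : ℝ≥0) + 1) ω < ((n : ℝ≥0) + 1 : ℝ≥0)} := by
    intro m n hmn ω hω
    simp only [Set.mem_ofPred_eq, stopTime_lt_iff le_rfl] at hω ⊢
    obtain ⟨s, hs, h⟩ := hω
    refine ⟨s, ⟨hs.1, hs.2.trans_le ?_⟩, h⟩
    have : (m : ℝ) ≤ n := by exact_mod_cast hmn
    push_cast
    linarith
  conv_lhs => rw [e]
  rw [setLIntegral_iUnion_of_directed _ hmono.directed_le]
  refine iSup_le fun n => ?_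
  have hm := hW.pastAlgebra_le _ _ ((hW.isOptionalTime_stopTime hg y ((n : ℝ≥0) + 1)).meas _ le_rfl)
  refine le_trans (le_of_eq ?_) ((hW.isOptionalTime_stopTime hg y ((n : ℝ≥0) + 1)).lintegral_expMart_le
    hW (by positivity) (hW.measurable_stopTime hg y _) θ)
  refine setLIntegral_congr_fun hm fun ω hω => ?_
  simp only [stopTime, if_pos (hsub n hω)]

/-- The barrier lies above a parabola. -/
def AboveParabola (c κ : ℝ) (g : ℝ → EReal) : Prop :=
  ∀ t : ℝ, ((c - κ * t ^ 2 : ℝ) : EReal) ≤ g t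

lemma AboveParabola.comp_neg {c κ : ℝ} (h : AboveParabola c κ g) :
    AboveParabola c κ fun t => g (-t) := fun t => by simpa using h (-t)

lemma AboveParabola.cutBarrier {c κ : ℝ} (h : AboveParabola c κ g) (L : ℝ) :
    AboveParabola c κ (cutBarrier L g) := fun t => by
  unfold AiryHitting.cutBarrier
  split_ifs
  · exact h t
  · exact le_top

lemma IsContBM.parabola_le (hW : IsContBM W P) {c κ : ℝ} (h : AboveParabola c κ g) {y : ℝ} {ω : Ω}
    (hω : ω ∈ hitEvent W g y) :
    c - κ * hitTime W g y ω ^ 2 ≤ y + √2 * W (hitTime W g y ω).toNNReal ω := by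
  have hcl : IsClosed {t : ℝ | c - κ * t ^ 2 ≤ y + √2 * W t.toNNReal ω} :=
    isClosed_le (by fun_prop) (hW.continuous_path y ω)
  have hsub : hitTimes W g y ω ⊆ {t : ℝ | c - κ * t ^ 2 ≤ y + √2 * W t.toNNReal ω} := by
    rintro t ⟨_, ht⟩
    exact EReal.coe_le_coe_iff.1 ((h t).trans ht)
  exact hcl.closure_subset_iff.2 hsub (csInf_mem_closure hω (hitTimes_bddBelow y ω))

/-- The sum of two exponential martingales at the hitting time. -/
def hitExp (W : ℝ≥0 → Ω → ℝ) (g : ℝ → EReal) (y : ℝ) (ω : Ω) : ℝ :=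
  expMart (√2 / 2) (hitTime W g y ω) (W (hitTime W g y ω).toNNReal ω) +
    expMart (-(√2 / 2)) (hitTime W g y ω) (W (hitTime W g y ω).toNNReal ω)

lemma hitExp_nonneg (y : ℝ) (ω : Ω) : 0 ≤ hitExp W g y ω :=
  add_nonneg (expMart_pos _ _ _).le (expMart_pos _ _ _).le

lemma IsContBM.measurable_hitExp (hW : IsContBM W P) (hg : GoodBarrier g) (y : ℝ) :
    Measurable (hitExp W g y) := by
  have h1 := hW.measurable_hitTime hg y
  have h2 : Measurable fun ω => W (hitTime W g y ω).toNNReal ω :=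
    hW.measurable_uncurry.comp (h1.real_toNNReal.prodMk measurable_id)
  exact ((continuous_expMart _).measurable.comp (h1.prodMk h2)).add
    ((continuous_expMart _).measurable.comp (h1.prodMk h2))

lemma IsContBM.lintegral_hitExp_le [IsProbabilityMeasure P] (hW : IsContBM W P)
    (hg : GoodBarrier g) (y : ℝ) :
    ∫⁻ ω in hitEvent W g y, ENNReal.ofReal (hitExp W g y ω) ∂P ≤ 2 := by
  unfold hitExp
  simp_rw [ENNReal.ofReal_add (expMart_pos _ _ _).le (expMart_pos _ _ _).le]
  have h1 := hW.measurable_hitTime hg y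
  have h2 : Measurable fun ω => W (hitTime W g y ω).toNNReal ω :=
    hW.measurable_uncurry.comp (h1.real_toNNReal.prodMk measurable_id)
  have h3 : Measurable fun ω => ENNReal.ofReal
      (expMart (√2 / 2) (hitTime W g y ω) (W (hitTime W g y ω).toNNReal ω)) :=
    ((continuous_expMart _).measurable.comp (h1.prodMk h2)).ennreal_ofReal
  rw [lintegral_add_left h3]
  refine (add_le_add (hW.lintegral_hit_expMart_le hg y _)
    (hW.lintegral_hit_expMart_le hg y _)).trans ?_
  norm_num

lemma IsContBM.integrable_hitExp [IsProbabilityMeasure P] (hW : IsContBM W P)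
    (hg : GoodBarrier g) (y : ℝ) : IntegrableOn (hitExp W g y) (hitEvent W g y) P :=
  (lintegral_ofReal_ne_top_iff_integrable (hW.measurable_hitExp hg y).aestronglyMeasurable
    (Eventually.of_forall fun ω => hitExp_nonneg y ω)).1
    (ne_top_of_le_ne_top (by norm_num) (hW.lintegral_hitExp_le hg y))

lemma IsContBM.integral_hitExp_le [IsProbabilityMeasure P] (hW : IsContBM W P)
    (hg : GoodBarrier g) (y : ℝ) : ∫ ω in hitEvent W g y, hitExp W g y ω ∂P ≤ 2 := by
  rw [integral_eq_lintegral_of_nonneg_ae (Eventually.of_forall fun ω => hitExp_nonneg y ω)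
    (hW.measurable_hitExp hg y).aestronglyMeasurable]
  exact ENNReal.toReal_le_of_le_ofReal zero_le_two (by simpa using hW.lintegral_hitExp_le hg y)

lemma exp_abs_sub_le (t w : ℝ) (ht : 0 ≤ t) : Real.exp (|√2 * w| / 2 - t) ≤
    expMart (√2 / 2) t w + expMart (-(√2 / 2)) t w := by
  have hs : (√2 / 2) ^ 2 = (1 : ℝ) / 2 := by
    rw [div_pow, Real.sq_sqrt (by norm_num)]; norm_num
  rcases abs_cases (√2 * w) with ⟨h, _⟩ | ⟨h, _⟩
  · refine le_trans ?_ (le_add_of_nonneg_right (expMart_pos _ _ _).le)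
    rw [expMart, h, hs, Real.exp_le_exp]
    linarith
  · refine le_trans ?_ (le_add_of_nonneg_left (expMart_pos _ _ _).le)
    rw [expMart, h, neg_sq, hs, Real.exp_le_exp]
    linarith

/-- A uniform bound for barriers above a given parabola. -/
structure IsHitBound (c κ C : ℝ) : Prop where
  pos : 0 < C
  bound : ∀ t x l : ℝ, 0 ≤ t → c - κ * t ^ 2 ≤ x → l ≤ 0 →
      |invHeatAiry t (x - l)| ≤ C * Real.exp (l - t - |x| / 2)

lemma IsContBM.abs_hitValue_le (hW : IsContBM W P) {c κ C : ℝ} (hC : IsHitBound c κ C)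
    (h : AboveParabola c κ g) {l y : ℝ} (hl : l ≤ 0) {ω : Ω} (hω : ω ∈ hitEvent W g y) :
    |hitValue W g l y ω| ≤ C * Real.exp (l - |y| / 2) * hitExp W g y ω := by
  set t := hitTime W g y ω with ht
  set w := W t.toNNReal ω with hw
  have ht0 : 0 ≤ t := hitTime_nonneg y ω
  refine (hC.bound t (y + √2 * w) l ht0 (hW.parabola_le h hω) hl).trans ?_
  have h1 := exp_abs_sub_le t w ht0
  have h2 : |y| ≤ |y + √2 * w| + |√2 * w| := by
    have := abs_sub (y + √2 * w) (√2 * w)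
    simpa using this
  rw [mul_assoc]
  have hC0 := hC.pos
  gcongr
  calc Real.exp (l - t - |y + √2 * w| / 2)
      ≤ Real.exp ((l - |y| / 2) + (|√2 * w| / 2 - t)) := by
        rw [Real.exp_le_exp]; linarith
    _ = Real.exp (l - |y| / 2) * Real.exp (|√2 * w| / 2 - t) := Real.exp_add _ _
    _ ≤ _ := by gcongr; exact h1

lemma IsContBM.abs_hitValue_le_const (hW : IsContBM W P) {c κ C : ℝ} (hC : IsHitBound c κ C)
    (h : AboveParabola c κ g) {l y : ℝ} (hl : l ≤ 0) {ω : Ω} (hω : ω ∈ hitEvent W g y) :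
    |hitValue W g l y ω| ≤ C := by
  have ht0 : 0 ≤ hitTime W g y ω := hitTime_nonneg y ω
  refine (hC.bound _ _ l ht0 (hW.parabola_le h hω) hl).trans ?_
  refine mul_le_of_le_one_right hC.pos.le ?_
  rw [Real.exp_le_one_iff]
  have := abs_nonneg (y + √2 * W (hitTime W g y ω).toNNReal ω)
  linarith

/-- The hitting term decays exponentially. -/
lemma IsContBM.abs_hitKernel_le [IsProbabilityMeasure P] (hW : IsContBM W P) (hg : GoodBarrier g)
    {c κ C : ℝ} (hC : IsHitBound c κ C) (h : AboveParabola c κ g) {l : ℝ} (hl : l ≤ 0) (y : ℝ) :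
    |hitKernel P W g l y| ≤ 2 * C * Real.exp (l - |y| / 2) := by
  have hi := (hW.integrable_hitExp hg y).const_mul (C * Real.exp (l - |y| / 2))
  have h1 : |hitKernel P W g l y| ≤
      ∫ ω in hitEvent W g y, C * Real.exp (l - |y| / 2) * hitExp W g y ω ∂P := by
    rw [← Real.norm_eq_abs, hitKernel]
    refine norm_integral_le_of_norm_le hi ?_
    refine (ae_restrict_mem (hW.measurableSet_hitEvent hg y)).mono fun ω hω => ?_
    exact hW.abs_hitValue_le hC h hl hω
  refine h1.trans ?_
  rw [integral_const_mul]
  have := hW.integral_hitExp_le hg y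
  have hC0 := hC.pos
  calc _ ≤ C * Real.exp (l - |y| / 2) * 2 := by gcongr
    _ = _ := by ring

lemma hitKernel_of_le [IsProbabilityMeasure P] (hW : IsContBM W P) {y : ℝ} (hy : g 0 ≤ (y : EReal))
    (l : ℝ) : hitKernel P W g l y = airyAi (y - l) := by
  have h0 : ∀ ω, (0 : ℝ) ∈ hitTimes W g y ω := fun ω => ⟨le_rfl, by
    simpa [hW.zero] using hy⟩
  have h1 : hitEvent W g y = Set.univ := Set.eq_univ_of_forall fun ω => ⟨0, h0 ω⟩
  have h2 : ∀ ω, hitTime W g y ω = 0 := fun ω =>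
    le_antisymm (csInf_le (hitTimes_bddBelow y ω) (h0 ω)) (hitTime_nonneg y ω)
  rw [hitKernel, h1, Measure.restrict_univ]
  simp [hitValue, h2, hW.zero, invHeatAiry_zero]

lemma cutPsiKernel_eq [IsProbabilityMeasure P] (hW : IsContBM W P) (l y : ℝ) :
    cutPsiKernel P W g l y =
      (Set.Iic (0 : ℝ)).indicator (fun l => airyAi (y - l) - hitKernel P W g l y) l := by
  unfold cutPsiKernel
  by_cases hl : l ≤ 0
  · rw [Set.indicator_of_mem (by exact hl)]
    by_cases hy : (y : EReal) ≤ g 0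
    · rw [if_pos ⟨hl, hy⟩, psiKernel_eq]
    · rw [if_neg (fun h => hy h.2), hitKernel_of_le hW (le_of_not_ge hy), sub_self]
  · rw [if_neg (fun h => hl h.1), Set.indicator_of_notMem (by exact hl)]

lemma hitTimes_cutBarrier (L y : ℝ) (ω : Ω) :
    hitTimes W (cutBarrier L g) y ω = hitTimes W g y ω ∩ Set.Iic L := by
  ext t
  simp only [hitTimes, cutBarrier, Set.mem_ofPred_eq, Set.mem_inter_iff, Set.mem_Iic]
  by_cases h : |t| ≤ L
  · rw [if_pos h]
    exact ⟨fun h2 => ⟨h2, (le_abs_self t).trans h⟩, fun h2 => h2.1⟩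
  · rw [if_neg h]
    constructor
    · rintro ⟨_, h2⟩
      exact absurd (top_le_iff.1 h2) (EReal.coe_ne_top _)
    · rintro ⟨⟨h1, _⟩, h3⟩
      exact absurd (by rwa [abs_of_nonneg h1]) h

lemma IsContBM.integrable_invHeatAiry (hW : IsContBM W P) (T : ℝ≥0) (t y l : ℝ) :
    Integrable (fun ω => invHeatAiry t (y + √2 * W T ω - l)) P := by
  have h1 := integrable_invHeatAiry_gaussian t (y - l) T
  rw [← (hW.bm.hasLaw_eval T).map_eq, integrable_map_measure
    (Continuous.aestronglyMeasurable (by fun_prop)) (hW.meas T).aemeasurable] at h1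
  refine h1.congr (Eventually.of_forall fun ω => ?_)
  simp only [Function.comp_apply]
  congr 1
  ring

/-- The hitting term for the barrier cut off at time `L`, by optional stopping. -/
lemma hitKernel_cutBarrier [IsProbabilityMeasure P] (hW : IsContBM W P) (hg : GoodBarrier g)
    {c κ C : ℝ} (hC : IsHitBound c κ C) (h : AboveParabola c κ g)
    {L : ℝ} (hL : 0 < L) {l : ℝ} (hl : l ≤ 0) (y : ℝ) :
    hitKernel P W (cutBarrier L g) l y =
      ∫ ω in hitEvent W (cutBarrier L g) y,
        invHeatAiry L (y + √2 * W L.toNNReal ω - l) ∂P := by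
  have hgL := hg.cutBarrier L
  set T : ℝ≥0 := L.toNNReal with hT
  have hTL : (T : ℝ) = L := Real.coe_toNNReal L hL.le
  have hT0 : 0 < T := Real.toNNReal_pos.2 hL
  set σ := stopTime W (cutBarrier L g) y T
  set E := hitEvent W (cutBarrier L g) y
  have hσm := hW.measurable_stopTime hgL y T
  have hσ := hW.isOptionalTime_stopTime hgL y T
  have hle : ∀ ω ∈ E, hitTime W (cutBarrier L g) y ω ≤ L := by
    rintro ω ⟨s, hs⟩
    have := hs
    rw [hitTimes_cutBarrier] at this
    exact (csInf_le (hitTimes_bddBelow y ω) hs).trans this.2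
  have hsub : {ω | σ ω < T} ⊆ E := by
    intro ω hω
    by_contra h
    have : σ ω = T + 1 := if_neg h
    simp only [Set.mem_ofPred_eq, this] at hω
    linarith
  have hEm : MeasurableSet E := hW.measurableSet_hitEvent hgL y
  have hAm := hσ.measurableSet_lt hW
  set F : ℝ → ℝ → ℝ := fun t x => invHeatAiry t (y + √2 * x - l) with hF
  have hFc : Continuous (Function.uncurry F) := by
    unfold Function.uncurry
    fun_prop
  have hmart : ∀ t : ℝ≥0, t ≤ T → ∀ x,
      ∫ z, F T (x + z) ∂(gaussianReal 0 (T - t)) = F t x := by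
    intro t ht x
    have := integral_invHeatAiry_gaussian t (y + √2 * x - l) (T - t)
    rw [NNReal.coe_sub ht, add_sub_cancel] at this
    change ∫ z, invHeatAiry T (y + √2 * (x + z) - l) ∂_ = invHeatAiry t (y + √2 * x - l)
    rw [← this]
    refine integral_congr_ae (Eventually.of_forall fun z => ?_)
    simp only
    congr 1
    ring
  set b : ℝ := T + 1 with hb
  have hsq2 : (√2 : ℝ) ^ 2 = 2 := Real.sq_sqrt (by norm_num)
  have hbound : ∀ t : ℝ, 0 ≤ t → t ≤ T → ∀ x, F t x ^ 2 ≤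
      Real.exp (2 * b ^ 3 / 3 + 2 * b ^ 2 * T - 2 * b * (y - l)) * expMart (-2 * b * √2) t x := by
    intro t _ htT x
    have h1 := abs_invHeatAiry_le (b := b) (t := t) (y + √2 * x - l) (by rw [hb]; linarith)
    calc F t x ^ 2 = |F t x| ^ 2 := (sq_abs _).symm
      _ ≤ Real.exp (b ^ 3 / 3 - b ^ 2 * t - b * (y + √2 * x - l)) ^ 2 := by gcongr
      _ = Real.exp (2 * (b ^ 3 / 3 - b ^ 2 * t - b * (y + √2 * x - l))) := by
          rw [← Real.exp_nat_mul]; norm_num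
      _ ≤ _ := by
          rw [expMart, ← Real.exp_add, Real.exp_le_exp]
          have h2 : (-2 * b * √2) ^ 2 = 8 * b ^ 2 := by rw [mul_pow, hsq2]; ring
          rw [h2]
          have h3 : b ^ 2 * t ≤ b ^ 2 * T := by gcongr
          linarith
  have hopt := hσ.setIntegral_eq hW hT0 hσm hFc hmart hbound (Real.exp_pos _).le
  have hsplit : ∀ f : Ω → ℝ, IntegrableOn f E P → ∫ ω in E, f ω ∂P =
      ∫ ω in {ω | σ ω < T}, f ω ∂P + ∫ ω in E \ {ω | σ ω < T}, f ω ∂P := by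
    intro f hf
    rw [← setIntegral_union Set.disjoint_sdiff_right (hEm.diff hAm) (hf.mono_set hsub)
      (hf.mono_set Set.sdiff_subset), Set.union_sdiff_cancel hsub]
  have hi₁ : IntegrableOn (hitValue W (cutBarrier L g) l y) E P := by
    refine Integrable.mono' (integrable_const C)
      (hW.measurable_hitValue hgL l y).aestronglyMeasurable ?_
    filter_upwards [ae_restrict_mem hEm] with ω hω
    exact hW.abs_hitValue_le_const hC (h.cutBarrier L) hl hω
  have hi₂ : IntegrableOn (fun ω => invHeatAiry L (y + √2 * W T ω - l)) E P :=
    (hW.integrable_invHeatAiry T L y l).integrableOn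
  rw [hitKernel, hsplit _ hi₁, hsplit _ hi₂]
  congr 1
  · have h1 : ∫ ω in {ω | σ ω < T}, hitValue W (cutBarrier L g) l y ω ∂P =
        ∫ ω in {ω | σ ω < T}, F (σ ω) (W (σ ω).toNNReal ω) ∂P := by
      refine setIntegral_congr_fun hAm fun ω hω => ?_
      have : σ ω = hitTime W (cutBarrier L g) y ω := if_pos (hsub hω)
      simp only [hF, this, hitValue]
    rw [h1, hopt, hF, hTL]
  · refine setIntegral_congr_fun (hEm.diff hAm) fun ω hω => ?_
    have h1 : σ ω = hitTime W (cutBarrier L g) y ω := if_pos hω.1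
    have h2 : hitTime W (cutBarrier L g) y ω = L := by
      refine le_antisymm (hle ω hω.1) ?_
      have := hω.2
      simp only [Set.mem_ofPred_eq, not_lt, h1, hTL] at this
      exact this
    simp only [hitValue, h2, ← hT]

lemma hitEvent_cutBarrier_subset (L y : ℝ) : hitEvent W (cutBarrier L g) y ⊆ hitEvent W g y := by
  rintro ω ⟨t, ht⟩
  rw [hitTimes_cutBarrier] at ht
  exact ⟨t, ht.1⟩

lemma hitTime_cutBarrier {L y : ℝ} {ω : Ω} (hω : ω ∈ hitEvent W (cutBarrier L g) y) :
    hitTime W (cutBarrier L g) y ω = hitTime W g y ω := by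
  unfold hitTime
  have hω' : (hitTimes W (cutBarrier L g) y ω).Nonempty := hω
  refine le_antisymm ?_ ?_
  · refine le_csInf (hitEvent_cutBarrier_subset L y hω) fun t ht => ?_
    by_cases htL : t ≤ L
    · refine csInf_le (hitTimes_bddBelow y ω) ?_
      rw [hitTimes_cutBarrier]
      exact ⟨ht, htL⟩
    · obtain ⟨s, hs⟩ := hω'
      refine (csInf_le (hitTimes_bddBelow y ω) hs).trans ?_
      rw [hitTimes_cutBarrier] at hs
      exact hs.2.trans (not_le.1 htL).le
  · refine csInf_le_csInf (hitTimes_bddBelow y ω) hω' ?_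
    rw [hitTimes_cutBarrier]
    exact Set.inter_subset_left

lemma tendsto_hitKernel_cutBarrier [IsProbabilityMeasure P] (hW : IsContBM W P)
    (hg : GoodBarrier g) {c κ C : ℝ} (hC : IsHitBound c κ C) (h : AboveParabola c κ g) {l : ℝ}
    (hl : l ≤ 0) (y : ℝ) :
    Tendsto (fun L => hitKernel P W (cutBarrier L g) l y) atTop (𝓝 (hitKernel P W g l y)) := by
  rw [hitKernel_eq_integral_indicator hW hg]
  have e : ∀ L, hitKernel P W (cutBarrier L g) l y = ∫ ω, (hitEvent W (cutBarrier L g) y).indicator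
      (hitValue W (cutBarrier L g) l y) ω ∂P := fun L =>
    hitKernel_eq_integral_indicator hW (hg.cutBarrier L) l y
  simp_rw [e]
  refine tendsto_integral_filter_of_dominated_convergence (fun _ => C) ?_ ?_
    (integrable_const C) ?_
  · refine Eventually.of_forall fun L => ?_
    exact ((hW.measurable_hitValue (hg.cutBarrier L) l y).indicator
      (hW.measurableSet_hitEvent (hg.cutBarrier L) y)).aestronglyMeasurable
  · refine Eventually.of_forall fun L => Eventually.of_forall fun ω => ?_
    by_cases hω : ω ∈ hitEvent W (cutBarrier L g) y
    · rw [Set.indicator_of_mem hω]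
      exact hW.abs_hitValue_le_const hC (h.cutBarrier L) hl hω
    · rw [Set.indicator_of_notMem hω, norm_zero]
      exact hC.pos.le
  · refine Eventually.of_forall fun ω => tendsto_const_nhds.congr' ?_
    by_cases hω : ω ∈ hitEvent W g y
    · obtain ⟨t, ht⟩ := id hω
      filter_upwards [eventually_ge_atTop t] with L hL
      have hω' : ω ∈ hitEvent W (cutBarrier L g) y := by
        refine ⟨t, ?_⟩
        rw [hitTimes_cutBarrier]
        exact ⟨ht, hL⟩
      rw [Set.indicator_of_mem hω, Set.indicator_of_mem hω', hitValue, hitValue,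
        hitTime_cutBarrier hω']
    · refine Eventually.of_forall fun L => ?_
      simp only [Set.indicator_of_notMem hω, Set.indicator_of_notMem
        fun h' => hω (hitEvent_cutBarrier_subset L y h')]

end Brownian

/-! ### Path decomposition of the Brownian bridge -/

/-- Continuous paths with the σ-algebra generated by the evaluations. -/
abbrev PathSpace : Type := {w : ℝ≥0 → ℝ // Continuous w}

lemma measurable_pathSpace_eval (s : ℝ≥0) : Measurable fun w : PathSpace => w.1 s :=
  (measurable_pi_apply s).comp measurable_subtype_coe

lemma PathSpace.continuous_path (y : ℝ) (w : PathSpace) :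
    Continuous fun s : ℝ => y + √2 * w.1 s.toNNReal :=
  continuous_const.add (continuous_const.mul (w.2.comp continuous_real_toNNReal))

section Brownian

variable {Ω : Type*} [MeasurableSpace Ω] {P : Measure Ω} {W : ℝ≥0 → Ω → ℝ} {g : ℝ → EReal}

/-- A continuous process as a random path. -/
def toPath (X : ℝ≥0 → Ω → ℝ) (hX : ∀ ω, Continuous (X · ω)) (ω : Ω) : PathSpace := ⟨(X · ω), hX ω⟩

lemma measurable_toPath {X : ℝ≥0 → Ω → ℝ} (hX : ∀ ω, Continuous (X · ω))
    (hm : ∀ t, Measurable (X t)) : Measurable (toPath X hX) :=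
  (measurable_pi_lambda _ hm).subtype_mk

lemma comap_toPath {X : ℝ≥0 → Ω → ℝ} (hX : ∀ ω, Continuous (X · ω)) :
    MeasurableSpace.comap (toPath X hX) inferInstance =
      MeasurableSpace.comap (fun ω t => X t ω) MeasurableSpace.pi := by
  change MeasurableSpace.comap (toPath X hX) (MeasurableSpace.comap _ _) = _
  rw [MeasurableSpace.comap_comp]
  rfl

lemma map_toPath_eq {X Y : ℝ≥0 → Ω → ℝ} (hX : ∀ ω, Continuous (X · ω))
    (hY : ∀ ω, Continuous (Y · ω)) (hXm : ∀ t, Measurable (X t)) (hYm : ∀ t, Measurable (Y t))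
    (h : P.map (fun ω t => X t ω) = P.map (fun ω t => Y t ω)) :
    P.map (toPath X hX) = P.map (toPath Y hY) := by
  ext S hS
  obtain ⟨S', hS', rfl⟩ := hS
  rw [Measure.map_apply (measurable_toPath hX hXm) (measurable_subtype_coe hS'),
    Measure.map_apply (measurable_toPath hY hYm) (measurable_subtype_coe hS')]
  have := congrArg (fun μ => μ S') h
  rwa [Measure.map_apply (measurable_pi_lambda _ hXm) hS',
    Measure.map_apply (measurable_pi_lambda _ hYm) hS'] at this

/-- The Brownian bridge of length `T`. -/
def bridgePart (W : ℝ≥0 → Ω → ℝ) (T s : ℝ≥0) (ω : Ω) : ℝ :=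
  W (min s T) ω - ((min s T : ℝ≥0) : ℝ) / T * W T ω

lemma IsContBM.continuous_bridgePart (hW : IsContBM W P) (T : ℝ≥0) (ω : Ω) :
    Continuous (bridgePart W T · ω) := by
  have := hW.cont ω
  unfold bridgePart
  fun_prop

lemma IsContBM.measurable_bridgePart (hW : IsContBM W P) (T s : ℝ≥0) :
    Measurable (bridgePart W T s) :=
  (hW.meas _).sub ((hW.meas _).const_mul _)

lemma IsContBM.memLp_two (hW : IsContBM W P) (t : ℝ≥0) : MemLp (W t) 2 P :=
  (hW.bm.isGaussianProcess.hasGaussianLaw_eval t).memLp_two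

lemma IsContBM.indepFun_bridgePart [IsProbabilityMeasure P] (hW : IsContBM W P) {T : ℝ≥0}
    (hT : 0 < T) : IndepFun (W T) (fun ω s => bridgePart W T s ω) P := by
  have h : IndepFun (fun ω (_ : Unit) => W T ω) (fun ω s => bridgePart W T s ω) P := by
    apply IsGaussianProcess.indepFun_of_covariance_eq_zero (X := fun _ : Unit => W T)
    · apply hW.bm.isGaussianProcess.of_isGaussianProcess
      rintro (t | s)
      · exact ⟨{T},
          { toFun x := x ⟨T, by simp⟩
            map_add' x y := by simp
            map_smul' c x := by simp }, by simp⟩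
      · exact ⟨{min s T, T},
          { toFun x := x ⟨min s T, by simp⟩ - ((min s T : ℝ≥0) : ℝ) / T * x ⟨T, by simp⟩
            map_add' x y := by simp only [Pi.add_apply]; ring
            map_smul' c x := by simp only [Pi.smul_apply, smul_eq_mul, RingHom.id_apply]; ring },
          by intro ω; simp [bridgePart]⟩
    · exact fun _ => (hW.meas T).aemeasurable
    · exact fun s => (hW.measurable_bridgePart T s).aemeasurable
    · intro _ s
      unfold bridgePart
      rw [covariance_fun_sub_right (hW.memLp_two _) (hW.memLp_two _)
        ((hW.memLp_two _).const_mul _), covariance_const_mul_right, hW.bm.covariance_fun_eval,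
        hW.bm.covariance_eval, min_self, min_eq_right (min_le_right s T)]
      have : (T : ℝ) ≠ 0 := by exact_mod_cast hT.ne'
      field_simp
      ring
  exact h.comp (measurable_pi_apply ()) measurable_id

lemma IsContBM.map_prod_bridgePart [IsProbabilityMeasure P] (hW : IsContBM W P) {T : ℝ≥0}
    (hT : 0 < T) :
    P.map (fun ω => (W T ω, toPath (bridgePart W T) (hW.continuous_bridgePart T) ω)) =
      (gaussianReal 0 T).prod (P.map (toPath (bridgePart W T) (hW.continuous_bridgePart T))) := by
  have hm := measurable_toPath (hW.continuous_bridgePart T) (hW.measurable_bridgePart T)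
  rw [← (hW.bm.hasLaw_eval T).map_eq]
  refine (indepFun_iff_map_prod_eq_prod_map_map (hW.meas T).aemeasurable hm.aemeasurable).1 ?_
  have h := hW.indepFun_bridgePart hT
  rw [IndepFun_iff_Indep] at h ⊢
  rwa [comap_toPath]

lemma map_affine_gaussianReal {T : ℝ≥0} (hT : 0 < T) (u : ℝ) :
    (gaussianReal 0 T).map (fun z => u + √2 * z) =
      volume.withDensity fun x => ENNReal.ofReal (heatKernel T (x - u)) := by
  have h1 : (gaussianReal 0 T).map (fun z => √2 * z) = gaussianReal 0 (2 * T) := by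
    have := gaussianReal_map_const_mul (μ := 0) (v := T) (√2)
    rw [mul_zero] at this
    convert this using 2
    ext
    simp
  have h2 : (gaussianReal 0 (2 * T)).map (fun z => u + z) = gaussianReal u (2 * T) := by
    simpa using gaussianReal_map_const_add (μ := 0) (v := 2 * T) u
  have h3 : (gaussianReal 0 T).map (fun z => u + √2 * z) = gaussianReal u (2 * T) := by
    rw [← h2, ← h1, Measure.map_map (by fun_prop) (by fun_prop)]
    rfl
  rw [h3, gaussianReal_of_var_ne_zero _ (by positivity)]
  congr 1
  ext x
  rw [gaussianPDF, gaussianPDFReal, heatKernel]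
  congr 2
  · push_cast
    ring_nf
  · push_cast
    ring_nf

/-- The event that the path `w` started at `y` exceeds the barrier during `[0, L]`. -/
def exceedSet (g : ℝ → EReal) (L : ℝ) : Set (ℝ × PathSpace) :=
  {p | ∃ s ∈ Set.Icc 0 L, g s < ((p.1 + √2 * p.2.1 s.toNNReal : ℝ) : EReal)}

lemma measurableSet_exceedSet (hg : GoodBarrier g) (L : ℝ) : MeasurableSet (exceedSet g L) :=
  hg.measurableSet_hit_strict (w := fun (p : ℝ × PathSpace) s => p.1 + √2 * p.2.1 s.toNNReal)
    (fun p => p.2.continuous_path p.1) fun _ _ =>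
    measurable_fst.add (((measurable_pathSpace_eval _).comp measurable_snd).const_mul _)

/-- The event that the bridge exceeds the barrier. -/
def bridgeExceed (W : ℝ≥0 → Ω → ℝ) (g : ℝ → EReal) (L u₁ u₂ : ℝ) : Set Ω :=
  {ω | ∃ t ∈ Set.Icc (-L) L, g t < (bridge W (-L) u₁ L u₂ t ω : EReal)}

lemma IsContBM.measurableSet_bridgeExceed_prod (hW : IsContBM W P) (hg : GoodBarrier g) (L : ℝ) :
    MeasurableSet {p : (ℝ × ℝ) × Ω | p.2 ∈ bridgeExceed W g L p.1.1 p.1.2} := by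
  refine hg.measurableSet_hit_strict
    (w := fun (p : (ℝ × ℝ) × Ω) t => bridge W (-L) p.1.1 L p.1.2 t p.2) (fun p => ?_) fun t _ => ?_
  · have := hW.cont p.2
    unfold bridge
    fun_prop
  · have h1 : Measurable fun p : (ℝ × ℝ) × Ω => W (t - -L).toNNReal p.2 :=
      (hW.meas _).comp measurable_snd
    have h2 : Measurable fun p : (ℝ × ℝ) × Ω => W (L - -L).toNNReal p.2 :=
      (hW.meas _).comp measurable_snd
    unfold bridge
    exact ((measurable_fst.comp measurable_fst).add
      (((measurable_snd.comp measurable_fst).sub (measurable_fst.comp measurable_fst)).const_mul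
        _)).add ((h1.sub (h2.const_mul _)).const_mul _)

lemma IsContBM.measurable_bridgeExceed [IsProbabilityMeasure P] (hW : IsContBM W P)
    (hg : GoodBarrier g) (L : ℝ) :
    Measurable fun p : ℝ × ℝ => P (bridgeExceed W g L p.1 p.2) :=
  measurable_measure_prodMk_left (hW.measurableSet_bridgeExceed_prod hg L)

/-- Conditioning on the end point. -/
lemma IsContBM.lintegral_bridgeExceed [IsProbabilityMeasure P] (hW : IsContBM W P)
    (hg : GoodBarrier g) {L : ℝ} (hL : 0 < L) {Φ : ℝ → ℝ≥0∞} (hΦ : Measurable Φ) (u : ℝ) :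
    ∫⁻ v, Φ v * (ENNReal.ofReal (heatKernel (2 * L) (v - u)) * P (bridgeExceed W g L u v)) =
      ∫⁻ ω, {ω | ∃ t ∈ Set.Icc (-L) L, g t < ((u + √2 * W (t + L).toNNReal ω : ℝ) : EReal)}.indicator
        (fun ω => Φ (u + √2 * W (2 * L).toNNReal ω)) ω ∂P := by
  set T : ℝ≥0 := (2 * L).toNNReal with hT
  have hTL : (T : ℝ) = 2 * L := Real.coe_toNNReal _ (by linarith)
  have hT0 : 0 < T := Real.toNNReal_pos.2 (by linarith)
  set β := toPath (bridgePart W T) (hW.continuous_bridgePart T)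
  have hβ : Measurable β :=
    measurable_toPath (hW.continuous_bridgePart T) (hW.measurable_bridgePart T)
  set S : Set (ℝ × PathSpace) := {p | ∃ t ∈ Set.Icc (-L) L,
    g t < ((u + √2 * ((t + L) / (2 * L) * p.1 + p.2.1 (t + L).toNNReal) : ℝ) : EReal)} with hS
  have hSm : MeasurableSet S := by
    refine hg.measurableSet_hit_strict (w := fun (p : ℝ × PathSpace) t =>
      u + √2 * ((t + L) / (2 * L) * p.1 + p.2.1 (t + L).toNNReal)) (fun p => ?_) fun t _ => ?_
    · have := p.2.2
      fun_prop
    · have : Measurable fun p : ℝ × PathSpace => p.2.1 (t + L).toNNReal :=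
        (measurable_pathSpace_eval _).comp measurable_snd
      exact (((measurable_fst.const_mul _).add this).const_mul _).const_add _
  have hbr : ∀ t ∈ Set.Icc (-L) L, ∀ ω, bridgePart W T (t + L).toNNReal ω =
      W (t + L).toNNReal ω - (t + L) / (2 * L) * W T ω := by
    intro t ht ω
    have h1 : (t + L).toNNReal ≤ T := Real.toNNReal_le_toNNReal (by linarith [ht.2])
    rw [bridgePart, min_eq_left h1, Real.coe_toNNReal _ (by linarith [ht.1]), hTL]
  set K : ℝ × PathSpace → ℝ≥0∞ := S.indicator fun p => Φ (u + √2 * p.1) with hK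
  have hKm : Measurable K :=
    (hΦ.comp ((measurable_fst.const_mul _).const_add _)).indicator hSm
  have hR : ∫⁻ ω, {ω | ∃ t ∈ Set.Icc (-L) L,
      g t < ((u + √2 * W (t + L).toNNReal ω : ℝ) : EReal)}.indicator
        (fun ω => Φ (u + √2 * W T ω)) ω ∂P = ∫⁻ ω, K (W T ω, β ω) ∂P := by
    refine lintegral_congr fun ω => ?_
    have : ω ∈ {ω | ∃ t ∈ Set.Icc (-L) L, g t < ((u + √2 * W (t + L).toNNReal ω : ℝ) : EReal)} ↔
        (W T ω, β ω) ∈ S := by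
      refine exists_congr fun t => and_congr_right fun ht => ?_
      change _ ↔ g t < ((u + √2 * ((t + L) / (2 * L) * W T ω +
        bridgePart W T (t + L).toNNReal ω) : ℝ) : EReal)
      rw [hbr t ht, add_sub_cancel]
    by_cases h : (W T ω, β ω) ∈ S
    · rw [hK, Set.indicator_of_mem h, Set.indicator_of_mem (this.2 h)]
    · rw [hK, Set.indicator_of_notMem h, Set.indicator_of_notMem (fun h' => h (this.1 h'))]
  rw [hR, ← lintegral_map (f := K) (g := fun ω => (W T ω, β ω)) hKm ((hW.meas T).prodMk hβ),
    hW.map_prod_bridgePart hT0]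
  have : IsProbabilityMeasure (P.map β) := Measure.isProbabilityMeasure_map hβ.aemeasurable
  rw [lintegral_prod _ hKm.aemeasurable]
  have hz : ∀ z, ∫⁻ w, K (z, w) ∂(P.map β) =
      Φ (u + √2 * z) * P (bridgeExceed W g L u (u + √2 * z)) := by
    intro z
    rw [lintegral_map (f := fun w => K (z, w)) (hKm.comp measurable_prodMk_left) hβ]
    have h1 : ∀ ω, K (z, β ω) =
        (bridgeExceed W g L u (u + √2 * z)).indicator (fun _ => Φ (u + √2 * z)) ω := by
      intro ω
      have : ω ∈ bridgeExceed W g L u (u + √2 * z) ↔ (z, β ω) ∈ S := by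
        refine exists_congr fun t => and_congr_right fun ht => ?_
        change _ ↔ g t < ((u + √2 * ((t + L) / (2 * L) * z +
          bridgePart W T (t + L).toNNReal ω) : ℝ) : EReal)
        rw [hbr t ht, bridge]
        have e1 : t - -L = t + L := by ring
        have e2 : L - -L = 2 * L := by ring
        rw [e1, e2, ← hT]
        ring_nf
      by_cases h : (z, β ω) ∈ S
      · rw [hK, Set.indicator_of_mem h, Set.indicator_of_mem (this.2 h)]
      · rw [hK, Set.indicator_of_notMem h, Set.indicator_of_notMem (fun h' => h (this.1 h'))]
    rw [lintegral_congr h1, lintegral_indicator, setLIntegral_const]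
    exact measurable_prodMk_left (hW.measurableSet_bridgeExceed_prod hg L) (x := (u, u + √2 * z))
  refine Eq.trans ?_ (lintegral_congr hz).symm
  have hBm : Measurable fun v => P (bridgeExceed W g L u v) :=
    (hW.measurable_bridgeExceed hg L).comp measurable_prodMk_left
  rw [← lintegral_map (f := fun v => Φ v * P (bridgeExceed W g L u v))
    (g := fun z => u + √2 * z) (hΦ.mul hBm) (by fun_prop), map_affine_gaussianReal hT0, hTL]
  have hhm : Measurable fun x => ENNReal.ofReal (heatKernel (2 * L) (x - u)) := by
    unfold heatKernel
    fun_prop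
  rw [lintegral_withDensity_eq_lintegral_mul _ hhm
    (g := fun v => Φ v * P (bridgeExceed W g L u v)) (hΦ.mul hBm)]
  refine lintegral_congr fun v => ?_
  change _ = ENNReal.ofReal (heatKernel (2 * L) (v - u)) * (Φ v * P (bridgeExceed W g L u v))
  ring

/-- The path run backwards from time `T`, continued so as to be a Brownian motion. -/
def reversedPart (W : ℝ≥0 → Ω → ℝ) (T s : ℝ≥0) (ω : Ω) : ℝ := W (T - s) ω - W (max T s) ω

lemma IsContBM.isPreBrownianReal_reversedPart (hW : IsContBM W P) (T : ℝ≥0) :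
    IsPreBrownianReal (reversedPart W T) P := by
  have := hW.bm.isGaussianProcess.isProbabilityMeasure
  refine IsGaussianProcess.isPreBrownianReal_of_covariance ?_ (fun t => ?_) fun s t hst => ?_
  · apply hW.bm.isGaussianProcess.of_isGaussianProcess
    intro s
    exact ⟨{T - s, max T s},
      { toFun x := x ⟨T - s, by simp⟩ - x ⟨max T s, by simp⟩
        map_add' x y := by simp only [Pi.add_apply]; ring
        map_smul' c x := by simp only [Pi.smul_apply, smul_eq_mul, RingHom.id_apply]; ring },
      by intro ω; simp [reversedPart]⟩
  · unfold reversedPart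
    rw [integral_sub (hW.bm.integrable_eval _) (hW.bm.integrable_eval _), hW.bm.integral_eval,
      hW.bm.integral_eval, sub_zero]
  · unfold reversedPart
    rw [covariance_fun_sub_fun_sub (hW.memLp_two _) (hW.memLp_two _) (hW.memLp_two _)
      (hW.memLp_two _)]
    simp only [hW.bm.covariance_fun_eval]
    have h1 : T - t ≤ T - s := tsub_le_tsub_left hst T
    have h2 : T - s ≤ max T t := tsub_le_self.trans (le_max_left _ _)
    have h3 : T - t ≤ max T s := tsub_le_self.trans (le_max_left _ _)
    have h4 : max T s ≤ max T t := max_le_max le_rfl hst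
    rw [min_eq_right h1, min_eq_left h2, min_eq_right h3, min_eq_left h4]
    have h5 : max T s = (T - s) + s := by
      rcases le_total s T with h | h
      · rw [max_eq_left h, tsub_add_cancel_of_le h]
      · rw [max_eq_right h, tsub_eq_zero_of_le h, zero_add]
    rw [h5]
    push_cast
    ring

/-- A process stopped at time `T`. -/
def stoppedAt (X : ℝ≥0 → Ω → ℝ) (T s : ℝ≥0) (ω : Ω) : ℝ := X (min s T) ω

lemma IsContBM.continuous_stoppedAt (hW : IsContBM W P) (T : ℝ≥0) (ω : Ω) :
    Continuous (stoppedAt W T · ω) := by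
  have := hW.cont ω
  unfold stoppedAt
  fun_prop

lemma IsContBM.continuous_reversedPart (hW : IsContBM W P) (T : ℝ≥0) (ω : Ω) :
    Continuous (stoppedAt (reversedPart W T) T · ω) := by
  have := hW.cont ω
  unfold stoppedAt reversedPart
  fun_prop

lemma IsContBM.continuous_shift (hW : IsContBM W P) (T : ℝ≥0) (ω : Ω) :
    Continuous fun s => W (T + s) ω - W T ω := by
  have := hW.cont ω
  fun_prop

/-- The law of the pair formed by the path before time `T`, run backwards, and the path after `T`. -/
lemma IsContBM.map_prod_reversedPart [IsProbabilityMeasure P] (hW : IsContBM W P) (T : ℝ≥0) :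
    P.map (fun ω => (toPath (stoppedAt (reversedPart W T) T) (hW.continuous_reversedPart T) ω,
      toPath (fun s ω => W (T + s) ω - W T ω) (hW.continuous_shift T) ω)) =
    (P.prod P).map (fun q => (toPath (stoppedAt W T) (hW.continuous_stoppedAt T) q.1,
      toPath W hW.cont q.2)) := by
  have hRm : ∀ s, Measurable (stoppedAt (reversedPart W T) T s) := fun s =>
    (hW.meas _).sub (hW.meas _)
  have hSm : ∀ s, Measurable fun ω => W (T + s) ω - W T ω := fun s => (hW.meas _).sub (hW.meas _)
  have hWm : ∀ s, Measurable (stoppedAt W T s) := fun s => hW.meas _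
  have m1 := measurable_toPath (hW.continuous_reversedPart T) hRm
  have m2 := measurable_toPath (hW.continuous_shift T) hSm
  have m3 := measurable_toPath (hW.continuous_stoppedAt T) hWm
  have m4 := measurable_toPath hW.cont hW.meas
  have hind : IndepFun (toPath (stoppedAt (reversedPart W T) T) (hW.continuous_reversedPart T))
      (toPath (fun s ω => W (T + s) ω - W T ω) (hW.continuous_shift T)) P := by
    have h := (hW.bm.indepFun_shift T).symm.comp
      (φ := fun (w : Set.Iic T → ℝ) (s : ℝ≥0) =>
        w ⟨T - min s T, Set.mem_Iic.2 tsub_le_self⟩ - w ⟨T, Set.self_mem_Iic⟩)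
      (ψ := id) (measurable_pi_lambda _ fun s =>
        (measurable_pi_apply _).sub (measurable_pi_apply _)) measurable_id
    have e : ((fun (w : Set.Iic T → ℝ) (s : ℝ≥0) =>
        w ⟨T - min s T, Set.mem_Iic.2 tsub_le_self⟩ - w ⟨T, Set.self_mem_Iic⟩) ∘
          fun ω (t : Set.Iic T) => W t ω) = fun ω s => stoppedAt (reversedPart W T) T s ω := by
      ext ω s
      simp [stoppedAt, reversedPart]
    rw [e] at h
    rw [IndepFun_iff_Indep] at h ⊢
    rw [comap_toPath, comap_toPath]
    exact h
  rw [(indepFun_iff_map_prod_eq_prod_map_map m1.aemeasurable m2.aemeasurable).1 hind]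
  have hfd : ∀ X : ℝ≥0 → Ω → ℝ, IsPreBrownianReal X P → (∀ t, Measurable (X t)) →
      P.map (fun ω t => X t ω) = P.map (fun ω t => W t ω) := by
    intro X hX hXm
    rw [map_eq_iff_forall_finset_map_restrict_eq (measurable_pi_lambda _ hXm).aemeasurable
      (measurable_pi_lambda _ hW.meas).aemeasurable]
    exact fun I => (hX.hasLaw I).map_eq.trans (hW.bm.hasLaw I).map_eq.symm
  have l2 := map_toPath_eq (hW.continuous_shift T) hW.cont hSm hW.meas (hfd _ (hW.bm.shift T) hSm)
  have l1 : P.map (toPath (stoppedAt (reversedPart W T) T) (hW.continuous_reversedPart T)) =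
      P.map (toPath (stoppedAt W T) (hW.continuous_stoppedAt T)) := by
    refine map_toPath_eq _ _ hRm hWm ?_
    have hR' : ∀ t, Measurable (reversedPart W T t) := fun s => (hW.meas _).sub (hW.meas _)
    have h := hfd _ (hW.isPreBrownianReal_reversedPart T) hR'
    have hst : Measurable fun (w : ℝ≥0 → ℝ) (s : ℝ≥0) => w (min s T) := by fun_prop
    have h' := congrArg (fun μ => μ.map fun (w : ℝ≥0 → ℝ) (s : ℝ≥0) => w (min s T)) h
    rw [Measure.map_map hst (measurable_pi_lambda _ hR'),
      Measure.map_map hst (measurable_pi_lambda _ hW.meas)] at h'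
    exact h'
  rw [l1, l2]
  exact (Measure.map_prod_map _ _ m3 m4)

lemma ae_exceedSet_iff (g : ℝ → EReal) (L : ℝ) (w : PathSpace) :
    ∀ᵐ y : ℝ, (y, w) ∈ exceedSet g L ↔
      ∃ s ∈ Set.Icc 0 L, g s ≤ ((y + √2 * w.1 s.toNNReal : ℝ) : EReal) := by
  have hs : {y : ℝ | ¬((y, w) ∈ exceedSet g L ↔
      ∃ s ∈ Set.Icc 0 L, g s ≤ ((y + √2 * w.1 s.toNNReal : ℝ) : EReal))}.Subsingleton := by
    have key : ∀ y₁ y₂ : ℝ, y₁ < y₂ → ¬((y₁, w) ∈ exceedSet g L ↔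
        ∃ s ∈ Set.Icc 0 L, g s ≤ ((y₁ + √2 * w.1 s.toNNReal : ℝ) : EReal)) →
        (y₂, w) ∈ exceedSet g L := by
      intro y₁ y₂ h12 h
      have h1 : ∃ s ∈ Set.Icc 0 L, g s ≤ ((y₁ + √2 * w.1 s.toNNReal : ℝ) : EReal) := by
        by_contra h2
        refine h ⟨?_, fun h3 => absurd h3 h2⟩
        rintro ⟨s, hs, hsg⟩
        exact ⟨s, hs, hsg.le⟩
      obtain ⟨s, hs, hsg⟩ := h1
      refine ⟨s, hs, hsg.trans_lt ?_⟩
      rw [EReal.coe_lt_coe_iff]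
      simpa using h12
    have key2 : ∀ y : ℝ, (y, w) ∈ exceedSet g L → ((y, w) ∈ exceedSet g L ↔
        ∃ s ∈ Set.Icc 0 L, g s ≤ ((y + √2 * w.1 s.toNNReal : ℝ) : EReal)) := fun y hy =>
      ⟨fun ⟨s, hs, hsg⟩ => ⟨s, hs, hsg.le⟩, fun _ => hy⟩
    intro y₁ h₁ y₂ h₂
    rcases lt_trichotomy y₁ y₂ with h | h | h
    · exact absurd (key2 _ (key _ _ h h₁)) h₂
    · exact h
    · exact absurd (key2 _ (key _ _ h h₂)) h₁
  exact hs.measure_zero _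

lemma mem_hitEvent_cutBarrier {L y : ℝ} {ω : Ω} : ω ∈ hitEvent W (cutBarrier L g) y ↔
    ∃ s ∈ Set.Icc 0 L, g s ≤ ((y + √2 * W s.toNNReal ω : ℝ) : EReal) := by
  change (hitTimes W (cutBarrier L g) y ω).Nonempty ↔ _
  rw [hitTimes_cutBarrier]
  constructor
  · rintro ⟨s, ⟨h1, h2⟩, h3⟩
    exact ⟨s, ⟨h1, h3⟩, h2⟩
  · rintro ⟨s, ⟨h1, h3⟩, h2⟩
    exact ⟨s, ⟨h1, h2⟩, h3⟩

/-- Pairs of paths started at `y`, one of which hits its barrier before time `L`. -/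
def hitPair (W : ℝ≥0 → Ω → ℝ) (g : ℝ → EReal) (L y : ℝ) : Set (Ω × Ω) :=
  {q | q.1 ∈ hitEvent W (cutBarrier L fun t => g (-t)) y ∨ q.2 ∈ hitEvent W (cutBarrier L g) y}

lemma IsContBM.measurableSet_hitPair (hW : IsContBM W P) (hg : GoodBarrier g) (L : ℝ) :
    MeasurableSet {p : ℝ × (Ω × Ω) | p.2 ∈ hitPair W g L p.1} := by
  refine MeasurableSet.union (s₁ := {p : ℝ × (Ω × Ω) |
    p.2.1 ∈ hitEvent W (cutBarrier L fun t => g (-t)) p.1})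
    (s₂ := {p : ℝ × (Ω × Ω) | p.2.2 ∈ hitEvent W (cutBarrier L g) p.1}) ?_ ?_
  · exact (measurable_fst.prodMk (measurable_fst.comp measurable_snd))
      (hW.measurableSet_hitEvent_prod (hg.comp_neg.cutBarrier L))
  · exact (measurable_fst.prodMk (measurable_snd.comp measurable_snd))
      (hW.measurableSet_hitEvent_prod (hg.cutBarrier L))

/-- Decomposition of the Brownian bridge at time `0`. -/
theorem IsContBM.lintegral_hit_decomposition [IsProbabilityMeasure P] (hW : IsContBM W P)
    (hg : GoodBarrier g) {L : ℝ} (hL : 0 < L) {Φ : ℝ × ℝ → ℝ≥0∞} (hΦ : Measurable Φ) :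
    ∫⁻ u, ∫⁻ v, Φ (u, v) *
        (ENNReal.ofReal (heatKernel (2 * L) (v - u)) * P (bridgeExceed W g L u v)) =
      ∫⁻ y, ∫⁻ q, (hitPair W g L y).indicator
        (fun q => Φ (y + √2 * W L.toNNReal q.1, y + √2 * W L.toNNReal q.2)) q ∂(P.prod P) := by
  set T : ℝ≥0 := L.toNNReal with hT
  have hTL : (T : ℝ) = L := Real.coe_toNNReal _ hL.le
  have hT2 : (2 * L).toNNReal = T + T := by
    rw [two_mul, Real.toNNReal_add hL.le hL.le]
  -- the functional of the two halves of the path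
  set S : Set (ℝ × (PathSpace × PathSpace)) :=
    {p | (p.1, p.2.1) ∈ exceedSet (fun t => g (-t)) L ∨ (p.1, p.2.2) ∈ exceedSet g L} with hS
  have hSm : MeasurableSet S := by
    refine MeasurableSet.union (s₁ := {p : ℝ × (PathSpace × PathSpace) |
      (p.1, p.2.1) ∈ exceedSet (fun t => g (-t)) L})
      (s₂ := {p : ℝ × (PathSpace × PathSpace) | (p.1, p.2.2) ∈ exceedSet g L}) ?_ ?_
    · exact (measurable_fst.prodMk (measurable_fst.comp measurable_snd))
        (measurableSet_exceedSet hg.comp_neg L)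
    · exact (measurable_fst.prodMk (measurable_snd.comp measurable_snd))
        (measurableSet_exceedSet hg L)
  set G : ℝ × (PathSpace × PathSpace) → ℝ≥0∞ := S.indicator fun p =>
    Φ (p.1 + √2 * p.2.1.1 T, p.1 + √2 * p.2.2.1 T) with hG
  have hGm : Measurable G := by
    refine (hΦ.comp ?_).indicator hSm
    have h1 : Measurable fun p : ℝ × (PathSpace × PathSpace) => p.2.1.1 T :=
      (measurable_pathSpace_eval T).comp (measurable_fst.comp measurable_snd)
    have h2 : Measurable fun p : ℝ × (PathSpace × PathSpace) => p.2.2.1 T :=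
      (measurable_pathSpace_eval T).comp (measurable_snd.comp measurable_snd)
    exact (measurable_fst.add (h1.const_mul _)).prodMk (measurable_fst.add (h2.const_mul _))
  set X := toPath (stoppedAt (reversedPart W T) T) (hW.continuous_reversedPart T) with hX
  set Y := toPath (fun s ω => W (T + s) ω - W T ω) (hW.continuous_shift T) with hY
  set X' := toPath (stoppedAt W T) (hW.continuous_stoppedAt T) with hX'
  set Y' := toPath W hW.cont with hY'
  have mX : Measurable X := measurable_toPath _ fun s => (hW.meas _).sub (hW.meas _)
  have mY : Measurable Y := measurable_toPath _ fun s => (hW.meas _).sub (hW.meas _)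
  have mX' : Measurable X' := measurable_toPath _ fun s => hW.meas _
  have mY' : Measurable Y' := measurable_toPath _ hW.meas
  set F : ℝ × Ω → ℝ≥0∞ := {p : ℝ × Ω | ∃ t ∈ Set.Icc (-L) L,
      g t < ((p.1 + √2 * W (t + L).toNNReal p.2 : ℝ) : EReal)}.indicator
        (fun p => Φ (p.1, p.1 + √2 * W (T + T) p.2)) with hF
  have hFm : Measurable F := by
    refine (hΦ.comp ?_).indicator ?_
    · exact measurable_fst.prodMk (measurable_fst.add
        (((hW.meas _).comp measurable_snd).const_mul _))
    · refine hg.measurableSet_hit_strict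
        (w := fun (p : ℝ × Ω) t => p.1 + √2 * W (t + L).toNNReal p.2) (fun p => ?_) fun t _ => ?_
      · have := hW.cont p.2
        fun_prop
      · exact measurable_fst.add (((hW.meas _).comp measurable_snd).const_mul _)
  have step1 : ∀ u, ∫⁻ v, Φ (u, v) *
      (ENNReal.ofReal (heatKernel (2 * L) (v - u)) * P (bridgeExceed W g L u v)) =
      ∫⁻ ω, F (u, ω) ∂P := by
    intro u
    rw [hW.lintegral_bridgeExceed hg hL (Φ := fun v => Φ (u, v))
      (hΦ.comp measurable_prodMk_left), hT2]
    rfl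
  have step2 : ∀ ω, ∫⁻ u, F (u, ω) = ∫⁻ y, G (y, (X ω, Y ω)) := by
    intro ω
    rw [← lintegral_sub_right_eq_self (fun u => F (u, ω)) (√2 * W T ω)]
    refine lintegral_congr fun y => ?_
    have hiff : (y - √2 * W T ω, ω) ∈ {p : ℝ × Ω | ∃ t ∈ Set.Icc (-L) L,
        g t < ((p.1 + √2 * W (t + L).toNNReal p.2 : ℝ) : EReal)} ↔ (y, (X ω, Y ω)) ∈ S := by
      have hx : ∀ s ∈ Set.Icc 0 L, y + √2 * (X ω).1 s.toNNReal =
          y - √2 * W T ω + √2 * W (-s + L).toNNReal ω := by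
        intro s hs
        have h1 : s.toNNReal ≤ T := Real.toNNReal_le_toNNReal hs.2
        have h2 : T - s.toNNReal = (-s + L).toNNReal := by
          apply NNReal.eq
          rw [NNReal.coe_sub h1, hTL, Real.coe_toNNReal _ hs.1,
            Real.coe_toNNReal _ (by linarith [hs.2])]
          ring
        change y + √2 * (W (T - min s.toNNReal T) ω - W (max T (min s.toNNReal T)) ω) = _
        rw [min_eq_left h1, max_eq_left h1, h2]
        ring
      have hy : ∀ s ∈ Set.Icc 0 L, y + √2 * (Y ω).1 s.toNNReal =
          y - √2 * W T ω + √2 * W (s + L).toNNReal ω := by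
        intro s hs
        change y + √2 * (W (T + s.toNNReal) ω - W T ω) = _
        rw [Real.toNNReal_add hs.1 hL.le, add_comm T]
        ring
      constructor
      · rintro ⟨t, ht, htg⟩
        rcases le_total t 0 with h0 | h0
        · refine Or.inl ⟨-t, ⟨by linarith, by linarith [ht.1]⟩, ?_⟩
          rw [hx (-t) ⟨by linarith, by linarith [ht.1]⟩]
          simp only [neg_neg]
          exact htg
        · refine Or.inr ⟨t, ⟨h0, ht.2⟩, ?_⟩
          rw [hy t ⟨h0, ht.2⟩]
          exact htg
      · rintro (⟨s, hs, hsg⟩ | ⟨s, hs, hsg⟩)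
        · refine ⟨-s, ⟨by linarith [hs.2], by linarith [hs.1]⟩, ?_⟩
          rw [hx s hs] at hsg
          exact hsg
        · refine ⟨s, ⟨by linarith [hs.1], hs.2⟩, ?_⟩
          rw [hy s hs] at hsg
          exact hsg
    have e1 : (X ω).1 T = - W T ω := by
      change W (T - min T T) ω - W (max T (min T T)) ω = _
      simp [hW.zero]
    have e2 : (Y ω).1 T = W (T + T) ω - W T ω := rfl
    by_cases h : (y, (X ω, Y ω)) ∈ S
    · rw [hF, hG, Set.indicator_of_mem h, Set.indicator_of_mem (hiff.2 h)]
      simp only [e1, e2]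
      congr 2 <;> ring
    · rw [hF, hG, Set.indicator_of_notMem h, Set.indicator_of_notMem (fun h' => h (hiff.1 h'))]
  have hGi : Measurable fun q : PathSpace × PathSpace => ∫⁻ y, G (y, q) :=
    hGm.lintegral_prod_left'
  have step3 : ∫⁻ ω, ∫⁻ y : ℝ, G (y, (X ω, Y ω)) ∂volume ∂P =
      ∫⁻ q, ∫⁻ y : ℝ, G (y, (X' q.1, Y' q.2)) ∂volume ∂(P.prod P) := by
    rw [← lintegral_map (f := fun q => ∫⁻ y, G (y, q)) (g := fun ω => (X ω, Y ω)) hGi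
      (mX.prodMk mY), hW.map_prod_reversedPart T,
      lintegral_map (g := fun q : Ω × Ω => (X' q.1, Y' q.2)) hGi
        ((mX'.comp measurable_fst).prodMk (mY'.comp measurable_snd))]
  have step4 : ∀ q : Ω × Ω, ∫⁻ y, G (y, (X' q.1, Y' q.2)) = ∫⁻ y, (hitPair W g L y).indicator
      (fun q => Φ (y + √2 * W T q.1, y + √2 * W T q.2)) q := by
    intro q
    refine lintegral_congr_ae ?_
    filter_upwards [ae_exceedSet_iff (fun t => g (-t)) L (X' q.1), ae_exceedSet_iff g L (Y' q.2)]
      with y h1 h2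
    have hiff : (y, (X' q.1, Y' q.2)) ∈ S ↔ q ∈ hitPair W g L y := by
      change (y, X' q.1) ∈ exceedSet (fun t => g (-t)) L ∨ (y, Y' q.2) ∈ exceedSet g L ↔
        q.1 ∈ hitEvent W (cutBarrier L fun t => g (-t)) y ∨ q.2 ∈ hitEvent W (cutBarrier L g) y
      rw [h1, h2, mem_hitEvent_cutBarrier, mem_hitEvent_cutBarrier]
      refine or_congr (exists_congr fun s => and_congr_right fun hs => ?_) Iff.rfl
      have h1 : s.toNNReal ≤ T := Real.toNNReal_le_toNNReal hs.2
      change g (-s) ≤ ((y + √2 * W (min s.toNNReal T) q.1 : ℝ) : EReal) ↔ _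
      rw [min_eq_left h1]
    have e1 : (X' q.1).1 T = W T q.1 := by
      change W (min T T) q.1 = _
      rw [min_self]
    have e2 : (Y' q.2).1 T = W T q.2 := rfl
    by_cases h : (y, (X' q.1, Y' q.2)) ∈ S
    · rw [hG, Set.indicator_of_mem h, Set.indicator_of_mem (hiff.1 h), e1, e2]
    · rw [hG, Set.indicator_of_notMem h, Set.indicator_of_notMem (fun h' => h (hiff.2 h'))]
  simp_rw [step1]
  rw [lintegral_lintegral_swap (f := fun u ω => F (u, ω)) hFm.aemeasurable]
  simp_rw [step2]
  rw [step3]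
  simp_rw [step4]
  refine lintegral_lintegral_swap (f := fun (q : Ω × Ω) y => (hitPair W g L y).indicator
      (fun q => Φ (y + √2 * W T q.1, y + √2 * W T q.2)) q) (Measurable.aemeasurable ?_)
  have h1 : Measurable fun p : (Ω × Ω) × ℝ => W T p.1.1 :=
    (hW.meas T).comp (measurable_fst.comp measurable_fst)
  have h2 : Measurable fun p : (Ω × Ω) × ℝ => W T p.1.2 :=
    (hW.meas T).comp (measurable_snd.comp measurable_fst)
  exact (hΦ.comp ((measurable_snd.add (h1.const_mul (√2))).prodMk
    (measurable_snd.add (h2.const_mul (√2))))).indicator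
    (measurable_swap (hW.measurableSet_hitPair hg L))

end Brownian

/-! ### The backward heat flow of the Airy kernel -/

/-- The kernel of `K_Ai e^{-tΔ}`. -/
def airyFlow (t x u : ℝ) : ℝ := ∫ l in Set.Iic (0 : ℝ), airyAi (x - l) * invHeatAiry t (u - l)

lemma airyFlow_zero (x u : ℝ) : airyFlow 0 x u = airyKernel x u := by
  simp only [airyFlow, airyKernel, invHeatAiry_zero]

lemma abs_airyAi_mul_invHeatAiry_le {t b : ℝ} (h : 1 / 8 ≤ b - t) (hb : 0 ≤ b) (x u : ℝ) {l : ℝ}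
    (hl : l ≤ 0) : |airyAi (x - l) * invHeatAiry t (u - l)| ≤
      2 * Real.exp (-x) * Real.exp (b ^ 3 / 3 - b ^ 2 * t) * (Real.exp l * Real.exp (-b * u)) := by
  rw [abs_mul]
  have h1 := abs_airyAi_le (x - l)
  have h2 := abs_invHeatAiry_le (u - l) h
  have h3 : Real.exp (b ^ 3 / 3 - b ^ 2 * t - b * (u - l)) ≤
      Real.exp (b ^ 3 / 3 - b ^ 2 * t) * Real.exp (-b * u) := by
    rw [← Real.exp_add, Real.exp_le_exp]
    nlinarith [mul_nonneg hb (neg_nonneg.2 hl)]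
  calc _ ≤ 2 * Real.exp (-(x - l)) * Real.exp (b ^ 3 / 3 - b ^ 2 * t - b * (u - l)) := by gcongr
    _ ≤ 2 * Real.exp (-(x - l)) * (Real.exp (b ^ 3 / 3 - b ^ 2 * t) * Real.exp (-b * u)) := by
        gcongr
    _ = _ := by
        rw [show -(x - l) = -x + l by ring, Real.exp_add]
        ring

lemma integral_exp_Iic_zero : ∫ l in Set.Iic (0 : ℝ), Real.exp l = 1 := by
  rw [integral_exp_Iic, Real.exp_zero]

lemma abs_airyFlow_le {t b : ℝ} (h : 1 / 8 ≤ b - t) (hb : 0 ≤ b) (x u : ℝ) :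
    |airyFlow t x u| ≤ 2 * Real.exp (-x) * Real.exp (b ^ 3 / 3 - b ^ 2 * t) * Real.exp (-b * u) := by
  have hi : IntegrableOn (fun l => 2 * Real.exp (-x) * Real.exp (b ^ 3 / 3 - b ^ 2 * t) *
      (Real.exp l * Real.exp (-b * u))) (Set.Iic 0) :=
    ((integrableOn_exp_Iic 0).mul_const _).const_mul _
  rw [← Real.norm_eq_abs, airyFlow]
  refine (norm_integral_le_of_norm_le hi ?_).trans (le_of_eq ?_)
  · filter_upwards [ae_restrict_mem measurableSet_Iic] with l hl
    exact abs_airyAi_mul_invHeatAiry_le h hb x u hl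
  · rw [integral_const_mul, integral_mul_const, integral_exp_Iic_zero, one_mul]

lemma measurable_airyFlow (t : ℝ) : Measurable (Function.uncurry (airyFlow t)) := by
  refine (StronglyMeasurable.integral_prod_right (f := fun (q : ℝ × ℝ) l =>
    airyAi (q.1 - l) * invHeatAiry t (q.2 - l)) ?_).measurable
  refine Continuous.stronglyMeasurable ?_
  unfold Function.uncurry
  fun_prop

lemma measurable_airyFlow_right (t x : ℝ) : Measurable (airyFlow t x) :=
  (measurable_airyFlow t).of_uncurry_left

lemma integral_airyFlow_comp {X : Type*} [MeasurableSpace X] {Q : Measure X} [SFinite Q]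
    {Z : X → ℝ} (hZ : Measurable Z) {t b : ℝ} (h : 1 / 8 ≤ b - t) (hb : 0 ≤ b)
    (hi : Integrable (fun ω => Real.exp (-b * Z ω)) Q) (x : ℝ) :
    Integrable (fun ω => airyFlow t x (Z ω)) Q ∧ ∫ ω, airyFlow t x (Z ω) ∂Q =
      ∫ l in Set.Iic (0 : ℝ), airyAi (x - l) * ∫ ω, invHeatAiry t (Z ω - l) ∂Q := by
  have hintg : Integrable (fun p : X × ℝ => airyAi (x - p.2) * invHeatAiry t (Z p.1 - p.2))
      (Q.prod (volume.restrict (Set.Iic 0))) := by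
    have h1 := ((hi.mul_prod (integrableOn_exp_Iic 0)).const_mul
      (2 * Real.exp (-x) * Real.exp (b ^ 3 / 3 - b ^ 2 * t)))
    refine h1.mono' ?_ ?_
    · have hm : Measurable fun p : X × ℝ => Z p.1 := hZ.comp measurable_fst
      refine Measurable.aestronglyMeasurable ?_
      exact (Measurable.airyAi (measurable_const.sub measurable_snd)).mul
        (Measurable.invHeatAiry measurable_const (hm.sub measurable_snd))
    · have hae : ∀ᵐ p ∂(Q.prod (volume.restrict (Set.Iic (0 : ℝ)))), p.2 ≤ 0 :=
        (Measure.quasiMeasurePreserving_snd (μ := Q)).ae (ae_restrict_mem measurableSet_Iic)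
      filter_upwards [hae] with p hp
      refine (abs_airyAi_mul_invHeatAiry_le h hb x (Z p.1) hp).trans (le_of_eq ?_)
      ring
  refine ⟨hintg.integral_prod_left, ?_⟩
  simp only [airyFlow]
  rw [integral_integral_swap hintg]
  simp_rw [integral_const_mul]

section Brownian

variable {Ω : Type*} [MeasurableSpace Ω] {P : Measure Ω} {W : ℝ≥0 → Ω → ℝ} {g : ℝ → EReal}

lemma IsContBM.measurable_start (hW : IsContBM W P) (T : ℝ≥0) (y : ℝ) :
    Measurable fun ω => y + √2 * W T ω := ((hW.meas T).const_mul _).const_add _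

lemma IsContBM.integrable_exp_start (hW : IsContBM W P) (T : ℝ≥0) (b y : ℝ) :
    Integrable (fun ω => Real.exp (b * (y + √2 * W T ω))) P := by
  refine ((hW.integrable_exp (b * √2) T).const_mul (Real.exp (b * y))).congr
    (Eventually.of_forall fun ω => ?_)
  simp only [← Real.exp_add]
  ring_nf

lemma IsContBM.integral_exp_start (hW : IsContBM W P) (T : ℝ≥0) (b y : ℝ) :
    ∫ ω, Real.exp (b * (y + √2 * W T ω)) ∂P = Real.exp (b * y + b ^ 2 * T) := by
  have h := hW.integral_expMart (b * √2) T
  have e : ∀ ω, Real.exp (b * (y + √2 * W T ω)) =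
      Real.exp (b * y + b ^ 2 * T) * expMart (b * √2) T (W T ω) := by
    intro ω
    rw [expMart, ← Real.exp_add]
    congr 1
    have : (b * √2) ^ 2 = 2 * b ^ 2 := by rw [mul_pow, Real.sq_sqrt (by norm_num)]; ring
    rw [this]
    ring
  simp_rw [e]
  rw [integral_const_mul, h, mul_one]

lemma IsContBM.integral_invHeatAiry (hW : IsContBM W P) (T : ℝ≥0) (t y l : ℝ) :
    ∫ ω, invHeatAiry t (y + √2 * W T ω - l) ∂P = invHeatAiry (t - T) (y - l) := by
  have h := integral_invHeatAiry_gaussian (t - T) (y - l) T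
  rw [sub_add_cancel, ← (hW.bm.hasLaw_eval T).map_eq, integral_map (hW.meas T).aemeasurable
    (Continuous.aestronglyMeasurable (by fun_prop))] at h
  rw [← h]
  refine integral_congr_ae (Eventually.of_forall fun ω => ?_)
  simp only
  congr 1
  ring

lemma IsContBM.integrable_airyFlow [IsProbabilityMeasure P] (hW : IsContBM W P) (T : ℝ≥0)
    {t : ℝ} (ht : 0 ≤ t) (x y : ℝ) : Integrable (fun ω => airyFlow t x (y + √2 * W T ω)) P :=
  (integral_airyFlow_comp (b := t + 1) (hW.measurable_start T y) (by linarith) (by linarith)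
    (hW.integrable_exp_start T _ y) x).1

lemma IsContBM.integral_airyFlow [IsProbabilityMeasure P] (hW : IsContBM W P) (T : ℝ≥0) {t : ℝ}
    (ht : 0 ≤ t) (x y : ℝ) :
    ∫ ω, airyFlow t x (y + √2 * W T ω) ∂P = airyFlow (t - T) x y := by
  rw [(integral_airyFlow_comp (b := t + 1) (hW.measurable_start T y) (by linarith) (by linarith)
    (hW.integrable_exp_start T _ y) x).2]
  simp only [hW.integral_invHeatAiry]
  rfl

/-- The hitting term in the Airy transformed variable. -/
def hitFlow (P : Measure Ω) (W : ℝ≥0 → Ω → ℝ) (g : ℝ → EReal) (x y : ℝ) : ℝ :=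
  ∫ l in Set.Iic (0 : ℝ), airyAi (x - l) * hitKernel P W g l y

lemma IsContBM.setIntegral_airyFlow [IsProbabilityMeasure P] (hW : IsContBM W P)
    (hg : GoodBarrier g) {c κ C : ℝ} (hC : IsHitBound c κ C) (h : AboveParabola c κ g)
    {L : ℝ} (hL : 0 < L) (x y : ℝ) :
    ∫ ω in hitEvent W (cutBarrier L g) y, airyFlow L x (y + √2 * W L.toNNReal ω) ∂P =
      hitFlow P W (cutBarrier L g) x y := by
  rw [(integral_airyFlow_comp (b := L + 1) (hW.measurable_start _ y) (by linarith) (by linarith)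
    (hW.integrable_exp_start _ _ y).integrableOn x).2]
  refine setIntegral_congr_fun measurableSet_Iic fun l hl => ?_
  simp only [hitKernel_cutBarrier hW hg hC h hL hl y]

lemma IsContBM.measure_hitEvent_le [IsProbabilityMeasure P] (hW : IsContBM W P)
    (hg : GoodBarrier g) {c κ : ℝ} (hκ : 0 ≤ κ) (h : AboveParabola c κ g) {L : ℝ} {θ : ℝ}
    (hθ : 0 ≤ θ) (y : ℝ) : P.real (hitEvent W (cutBarrier L g) y) ≤
      Real.exp (θ * (y - (c - κ * L ^ 2)) + θ ^ 2 * L) := by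
  set E := hitEvent W (cutBarrier L g) y
  set τ := hitTime W (cutBarrier L g) y
  have hE : MeasurableSet E := hW.measurableSet_hitEvent (hg.cutBarrier L) y
  have h1 := hW.lintegral_hit_expMart_le (hg.cutBarrier L) y (√2 * θ)
  have hle : ∀ ω ∈ E, ENNReal.ofReal (Real.exp (-(θ * (y - (c - κ * L ^ 2)) + θ ^ 2 * L))) ≤
      ENNReal.ofReal (expMart (√2 * θ) (τ ω) (W (τ ω).toNNReal ω)) := by
    intro ω hω
    refine ENNReal.ofReal_le_ofReal ?_
    have hτ0 : 0 ≤ τ ω := hitTime_nonneg y ω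
    have hτL : τ ω ≤ L := by
      obtain ⟨s, hs⟩ := id hω
      have := hs
      rw [hitTimes_cutBarrier] at this
      exact (csInf_le (hitTimes_bddBelow y ω) hs).trans this.2
    have hp := hW.parabola_le (h.cutBarrier L) hω
    change c - κ * τ ω ^ 2 ≤ y + √2 * W (τ ω).toNNReal ω at hp
    rw [expMart, Real.exp_le_exp, mul_pow, Real.sq_sqrt (by norm_num)]
    have h2 : κ * τ ω ^ 2 ≤ κ * L ^ 2 := by gcongr
    have h3 : θ * (c - κ * L ^ 2) ≤ θ * (y + √2 * W (τ ω).toNNReal ω) := by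
      gcongr
      linarith
    have h4 : θ ^ 2 * τ ω ≤ θ ^ 2 * L := by gcongr
    linarith
  have h2 : ENNReal.ofReal (Real.exp (-(θ * (y - (c - κ * L ^ 2)) + θ ^ 2 * L))) * P E ≤ 1 := by
    rw [← setLIntegral_const]
    exact (setLIntegral_mono' hE hle).trans h1
  have h3 := ENNReal.toReal_mono ENNReal.one_ne_top h2
  rw [ENNReal.toReal_mul, ENNReal.toReal_ofReal (Real.exp_pos _).le, ENNReal.toReal_one] at h3
  change Real.exp _ * P.real E ≤ 1 at h3
  rw [Real.exp_neg] at h3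
  rwa [inv_mul_le_iff₀ (Real.exp_pos _), mul_one] at h3

/-- The part of the flow carried by paths that hit the barrier. -/
lemma IsContBM.setIntegral_exp_le [IsProbabilityMeasure P] (hW : IsContBM W P)
    (hg : GoodBarrier g) {c κ : ℝ} (hκ : 0 ≤ κ) (h : AboveParabola c κ g) {L : ℝ} (hL : 0 < L)
    {b : ℝ} (hb : 0 ≤ b) :
    ∃ K : ℝ, 0 ≤ K ∧ ∀ y, ∫ ω in hitEvent W (cutBarrier L g) y,
      Real.exp (-b * (y + √2 * W L.toNNReal ω)) ∂P ≤ K * Real.exp ((b + 1) * y) := by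
  set θ : ℝ := 4 * b + 2
  refine ⟨Real.exp (4 * b ^ 2 * L) + Real.exp (-(θ * (c - κ * L ^ 2)) + θ ^ 2 * L),
    by positivity, fun y => ?_⟩
  set E := hitEvent W (cutBarrier L g) y
  have hE : MeasurableSet E := hW.measurableSet_hitEvent (hg.cutBarrier L) y
  set s : ℝ := Real.exp ((3 * b + 1) * y)
  have hs : 0 < s := Real.exp_pos _
  have hi := hW.integrable_exp_start L.toNNReal (-(2 * b)) y
  have hi' : IntegrableOn (fun ω => s * Real.exp (-(2 * b) * (y + √2 * W L.toNNReal ω)) + s⁻¹) E P :=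
    ((hi.const_mul s).integrableOn).add (integrable_const _)
  calc ∫ ω in E, Real.exp (-b * (y + √2 * W L.toNNReal ω)) ∂P
      ≤ ∫ ω in E, (s * Real.exp (-(2 * b) * (y + √2 * W L.toNNReal ω)) + s⁻¹) ∂P := by
        refine setIntegral_mono_on (hW.integrable_exp_start _ _ _).integrableOn hi' hE ?_
        intro ω _
        set a : ℝ := Real.exp (-b * (y + √2 * W L.toNNReal ω)) with ha
        have ha0 : 0 < a := Real.exp_pos _
        have e : Real.exp (-(2 * b) * (y + √2 * W L.toNNReal ω)) = a ^ 2 := by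
          rw [ha, ← Real.exp_nat_mul]
          congr 1
          push_cast
          ring
        rw [e]
        have h1 : 0 ≤ s⁻¹ * (s * a - 1) ^ 2 := by positivity
        have h2 : s⁻¹ * (s * a - 1) ^ 2 = s * a ^ 2 - 2 * a + s⁻¹ := by
          field_simp
          ring
        linarith
    _ = s * ∫ ω in E, Real.exp (-(2 * b) * (y + √2 * W L.toNNReal ω)) ∂P + P.real E * s⁻¹ := by
        rw [integral_add (hi.const_mul s).integrableOn (integrable_const _), integral_const_mul,
          setIntegral_const, smul_eq_mul]
    _ ≤ s * Real.exp (-(2 * b) * y + (-(2 * b)) ^ 2 * L) +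
        Real.exp (θ * (y - (c - κ * L ^ 2)) + θ ^ 2 * L) * s⁻¹ := by
        have h1 := setIntegral_le_integral (s := E) hi
          (Eventually.of_forall fun ω => (Real.exp_pos _).le)
        rw [hW.integral_exp_start, Real.coe_toNNReal _ hL.le] at h1
        have h2 := hW.measure_hitEvent_le hg hκ h (L := L) (θ := θ) (by positivity) y
        gcongr
    _ = _ := by
        rw [add_mul (Real.exp _), ← Real.exp_neg, ← Real.exp_add, ← Real.exp_add, ← Real.exp_add,
          ← Real.exp_add]
        congr 2
        · ring
        · simp only [θ]
          ring

end Brownian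

/-! ### The part of `e^{LH} K_Ai Θ e^{LH} K_Ai` carried by bridges that cross the barrier -/

lemma integrable_exp_neg_mul_abs {a : ℝ} (ha : 0 < a) :
    Integrable fun y : ℝ => Real.exp (-(a * |y|)) := by
  rw [← integrableOn_univ, ← Set.Iic_union_Ioi (a := (0 : ℝ))]
  refine IntegrableOn.union ?_ ?_
  · refine (integrableOn_exp_mul_Iic ha 0).congr_fun (fun y hy => ?_) measurableSet_Iic
    simp only [abs_of_nonpos (Set.mem_Iic.1 hy)]
    ring_nf
  · refine (integrableOn_exp_mul_Ioi (neg_neg_of_pos ha) 0).congr_fun (fun y hy => ?_)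
      measurableSet_Ioi
    simp only [abs_of_pos (Set.mem_Ioi.1 hy)]
    ring_nf

lemma integrable_exp_neg_abs : Integrable fun y : ℝ => Real.exp (-|y|) := by
  simpa using integrable_exp_neg_mul_abs one_pos

section Brownian

variable {Ω : Type*} [MeasurableSpace Ω] {P : Measure Ω} {W : ℝ≥0 → Ω → ℝ} {g : ℝ → EReal}

/-- Integrals over independent pairs of paths started at the same point. -/
lemma integrable_tensor [IsProbabilityMeasure P] {f h : ℝ × Ω → ℝ} (hf : Measurable f)
    (hh : Measurable h) (hfi : ∀ y, Integrable (fun ω => f (y, ω)) P)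
    (hhi : ∀ y, Integrable (fun ω => h (y, ω)) P) {K : ℝ}
    (hK : ∀ y, (∫ ω, |f (y, ω)| ∂P) * ∫ ω, |h (y, ω)| ∂P ≤ K * Real.exp (-|y|)) :
    Integrable (fun p : ℝ × (Ω × Ω) => f (p.1, p.2.1) * h (p.1, p.2.2))
      (volume.prod (P.prod P)) := by
  have hm : Measurable fun p : ℝ × (Ω × Ω) => f (p.1, p.2.1) * h (p.1, p.2.2) :=
    (hf.comp (measurable_fst.prodMk (measurable_fst.comp measurable_snd))).mul
      (hh.comp (measurable_fst.prodMk (measurable_snd.comp measurable_snd)))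
  rw [integrable_prod_iff hm.aestronglyMeasurable]
  refine ⟨Eventually.of_forall fun y => (hfi y).mul_prod (hhi y), ?_⟩
  refine (integrable_exp_neg_abs.const_mul K).mono'
    (hm.norm.stronglyMeasurable.integral_prod_right').aestronglyMeasurable
    (Eventually.of_forall fun y => ?_)
  rw [Real.norm_eq_abs, abs_of_nonneg (integral_nonneg fun _ => norm_nonneg _)]
  refine le_trans (le_of_eq ?_) (hK y)
  simp only [Real.norm_eq_abs, abs_mul]
  exact integral_prod_mul (fun ω => |f (y, ω)|) fun ω => |h (y, ω)|

lemma IsContBM.measurable_airyFlow_start (hW : IsContBM W P) (L x : ℝ) :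
    Measurable fun p : ℝ × Ω => airyFlow L x (p.1 + √2 * W L.toNNReal p.2) :=
  (measurable_airyFlow_right L x).comp
    (measurable_fst.add (((hW.meas _).comp measurable_snd).const_mul _))

/-- The flow along paths that hit the barrier. -/
def flowOn (W : ℝ≥0 → Ω → ℝ) (g : ℝ → EReal) (L x : ℝ) : ℝ × Ω → ℝ :=
  {p : ℝ × Ω | p.2 ∈ hitEvent W g p.1}.indicator
    fun p => airyFlow L x (p.1 + √2 * W L.toNNReal p.2)

lemma flowOn_apply (L x y : ℝ) : (fun ω => flowOn W g L x (y, ω)) =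
    (hitEvent W g y).indicator fun ω => airyFlow L x (y + √2 * W L.toNNReal ω) := by
  ext ω
  by_cases h : ω ∈ hitEvent W g y
  · rw [Set.indicator_of_mem h, flowOn, Set.indicator_of_mem (by exact h)]
  · rw [Set.indicator_of_notMem h, flowOn, Set.indicator_of_notMem (by exact h)]

lemma IsContBM.measurable_flowOn (hW : IsContBM W P) (hg : GoodBarrier g) (L x : ℝ) :
    Measurable (flowOn W g L x) :=
  (hW.measurable_airyFlow_start L x).indicator (hW.measurableSet_hitEvent_prod hg)

lemma IsContBM.integrable_flowOn [IsProbabilityMeasure P] (hW : IsContBM W P) (hg : GoodBarrier g)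
    {L : ℝ} (hL : 0 < L) (x y : ℝ) : Integrable (fun ω => flowOn W g L x (y, ω)) P := by
  rw [flowOn_apply]
  exact (hW.integrable_airyFlow _ hL.le x y).indicator (hW.measurableSet_hitEvent hg y)

lemma IsContBM.integral_flowOn [IsProbabilityMeasure P] (hW : IsContBM W P) (hg : GoodBarrier g)
    {c κ C : ℝ} (hC : IsHitBound c κ C) (h : AboveParabola c κ g) {L : ℝ} (hL : 0 < L) (x y : ℝ) :
    ∫ ω, flowOn W (cutBarrier L g) L x (y, ω) ∂P = hitFlow P W (cutBarrier L g) x y := by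
  rw [flowOn_apply, integral_indicator (hW.measurableSet_hitEvent (hg.cutBarrier L) y),
    hW.setIntegral_airyFlow hg hC h hL]

lemma IsContBM.exists_integral_abs_airyFlow_le [IsProbabilityMeasure P] (hW : IsContBM W P) {L : ℝ}
    (hL : 0 < L) (x : ℝ) : ∃ K : ℝ, 0 ≤ K ∧ ∀ y,
      ∫ ω, |airyFlow L x (y + √2 * W L.toNNReal ω)| ∂P ≤ K * Real.exp (-(L + 1) * y) := by
  set b := L + 1 with hb
  set K₀ := 2 * Real.exp (-x) * Real.exp (b ^ 3 / 3 - b ^ 2 * L)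
  refine ⟨K₀ * Real.exp ((-b) ^ 2 * L), by positivity, fun y => ?_⟩
  calc _ ≤ ∫ ω, K₀ * Real.exp (-b * (y + √2 * W L.toNNReal ω)) ∂P := by
        refine integral_mono (hW.integrable_airyFlow _ hL.le x y).abs
          ((hW.integrable_exp_start _ _ _).const_mul _) fun ω => ?_
        exact abs_airyFlow_le (by linarith) (by linarith) x _
    _ = _ := by
        rw [integral_const_mul, hW.integral_exp_start, Real.coe_toNNReal _ hL.le, Real.exp_add]
        ring

lemma IsContBM.integral_abs_flowOn_le [IsProbabilityMeasure P] (hW : IsContBM W P)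
    (hg : GoodBarrier g) {L : ℝ} (hL : 0 < L) (x y : ℝ) :
    ∫ ω, |flowOn W g L x (y, ω)| ∂P ≤ ∫ ω, |airyFlow L x (y + √2 * W L.toNNReal ω)| ∂P := by
  refine integral_mono (hW.integrable_flowOn hg hL x y).abs
    (hW.integrable_airyFlow _ hL.le x y).abs fun ω => ?_
  simp only [flowOn]
  rw [← Real.norm_eq_abs, ← Real.norm_eq_abs]
  exact norm_indicator_le_norm_self _ _

lemma IsContBM.exists_integral_abs_flowOn_le [IsProbabilityMeasure P] (hW : IsContBM W P)
    (hg : GoodBarrier g) {c κ : ℝ} (hκ : 0 ≤ κ) (h : AboveParabola c κ g) {L : ℝ} (hL : 0 < L)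
    (x : ℝ) : ∃ K : ℝ, 0 ≤ K ∧ ∀ y,
      ∫ ω, |flowOn W (cutBarrier L g) L x (y, ω)| ∂P ≤ K * Real.exp ((L + 2) * y) := by
  set b := L + 1 with hb
  have hgL := hg.cutBarrier L
  obtain ⟨K, hK0, hK⟩ := hW.setIntegral_exp_le hg hκ h hL (b := b) (by linarith)
  set K₀ := 2 * Real.exp (-x) * Real.exp (b ^ 3 / 3 - b ^ 2 * L)
  refine ⟨K₀ * K, by positivity, fun y => ?_⟩
  have hE := hW.measurableSet_hitEvent hgL y
  have e : ∀ ω, |flowOn W (cutBarrier L g) L x (y, ω)| =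
      (hitEvent W (cutBarrier L g) y).indicator
        (fun ω => |airyFlow L x (y + √2 * W L.toNNReal ω)|) ω := by
    intro ω
    have := congrFun (flowOn_apply (W := W) (g := cutBarrier L g) L x y) ω
    change flowOn W (cutBarrier L g) L x (y, ω) = _ at this
    rw [this]
    by_cases h : ω ∈ hitEvent W (cutBarrier L g) y
    · rw [Set.indicator_of_mem h, Set.indicator_of_mem h]
    · rw [Set.indicator_of_notMem h, Set.indicator_of_notMem h, abs_zero]
  simp_rw [e]
  rw [integral_indicator hE]
  calc _ ≤ ∫ ω in hitEvent W (cutBarrier L g) y,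
        K₀ * Real.exp (-b * (y + √2 * W L.toNNReal ω)) ∂P := by
        refine integral_mono (hW.integrable_airyFlow _ hL.le x y).abs.integrableOn
          ((hW.integrable_exp_start _ _ _).const_mul _).integrableOn fun ω => ?_
        exact abs_airyFlow_le (by linarith) (by linarith) x _
    _ ≤ K₀ * (K * Real.exp ((b + 1) * y)) := by
        rw [integral_const_mul]
        gcongr
        exact hK y
    _ = _ := by
        rw [hb]
        ring_nf

lemma mul_le_exp_neg_abs {L a b K K₁ K₂ y : ℝ} (hL : 0 < L) (hb0 : 0 ≤ b)
    (hK : 0 ≤ K) (hK₁ : 0 ≤ K₁) (hK₂ : 0 ≤ K₂) (ha : a ≤ K * Real.exp ((L + 2) * y))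
    (ha' : a ≤ K₁ * Real.exp (-(L + 1) * y)) (hb : b ≤ K₂ * Real.exp (-(L + 1) * y)) :
    a * b ≤ (K + K₁) * K₂ * Real.exp (-|y|) := by
  rcases le_total 0 y with hy | hy
  · calc a * b ≤ (K₁ * Real.exp (-(L + 1) * y)) * (K₂ * Real.exp (-(L + 1) * y)) := by gcongr
      _ = K₁ * K₂ * Real.exp (-(L + 1) * y + -(L + 1) * y) := by rw [Real.exp_add]; ring
      _ ≤ (K + K₁) * K₂ * Real.exp (-|y|) := by
        rw [abs_of_nonneg hy]
        gcongr
        · linarith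
        · nlinarith
  · calc a * b ≤ (K * Real.exp ((L + 2) * y)) * (K₂ * Real.exp (-(L + 1) * y)) := by gcongr
      _ = K * K₂ * Real.exp ((L + 2) * y + -(L + 1) * y) := by rw [Real.exp_add]; ring
      _ ≤ (K + K₁) * K₂ * Real.exp (-|y|) := by
        rw [abs_of_nonpos hy]
        gcongr
        · linarith
        · linarith

/-- The density of the bridges that cross the barrier. -/
def crossDensity (P : Measure Ω) (W : ℝ≥0 → Ω → ℝ) (g : ℝ → EReal) (L u v : ℝ) : ℝ :=
  heatKernel (2 * L) (v - u) * P.real (bridgeExceed W g L u v)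

/-- The measure identity behind the decomposition of the bridge at time `0`. -/
lemma IsContBM.withDensity_eq_map [IsProbabilityMeasure P] (hW : IsContBM W P)
    (hg : GoodBarrier g) {L : ℝ} (hL : 0 < L) :
    (volume.prod volume).withDensity (fun p : ℝ × ℝ =>
      ENNReal.ofReal (heatKernel (2 * L) (p.2 - p.1)) * P (bridgeExceed W g L p.1 p.2)) =
    ((volume.prod (P.prod P)).restrict {p : ℝ × (Ω × Ω) | p.2 ∈ hitPair W g L p.1}).map
      fun p => (p.1 + √2 * W L.toNNReal p.2.1, p.1 + √2 * W L.toNNReal p.2.2) := by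
  have hd : Measurable fun p : ℝ × ℝ =>
      ENNReal.ofReal (heatKernel (2 * L) (p.2 - p.1)) * P (bridgeExceed W g L p.1 p.2) := by
    refine Measurable.mul ?_ (hW.measurable_bridgeExceed hg L)
    unfold heatKernel
    fun_prop
  have hm : Measurable fun p : ℝ × (Ω × Ω) =>
      (p.1 + √2 * W L.toNNReal p.2.1, p.1 + √2 * W L.toNNReal p.2.2) := by
    have h1 : Measurable fun p : ℝ × (Ω × Ω) => W L.toNNReal p.2.1 :=
      (hW.meas _).comp (measurable_fst.comp measurable_snd)
    have h2 : Measurable fun p : ℝ × (Ω × Ω) => W L.toNNReal p.2.2 :=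
      (hW.meas _).comp (measurable_snd.comp measurable_snd)
    exact (measurable_fst.add (h1.const_mul _)).prodMk (measurable_fst.add (h2.const_mul _))
  have hS := hW.measurableSet_hitPair hg L
  ext A hA
  have hΦ : Measurable (A.indicator (1 : ℝ × ℝ → ℝ≥0∞)) := measurable_one.indicator hA
  have key := hW.lintegral_hit_decomposition hg hL hΦ
  rw [withDensity_apply _ hA, ← lintegral_indicator hA, Measure.map_apply hm hA,
    Measure.restrict_apply (hm hA)]
  have e1 : ∫⁻ p, A.indicator (fun p : ℝ × ℝ =>
      ENNReal.ofReal (heatKernel (2 * L) (p.2 - p.1)) * P (bridgeExceed W g L p.1 p.2)) p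
      ∂(volume.prod volume) = ∫⁻ u, ∫⁻ v, A.indicator (1 : ℝ × ℝ → ℝ≥0∞) (u, v) *
        (ENNReal.ofReal (heatKernel (2 * L) (v - u)) * P (bridgeExceed W g L u v)) := by
    rw [lintegral_prod _ (hd.indicator hA).aemeasurable]
    refine lintegral_congr fun u => lintegral_congr fun v => ?_
    by_cases h : (u, v) ∈ A
    · rw [Set.indicator_of_mem h, Set.indicator_of_mem h, Pi.one_apply, one_mul]
    · rw [Set.indicator_of_notMem h, Set.indicator_of_notMem h, zero_mul]
  rw [e1, key, ← lintegral_indicator_one ((hm hA).inter hS), lintegral_prod _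
    (measurable_one.indicator ((hm hA).inter hS)).aemeasurable]
  refine lintegral_congr fun y => lintegral_congr fun q => ?_
  by_cases h : q ∈ hitPair W g L y
  · rw [Set.indicator_of_mem h]
    by_cases h' : (y + √2 * W L.toNNReal q.1, y + √2 * W L.toNNReal q.2) ∈ A
    · rw [Set.indicator_of_mem h', Set.indicator_of_mem (by exact ⟨h', h⟩)]
      rfl
    · rw [Set.indicator_of_notMem h', Set.indicator_of_notMem (fun h'' => h' h''.1)]
  · rw [Set.indicator_of_notMem h, Set.indicator_of_notMem (fun hmem => h hmem.2)]

/-- The contribution of the bridges that cross the barrier. -/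
theorem IsContBM.integral_crossDensity [IsProbabilityMeasure P] (hW : IsContBM W P)
    (hg : GoodBarrier g) {c κ C : ℝ} (hκ : 0 ≤ κ) (hC : IsHitBound c κ C) (h : AboveParabola c κ g)
    {L : ℝ} (hL : 0 < L) (x x' : ℝ) :
    Integrable (fun p : ℝ × ℝ => airyFlow L x p.1 * airyFlow L x' p.2 *
      crossDensity P W g L p.1 p.2) (volume.prod volume) ∧
    ∫ p : ℝ × ℝ, airyFlow L x p.1 * airyFlow L x' p.2 * crossDensity P W g L p.1 p.2
      ∂(volume.prod volume) =
      ∫ y, (hitFlow P W (cutBarrier L fun t => g (-t)) x y * airyKernel x' y +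
        airyKernel x y * hitFlow P W (cutBarrier L g) x' y -
        hitFlow P W (cutBarrier L fun t => g (-t)) x y * hitFlow P W (cutBarrier L g) x' y) := by
  set g' : ℝ → EReal := fun t => g (-t) with hg'
  have hgn : GoodBarrier g' := hg.comp_neg
  have hn : AboveParabola c κ g' := h.comp_neg
  set dens : ℝ × ℝ → ℝ≥0∞ := fun p =>
    ENNReal.ofReal (heatKernel (2 * L) (p.2 - p.1)) * P (bridgeExceed W g L p.1 p.2) with hdens
  have hheat : ∀ s, 0 ≤ heatKernel (2 * L) s := fun s => by unfold heatKernel; positivity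
  have hd : Measurable dens := by
    refine Measurable.mul ?_ (hW.measurable_bridgeExceed hg L)
    unfold heatKernel
    fun_prop
  have hdlt : ∀ᵐ p ∂(volume.prod volume : Measure (ℝ × ℝ)), dens p < ∞ :=
    Eventually.of_forall fun p => ENNReal.mul_lt_top ENNReal.ofReal_lt_top (measure_lt_top _ _)
  have hdr : ∀ p, (dens p).toReal = crossDensity P W g L p.1 p.2 := fun p => by
    rw [hdens, ENNReal.toReal_mul, ENNReal.toReal_ofReal (hheat _)]
    rfl
  set F : ℝ × ℝ → ℝ := fun p => airyFlow L x p.1 * airyFlow L x' p.2 with hF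
  have hFm : Measurable F := ((measurable_airyFlow_right L x).comp measurable_fst).mul
    ((measurable_airyFlow_right L x').comp measurable_snd)
  have hm : Measurable fun p : ℝ × (Ω × Ω) =>
      (p.1 + √2 * W L.toNNReal p.2.1, p.1 + √2 * W L.toNNReal p.2.2) := by
    have h1 : Measurable fun p : ℝ × (Ω × Ω) => W L.toNNReal p.2.1 :=
      (hW.meas _).comp (measurable_fst.comp measurable_snd)
    have h2 : Measurable fun p : ℝ × (Ω × Ω) => W L.toNNReal p.2.2 :=
      (hW.meas _).comp (measurable_snd.comp measurable_snd)
    exact (measurable_fst.add (h1.const_mul _)).prodMk (measurable_fst.add (h2.const_mul _))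
  have hS := hW.measurableSet_hitPair hg L
  -- the three pieces
  set f₀ : ℝ × Ω → ℝ := fun p => airyFlow L x (p.1 + √2 * W L.toNNReal p.2)
  set h₀ : ℝ × Ω → ℝ := fun p => airyFlow L x' (p.1 + √2 * W L.toNNReal p.2)
  set f₁ := flowOn W (cutBarrier L g') L x
  set h₁ := flowOn W (cutBarrier L g) L x'
  have mf₀ : Measurable f₀ := hW.measurable_airyFlow_start L x
  have mh₀ : Measurable h₀ := hW.measurable_airyFlow_start L x'
  have mf₁ : Measurable f₁ := hW.measurable_flowOn (hgn.cutBarrier L) L x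
  have mh₁ : Measurable h₁ := hW.measurable_flowOn (hg.cutBarrier L) L x'
  have if₀ : ∀ y, Integrable (fun ω => f₀ (y, ω)) P := hW.integrable_airyFlow _ hL.le x
  have ih₀ : ∀ y, Integrable (fun ω => h₀ (y, ω)) P := hW.integrable_airyFlow _ hL.le x'
  have if₁ : ∀ y, Integrable (fun ω => f₁ (y, ω)) P := hW.integrable_flowOn (hgn.cutBarrier L) hL x
  have ih₁ : ∀ y, Integrable (fun ω => h₁ (y, ω)) P := hW.integrable_flowOn (hg.cutBarrier L) hL x'
  obtain ⟨A₀, hA₀, bA₀⟩ := hW.exists_integral_abs_airyFlow_le hL x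
  obtain ⟨B₀, hB₀, bB₀⟩ := hW.exists_integral_abs_airyFlow_le hL x'
  obtain ⟨A₁, hA₁, bA₁⟩ := hW.exists_integral_abs_flowOn_le hgn hκ hn hL x
  obtain ⟨B₁, hB₁, bB₁⟩ := hW.exists_integral_abs_flowOn_le hg hκ h hL x'
  have lf : ∀ y, ∫ ω, |f₁ (y, ω)| ∂P ≤ ∫ ω, |f₀ (y, ω)| ∂P :=
    hW.integral_abs_flowOn_le (hgn.cutBarrier L) hL x
  have lh : ∀ y, ∫ ω, |h₁ (y, ω)| ∂P ≤ ∫ ω, |h₀ (y, ω)| ∂P :=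
    hW.integral_abs_flowOn_le (hg.cutBarrier L) hL x'
  have nn : ∀ k : ℝ × Ω → ℝ, ∀ y, 0 ≤ ∫ ω, |k (y, ω)| ∂P := fun k y =>
    integral_nonneg fun _ => abs_nonneg _
  have i10 := integrable_tensor mf₁ mh₀ if₁ ih₀ fun y =>
    mul_le_exp_neg_abs hL (nn h₀ y) hA₁ hA₀ hB₀ (bA₁ y) ((lf y).trans (bA₀ y)) (bB₀ y)
  have i01 := integrable_tensor mf₀ mh₁ if₀ ih₁ fun y => by
    rw [mul_comm]
    exact mul_le_exp_neg_abs hL (nn f₀ y) hB₁ hB₀ hA₀ (bB₁ y) ((lh y).trans (bB₀ y))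
      (bA₀ y)
  have i11 := integrable_tensor mf₁ mh₁ if₁ ih₁ fun y =>
    mul_le_exp_neg_abs hL (nn h₁ y) hA₁ hA₀ hB₀ (bA₁ y) ((lf y).trans (bA₀ y))
      ((lh y).trans (bB₀ y))
  have hind : ∀ p : ℝ × (Ω × Ω), {p : ℝ × (Ω × Ω) | p.2 ∈ hitPair W g L p.1}.indicator
      (fun p => F (p.1 + √2 * W L.toNNReal p.2.1, p.1 + √2 * W L.toNNReal p.2.2)) p =
      f₁ (p.1, p.2.1) * h₀ (p.1, p.2.2) + f₀ (p.1, p.2.1) * h₁ (p.1, p.2.2) -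
        f₁ (p.1, p.2.1) * h₁ (p.1, p.2.2) := by
    rintro ⟨y, ω, ω'⟩
    have e1 := congrFun (flowOn_apply (W := W) (g := cutBarrier L g') L x y) ω
    have e2 := congrFun (flowOn_apply (W := W) (g := cutBarrier L g) L x' y) ω'
    change f₁ (y, ω) = _ at e1
    change h₁ (y, ω') = _ at e2
    by_cases h1 : ω ∈ hitEvent W (cutBarrier L g') y
    · rw [Set.indicator_of_mem (by exact Or.inl h1)]
      rw [Set.indicator_of_mem h1] at e1
      simp only [e1, hF, f₀, h₀]
      ring
    · rw [Set.indicator_of_notMem h1] at e1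
      by_cases h2 : ω' ∈ hitEvent W (cutBarrier L g) y
      · rw [Set.indicator_of_mem (by exact Or.inr h2)]
        rw [Set.indicator_of_mem h2] at e2
        simp only [e1, e2, hF, f₀, h₀]
        ring
      · rw [Set.indicator_of_notMem h2] at e2
        rw [Set.indicator_of_notMem (by rintro (h3 | h3); exacts [h1 h3, h2 h3])]
        simp only [e1, e2]
        ring
  have hintg := (i10.add i01).sub i11
  have hintg' : IntegrableOn
      (fun p : ℝ × (Ω × Ω) => F (p.1 + √2 * W L.toNNReal p.2.1, p.1 + √2 * W L.toNNReal p.2.2))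
      {p : ℝ × (Ω × Ω) | p.2 ∈ hitPair W g L p.1} (volume.prod (P.prod P)) := by
    rw [← integrable_indicator_iff hS]
    exact hintg.congr (Eventually.of_forall fun p => (hind p).symm)
  have hFi : Integrable F ((volume.prod volume).withDensity dens) := by
    rw [hW.withDensity_eq_map hg hL]
    exact (integrable_map_measure hFm.aestronglyMeasurable hm.aemeasurable).2 hintg'
  refine ⟨?_, ?_⟩
  · rw [integrable_withDensity_iff_integrable_smul' hd hdlt] at hFi
    refine hFi.congr (Eventually.of_forall fun p => ?_)
    simp only [hdr, smul_eq_mul, hF]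
    ring
  have e1 : ∫ p : ℝ × ℝ, airyFlow L x p.1 * airyFlow L x' p.2 * crossDensity P W g L p.1 p.2
      ∂(volume.prod volume) = ∫ p, F p ∂((volume.prod volume).withDensity dens) := by
    rw [integral_withDensity_eq_integral_toReal_smul hd hdlt]
    refine integral_congr_ae (Eventually.of_forall fun p => ?_)
    simp only [hdr, smul_eq_mul, hF]
    ring
  rw [e1, hW.withDensity_eq_map hg hL, integral_map hm.aemeasurable hFm.aestronglyMeasurable,
    ← integral_indicator hS, integral_congr_ae (Eventually.of_forall hind)]
  refine (integral_prod _ hintg).trans ?_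
  refine integral_congr_ae (Eventually.of_forall fun y => ?_)
  have q10 := (if₁ y).mul_prod (ih₀ y)
  have q01 := (if₀ y).mul_prod (ih₁ y)
  have q11 := (if₁ y).mul_prod (ih₁ y)
  have hf₁ : ∫ ω, f₁ (y, ω) ∂P = hitFlow P W (cutBarrier L g') x y :=
    hW.integral_flowOn hgn hC hn hL x y
  have hh₁ : ∫ ω, h₁ (y, ω) ∂P = hitFlow P W (cutBarrier L g) x' y :=
    hW.integral_flowOn hg hC h hL x' y
  have hf₀ : ∫ ω, f₀ (y, ω) ∂P = airyKernel x y := by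
    have := hW.integral_airyFlow L.toNNReal hL.le x y
    rwa [Real.coe_toNNReal _ hL.le, sub_self, airyFlow_zero] at this
  have hh₀ : ∫ ω, h₀ (y, ω) ∂P = airyKernel x' y := by
    have := hW.integral_airyFlow L.toNNReal hL.le x' y
    rwa [Real.coe_toNNReal _ hL.le, sub_self, airyFlow_zero] at this
  have r10 := integral_prod_mul (μ := P) (ν := P) (fun ω => f₁ (y, ω)) (fun ω => h₀ (y, ω))
  have r01 := integral_prod_mul (μ := P) (ν := P) (fun ω => f₀ (y, ω)) (fun ω => h₁ (y, ω))
  have r11 := integral_prod_mul (μ := P) (ν := P) (fun ω => f₁ (y, ω)) (fun ω => h₁ (y, ω))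
  rw [hf₁, hh₀] at r10
  rw [hf₀, hh₁] at r01
  rw [hf₁, hh₁] at r11
  beta_reduce
  rw [← r10, ← r01, ← r11]
  exact (integral_sub (q10.add q01) q11).trans (congrArg (· - _) (integral_add q10 q01))

end Brownian

/-! ### The kernel of `e^{LH} K_Ai Θ e^{LH} K_Ai` -/

/-- The Airy transform preserves inner products. -/
theorem integral_airy_mul_airy {φ ψ : ℝ → ℝ} (hφ : MemLp φ 2) (hψ : MemLp ψ 2)
    (hφ' : Integrable fun l => Real.exp (l / 8) * |φ l|)
    (hψ' : Integrable fun l => Real.exp (l / 8) * |ψ l|) :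
    Integrable (fun s => (∫ l, airyAi (s - l) * φ l) * ∫ l, airyAi (s - l) * ψ l) ∧
    ∫ s, (∫ l, airyAi (s - l) * φ l) * ∫ l, airyAi (s - l) * ψ l = ∫ l, φ l * ψ l := by
  have key : ∀ {φ : ℝ → ℝ} (hφ : MemLp φ 2), (Integrable fun l => Real.exp (l / 8) * |φ l|) →
      ∃ F : L2, (F =ᵐ[volume] fun l => ((φ l : ℝ) : ℂ)) ∧
        airyA F =ᵐ[volume] fun s => ((∫ l, airyAi (s - l) * φ l : ℝ) : ℂ) := by
    intro φ hφ hφ'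
    have hm : MemLp (fun l => ((φ l : ℝ) : ℂ)) 2 := hφ.ofReal
    have hae := hm.coeFn_toLp
    refine ⟨hm.toLp, hae, ?_⟩
    have h1 := hasTestKernel_airyA.coeFn_apply hm.toLp (hφ'.congr (by
      filter_upwards [hae] with l hl
      rw [hl, Complex.norm_real, Real.norm_eq_abs]))
    filter_upwards [h1] with s hs
    rw [hs, ← integral_complex_ofReal]
    refine integral_congr_ae ?_
    filter_upwards [hae] with l hl
    rw [hl, Complex.real_smul, airyTransformKernel]
    push_cast
    rfl
  obtain ⟨F, hF, hAF⟩ := key hφ hφ'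
  obtain ⟨G, hG, hAG⟩ := key hψ hψ'
  have hinner : ⟪airyA F, airyA G⟫_ℂ = ⟪F, G⟫_ℂ := by
    rw [← ContinuousLinearMap.adjoint_inner_right, ← ContinuousLinearMap.comp_apply,
      adjoint_airyA_comp_airyA, one_apply_eq_self]
  have e1 : (fun s => ⟪airyA F s, airyA G s⟫_ℂ) =ᵐ[volume] fun s =>
      (((∫ l, airyAi (s - l) * φ l) * ∫ l, airyAi (s - l) * ψ l : ℝ) : ℂ) := by
    filter_upwards [hAF, hAG] with s h1 h2
    rw [h1, h2, RCLike.inner_apply, Complex.conj_ofReal]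
    push_cast
    ring
  have e2 : (fun s => ⟪F s, G s⟫_ℂ) =ᵐ[volume] fun s => ((φ s * ψ s : ℝ) : ℂ) := by
    filter_upwards [hF, hG] with s h1 h2
    rw [h1, h2, RCLike.inner_apply, Complex.conj_ofReal]
    push_cast
    ring
  refine ⟨?_, ?_⟩
  · have := ((L2.integrable_inner (𝕜 := ℂ) (airyA F) (airyA G)).congr e1).re
    simpa using this
  · rw [L2.inner_def, L2.inner_def, integral_congr_ae e1, integral_congr_ae e2,
      integral_complex_ofReal, integral_complex_ofReal] at hinner
    exact_mod_cast hinner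

/-- The weight `1_{l ≤ 0} e^{lt} Ai(x - l)`. -/
def airyWeight (t x : ℝ) : ℝ → ℝ :=
  (Set.Iic 0).indicator fun l => Real.exp (l * t) * airyAi (x - l)

lemma measurable_airyWeight (t x : ℝ) : Measurable (airyWeight t x) :=
  Measurable.indicator (by fun_prop) measurableSet_Iic

lemma abs_airyWeight_le (t x l : ℝ) : |airyWeight t x l| ≤
    Real.exp ((|t| + 1) ^ 3 / 3 - (|t| + 1) * x) * (Set.Iic (0 : ℝ)).indicator Real.exp l := by
  unfold airyWeight
  by_cases hl : l ∈ Set.Iic (0 : ℝ)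
  · rw [Set.indicator_of_mem hl, Set.indicator_of_mem hl, abs_mul, abs_of_pos (Real.exp_pos _)]
    have hl0 : l ≤ 0 := hl
    have h1 := abs_invHeatAiry_le (t := 0) (b := |t| + 1) (x - l) (by
      have := abs_nonneg t
      linarith)
    rw [invHeatAiry_zero] at h1
    calc _ ≤ Real.exp (l * t) *
          Real.exp ((|t| + 1) ^ 3 / 3 - (|t| + 1) ^ 2 * 0 - (|t| + 1) * (x - l)) := by gcongr
      _ ≤ _ := by
        rw [← Real.exp_add, ← Real.exp_add, Real.exp_le_exp]
        nlinarith [neg_abs_le t]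
  · rw [Set.indicator_of_notMem hl, Set.indicator_of_notMem hl]
    simp

lemma memLp_indicator_exp : MemLp ((Set.Iic (0 : ℝ)).indicator Real.exp) 2 := by
  rw [memLp_two_iff_integrable_sq (Measurable.indicator (by fun_prop)
    measurableSet_Iic).aestronglyMeasurable]
  have h1 : Integrable ((Set.Iic (0 : ℝ)).indicator Real.exp) :=
    (integrable_indicator_iff measurableSet_Iic).2 (integrableOn_exp_Iic 0)
  refine h1.mono' ?_ (Eventually.of_forall fun l => ?_)
  · exact ((Measurable.indicator (by fun_prop) measurableSet_Iic).pow_const 2).aestronglyMeasurable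
  · by_cases hl : l ∈ Set.Iic (0 : ℝ)
    · rw [Set.indicator_of_mem hl, Real.norm_eq_abs, abs_of_nonneg (sq_nonneg _), sq]
      exact mul_le_of_le_one_left (Real.exp_pos _).le (Real.exp_le_one_iff.2 hl)
    · rw [Set.indicator_of_notMem hl]
      simp

lemma memLp_airyWeight (t x : ℝ) : MemLp (airyWeight t x) 2 := by
  refine (memLp_indicator_exp.const_mul
    (Real.exp ((|t| + 1) ^ 3 / 3 - (|t| + 1) * x))).mono'
    (measurable_airyWeight t x).aestronglyMeasurable (Eventually.of_forall fun l => ?_)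
  exact abs_airyWeight_le t x l

lemma integrable_airyWeight (t x : ℝ) :
    Integrable fun l => Real.exp (l / 8) * |airyWeight t x l| := by
  have h1 : Integrable ((Set.Iic (0 : ℝ)).indicator Real.exp) :=
    (integrable_indicator_iff measurableSet_Iic).2 (integrableOn_exp_Iic 0)
  refine (h1.const_mul (Real.exp ((|t| + 1) ^ 3 / 3 - (|t| + 1) * x))).mono'
    (Measurable.aestronglyMeasurable ?_) (Eventually.of_forall fun l => ?_)
  · exact (by fun_prop : Measurable fun l : ℝ => Real.exp (l / 8)).mul
      (measurable_airyWeight t x).abs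
  · rw [norm_mul, Real.norm_eq_abs, abs_of_pos (Real.exp_pos _), Real.norm_eq_abs, abs_abs]
    refine le_trans ?_ (abs_airyWeight_le t x l)
    by_cases hl : l ∈ Set.Iic (0 : ℝ)
    · refine mul_le_of_le_one_left (abs_nonneg _) (Real.exp_le_one_iff.2 ?_)
      have : l ≤ 0 := hl
      linarith
    · rw [airyWeight, Set.indicator_of_notMem hl]
      simp

lemma airyFlow_eq (t x u : ℝ) : airyFlow t x u =
    Real.exp (-2 * t ^ 3 / 3 - u * t) * ∫ l, airyAi (u + t ^ 2 - l) * airyWeight t x l := by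
  rw [airyFlow, ← integral_indicator measurableSet_Iic, ← integral_const_mul]
  refine integral_congr_ae (Eventually.of_forall fun l => ?_)
  simp only
  by_cases hl : l ∈ Set.Iic (0 : ℝ)
  · rw [airyWeight, Set.indicator_of_mem hl, Set.indicator_of_mem hl, invHeatAiry,
      show -2 * t ^ 3 / 3 - (u - l) * t = (-2 * t ^ 3 / 3 - u * t) + l * t by ring, Real.exp_add,
      show u - l + t ^ 2 = u + t ^ 2 - l by ring]
    ring
  · rw [airyWeight, Set.indicator_of_notMem hl, Set.indicator_of_notMem hl, mul_zero, mul_zero]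

/-- The contribution of the free bridge. -/
theorem integral_airyFlow_mul_airyFlow (L x y : ℝ) :
    Integrable (fun u => airyFlow L x u * airyFlow (-L) y u) ∧
    ∫ u, airyFlow L x u * airyFlow (-L) y u = airyKernel x y := by
  obtain ⟨h1, h2⟩ := integral_airy_mul_airy (memLp_airyWeight L x) (memLp_airyWeight (-L) y)
    (integrable_airyWeight L x) (integrable_airyWeight (-L) y)
  have e : ∀ u, airyFlow L x u * airyFlow (-L) y u =
      (∫ l, airyAi (u + L ^ 2 - l) * airyWeight L x l) *
        ∫ l, airyAi (u + L ^ 2 - l) * airyWeight (-L) y l := by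
    intro u
    have h3 : Real.exp (-2 * L ^ 3 / 3 - u * L) * Real.exp (-2 * (-L) ^ 3 / 3 - u * -L) = 1 := by
      rw [← Real.exp_add, Real.exp_eq_one_iff]
      ring
    rw [airyFlow_eq, airyFlow_eq (-L), neg_sq, mul_mul_mul_comm, h3, one_mul]
  refine ⟨?_, ?_⟩
  · exact (h1.comp_add_right (L ^ 2)).congr (Eventually.of_forall fun u => (e u).symm)
  · simp_rw [e]
    rw [integral_add_right_eq_self (fun s => (∫ l, airyAi (s - l) * airyWeight L x l) *
        ∫ l, airyAi (s - l) * airyWeight (-L) y l) (L ^ 2), h2, airyKernel,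
      ← integral_indicator measurableSet_Iic]
    refine integral_congr_ae (Eventually.of_forall fun l => ?_)
    simp only
    by_cases hl : l ∈ Set.Iic (0 : ℝ)
    · have h3 : Real.exp (l * L) * Real.exp (l * -L) = 1 := by
        rw [← Real.exp_add, Real.exp_eq_one_iff]
        ring
      rw [airyWeight, airyWeight, Set.indicator_of_mem hl, Set.indicator_of_mem hl,
        Set.indicator_of_mem hl, mul_mul_mul_comm, h3, one_mul]
    · rw [airyWeight, Set.indicator_of_notMem hl, Set.indicator_of_notMem hl, zero_mul]

lemma expAiryKernel_eq (L x z : ℝ) :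
    expAiryKernel L x z = Real.exp (L * z - L ^ 3 / 3) * airyFlow L x (z - L ^ 2) := by
  rw [expAiryKernel, airyFlow, ← integral_const_mul]
  refine integral_congr_ae (Eventually.of_forall fun l => ?_)
  simp only [invHeatAiry]
  rw [show z - L ^ 2 - l + L ^ 2 = z - l by ring]
  have : Real.exp (l * L) = Real.exp (L * z - L ^ 3 / 3) *
      Real.exp (-2 * L ^ 3 / 3 - (z - L ^ 2 - l) * L) := by
    rw [← Real.exp_add]
    congr 1
    ring
  rw [this]
  ring

lemma expAiryKernel_comm (L x z : ℝ) : expAiryKernel L x z = expAiryKernel L z x := by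
  unfold expAiryKernel
  refine integral_congr_ae (Eventually.of_forall fun l => ?_)
  simp only
  ring

lemma heatKernel_nonneg (t x : ℝ) : 0 ≤ heatKernel t x := by
  unfold heatKernel
  positivity

lemma integral_heatKernel_mul {T : ℝ≥0} (hT : 0 < T) {F : ℝ → ℝ} (hF : Measurable F) {u : ℝ}
    (hi : Integrable (fun z => F (u + √2 * z)) (gaussianReal 0 T)) :
    Integrable (fun v => heatKernel T (v - u) * F v) ∧
    ∫ v, heatKernel T (v - u) * F v = ∫ z, F (u + √2 * z) ∂(gaussianReal 0 T) := by
  have hm : Measurable fun v => ENNReal.ofReal (heatKernel T (v - u)) := by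
    unfold heatKernel
    fun_prop
  have hlt : ∀ᵐ v : ℝ, ENNReal.ofReal (heatKernel T (v - u)) < ∞ :=
    Eventually.of_forall fun _ => ENNReal.ofReal_lt_top
  have ha : AEMeasurable (fun z => u + √2 * z) (gaussianReal 0 T) :=
    Measurable.aemeasurable (by fun_prop)
  have h1 : Integrable F ((gaussianReal 0 T).map fun z => u + √2 * z) :=
    (integrable_map_measure hF.aestronglyMeasurable ha).2 hi
  refine ⟨?_, ?_⟩
  · rw [map_affine_gaussianReal hT, integrable_withDensity_iff_integrable_smul' hm hlt] at h1
    simpa only [ENNReal.toReal_ofReal (heatKernel_nonneg _ _), smul_eq_mul] using h1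
  · rw [← integral_map ha hF.aestronglyMeasurable, map_affine_gaussianReal hT,
      integral_withDensity_eq_integral_toReal_smul hm hlt]
    simp only [ENNReal.toReal_ofReal (heatKernel_nonneg _ _), smul_eq_mul]

section Brownian

variable {Ω : Type*} [MeasurableSpace Ω] {P : Measure Ω} {W : ℝ≥0 → Ω → ℝ} {g : ℝ → EReal}

lemma IsContBM.thetaKernel_eq [IsProbabilityMeasure P] (hW : IsContBM W P) (hg : GoodBarrier g)
    (L z₁ z₂ : ℝ) : thetaKernel P W g L z₁ z₂ = Real.exp (2 * L ^ 3 / 3 - L * z₁ - L * z₂) *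
      (heatKernel (2 * L) ((z₂ - L ^ 2) - (z₁ - L ^ 2)) -
        crossDensity P W g L (z₁ - L ^ 2) (z₂ - L ^ 2)) := by
  have hm : MeasurableSet (bridgeExceed W g L (z₁ - L ^ 2) (z₂ - L ^ 2)) :=
    measurable_prodMk_left (hW.measurableSet_bridgeExceed_prod hg L)
      (x := (z₁ - L ^ 2, z₂ - L ^ 2))
  have e : {ω | ∀ t ∈ Set.Icc (-L) L,
      (bridge W (-L) (z₁ - L ^ 2) L (z₂ - L ^ 2) t ω : EReal) ≤ g t} =
      (bridgeExceed W g L (z₁ - L ^ 2) (z₂ - L ^ 2))ᶜ := by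
    ext ω
    simp [bridgeExceed]
  rw [thetaKernel, e, probReal_compl_eq_one_sub hm, crossDensity, sub_sub_sub_cancel_right]
  ring

lemma IsContBM.measurable_crossDensity [IsProbabilityMeasure P] (hW : IsContBM W P)
    (hg : GoodBarrier g) (L : ℝ) : Measurable (Function.uncurry (crossDensity P W g L)) := by
  refine Measurable.mul ?_ (hW.measurable_bridgeExceed hg L).ennreal_toReal
  unfold heatKernel
  fun_prop

lemma abs_crossDensity_le [IsProbabilityMeasure P] (L u v : ℝ) :
    |crossDensity P W g L u v| ≤ heatKernel (2 * L) (v - u) := by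
  rw [crossDensity, abs_mul, abs_of_nonneg (heatKernel_nonneg _ _), abs_of_nonneg measureReal_nonneg]
  exact mul_le_of_le_one_right (heatKernel_nonneg _ _) measureReal_le_one

lemma IsContBM.integral_heatKernel_airyFlow [IsProbabilityMeasure P] (hW : IsContBM W P) {L : ℝ}
    (hL : 0 < L) (y u : ℝ) :
    Integrable (fun v => heatKernel (2 * L) (v - u) * airyFlow L y v) ∧
    ∫ v, heatKernel (2 * L) (v - u) * airyFlow L y v = airyFlow (-L) y u := by
  set T : ℝ≥0 := (2 * L).toNNReal
  have hTL : (T : ℝ) = 2 * L := Real.coe_toNNReal _ (by linarith)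
  have hT0 : 0 < T := Real.toNNReal_pos.2 (by linarith)
  have hm := measurable_airyFlow_right L y
  have hc : Measurable fun z : ℝ => airyFlow L y (u + √2 * z) := hm.comp (by fun_prop)
  have hi := hW.integrable_airyFlow T hL.le y u
  have he := hW.integral_airyFlow T hL.le y u
  have hi' : Integrable (fun z => airyFlow L y (u + √2 * z)) (gaussianReal 0 T) := by
    rw [← (hW.bm.hasLaw_eval T).map_eq]
    exact (integrable_map_measure hc.aestronglyMeasurable (hW.meas T).aemeasurable).2 hi
  obtain ⟨h1, h2⟩ := integral_heatKernel_mul hT0 hm hi'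
  rw [hTL] at h1 h2
  refine ⟨h1, ?_⟩
  rw [h2, ← (hW.bm.hasLaw_eval T).map_eq, integral_map (hW.meas T).aemeasurable
    hc.aestronglyMeasurable, he, hTL]
  congr 1
  ring

lemma IsContBM.integrable_crossDensity_airyFlow [IsProbabilityMeasure P] (hW : IsContBM W P)
    (hg : GoodBarrier g) {L : ℝ} (hL : 0 < L) (y u : ℝ) :
    Integrable fun v => crossDensity P W g L u v * airyFlow L y v := by
  refine (hW.integral_heatKernel_airyFlow hL y u).1.norm.mono' ?_ (Eventually.of_forall fun v => ?_)
  · exact ((hW.measurable_crossDensity hg L).of_uncurry_left.mul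
      (measurable_airyFlow_right L y)).aestronglyMeasurable
  · rw [norm_mul, norm_mul, Real.norm_eq_abs, Real.norm_eq_abs,
      Real.norm_eq_abs, abs_of_nonneg (heatKernel_nonneg _ _)]
    gcongr
    exact abs_crossDensity_le L u v

lemma IsContBM.thetaKernel_mul_expAiryKernel [IsProbabilityMeasure P] (hW : IsContBM W P)
    (hg : GoodBarrier g) (L z₁ z₂ y : ℝ) :
    thetaKernel P W g L z₁ z₂ * expAiryKernel L z₂ y = Real.exp (L ^ 3 / 3 - L * z₁) *
      (heatKernel (2 * L) ((z₂ - L ^ 2) - (z₁ - L ^ 2)) * airyFlow L y (z₂ - L ^ 2) -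
        crossDensity P W g L (z₁ - L ^ 2) (z₂ - L ^ 2) * airyFlow L y (z₂ - L ^ 2)) := by
  rw [hW.thetaKernel_eq hg, expAiryKernel_comm, expAiryKernel_eq]
  have : Real.exp (L ^ 3 / 3 - L * z₁) = Real.exp (2 * L ^ 3 / 3 - L * z₁ - L * z₂) *
      Real.exp (L * z₂ - L ^ 3 / 3) := by
    rw [← Real.exp_add]
    congr 1
    ring
  rw [this]
  ring

lemma IsContBM.composable_theta [IsProbabilityMeasure P] (hW : IsContBM W P) (hg : GoodBarrier g)
    {L : ℝ} (hL : 0 < L) : Composable (thetaKernel P W g L) (expAiryKernel L) := by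
  intro z₁ y
  simp_rw [hW.thetaKernel_mul_expAiryKernel hg]
  have h := ((hW.integral_heatKernel_airyFlow hL y (z₁ - L ^ 2)).1.sub
    (hW.integrable_crossDensity_airyFlow hg hL y (z₁ - L ^ 2))).comp_sub_right (L ^ 2)
  exact h.const_mul _

lemma IsContBM.kernelComp_theta [IsProbabilityMeasure P] (hW : IsContBM W P) (hg : GoodBarrier g)
    {L : ℝ} (hL : 0 < L) (z₁ y : ℝ) : kernelComp (thetaKernel P W g L) (expAiryKernel L) z₁ y =
      Real.exp (L ^ 3 / 3 - L * z₁) * (airyFlow (-L) y (z₁ - L ^ 2) -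
        ∫ v, crossDensity P W g L (z₁ - L ^ 2) v * airyFlow L y v) := by
  unfold kernelComp
  simp_rw [hW.thetaKernel_mul_expAiryKernel hg]
  obtain ⟨h1, h2⟩ := hW.integral_heatKernel_airyFlow hL y (z₁ - L ^ 2)
  rw [integral_const_mul, integral_sub_right_eq_self (fun v =>
    heatKernel (2 * L) (v - (z₁ - L ^ 2)) * airyFlow L y v -
      crossDensity P W g L (z₁ - L ^ 2) v * airyFlow L y v) (L ^ 2),
    integral_sub h1 (hW.integrable_crossDensity_airyFlow hg hL y _), h2]

/-- The kernel of `e^{LH} K_Ai Θ e^{LH} K_Ai` in terms of the hitting kernels. -/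
theorem IsContBM.scatLKernel_eq [IsProbabilityMeasure P] (hW : IsContBM W P) (hg : GoodBarrier g)
    {c κ C : ℝ} (hκ : 0 ≤ κ) (hC : IsHitBound c κ C) (h : AboveParabola c κ g) {L : ℝ}
    (hL : 0 < L) :
    Composable (expAiryKernel L) (kernelComp (thetaKernel P W g L) (expAiryKernel L)) ∧
    ∀ x y, scatLKernel P W g L x y = airyKernel x y -
      ∫ z, (hitFlow P W (cutBarrier L fun t => g (-t)) x z * airyKernel y z +
        airyKernel x z * hitFlow P W (cutBarrier L g) y z -
        hitFlow P W (cutBarrier L fun t => g (-t)) x z * hitFlow P W (cutBarrier L g) y z) := by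
  set N : ℝ → ℝ → ℝ := fun y u => ∫ v, crossDensity P W g L u v * airyFlow L y v with hN
  have e : ∀ x y z, expAiryKernel L x z *
      kernelComp (thetaKernel P W g L) (expAiryKernel L) z y =
      airyFlow L x (z - L ^ 2) * airyFlow (-L) y (z - L ^ 2) -
        airyFlow L x (z - L ^ 2) * N y (z - L ^ 2) := by
    intro x y z
    rw [hW.kernelComp_theta hg hL, expAiryKernel_eq]
    have : Real.exp (L * z - L ^ 3 / 3) * Real.exp (L ^ 3 / 3 - L * z) = 1 := by
      rw [← Real.exp_add, Real.exp_eq_one_iff]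
      ring
    rw [mul_mul_mul_comm, this, one_mul, mul_sub]
  have hfree := fun x y => integral_airyFlow_mul_airyFlow L x y
  have hcross := fun x y => hW.integral_crossDensity hg hκ hC h hL x y
  have eN : ∀ x y u, airyFlow L x u * N y u =
      ∫ v, airyFlow L x u * airyFlow L y v * crossDensity P W g L u v := by
    intro x y u
    simp only [hN]
    rw [← integral_const_mul]
    refine integral_congr_ae (Eventually.of_forall fun v => ?_)
    simp only
    ring
  have hNi : ∀ x y, Integrable fun u => airyFlow L x u * N y u := by
    intro x y
    simp_rw [eN]
    exact (hcross x y).1.integral_prod_left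
  refine ⟨fun x y => ?_, fun x y => ?_⟩
  · simp_rw [e]
    exact ((hfree x y).1.sub (hNi x y)).comp_sub_right (L ^ 2)
  · rw [scatLKernel, kernelComp]
    simp_rw [e]
    rw [integral_sub_right_eq_self (fun u => airyFlow L x u * airyFlow (-L) y u -
      airyFlow L x u * N y u) (L ^ 2), integral_sub (hfree x y).1 (hNi x y), (hfree x y).2,
      ← (hcross x y).2, integral_prod _ (hcross x y).1]
    simp_rw [eN]

end Brownian

/-! ### Composition of integral operators with weighted kernels -/

lemma HasKernel.add {k₁ k₂ : ℝ → ℝ → ℝ} {T₁ T₂ : L2 →L[ℂ] L2} (h₁ : HasKernel k₁ T₁)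
    (h₂ : HasKernel k₂ T₂) : HasKernel (fun x y => k₁ x y + k₂ x y) (T₁ + T₂) := by
  intro f hf hs
  obtain ⟨i₁, e₁⟩ := h₁ f hf hs
  obtain ⟨i₂, e₂⟩ := h₂ f hf hs
  refine ⟨?_, ?_⟩
  · filter_upwards [i₁, i₂] with x hx₁ hx₂
    simp_rw [add_smul]
    exact hx₁.add hx₂
  · rw [_root_.add_apply]
    filter_upwards [i₁, i₂, e₁, e₂, Lp.coeFn_add (T₁ ((hf.memLp_of_hasCompactSupport hs).toLp f))
      (T₂ ((hf.memLp_of_hasCompactSupport hs).toLp f))] with x hx₁ hx₂ h₁ h₂ h₃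
    simp_rw [add_smul]
    rw [h₃, Pi.add_apply, h₁, h₂, integral_add hx₁ hx₂]

lemma HasKernel.neg {k : ℝ → ℝ → ℝ} {T : L2 →L[ℂ] L2} (h : HasKernel k T) :
    HasKernel (fun x y => -k x y) (-T) := by
  intro f hf hs
  obtain ⟨i, e⟩ := h f hf hs
  refine ⟨?_, ?_⟩
  · filter_upwards [i] with x hx
    simp_rw [neg_smul]
    exact hx.neg
  · rw [_root_.neg_apply]
    filter_upwards [e, Lp.coeFn_neg (T ((hf.memLp_of_hasCompactSupport hs).toLp f))] with x h₁ h₂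
    simp_rw [neg_smul]
    rw [h₂, Pi.neg_apply, h₁, integral_neg]

lemma HasKernel.sub {k₁ k₂ : ℝ → ℝ → ℝ} {T₁ T₂ : L2 →L[ℂ] L2} (h₁ : HasKernel k₁ T₁)
    (h₂ : HasKernel k₂ T₂) : HasKernel (fun x y => k₁ x y - k₂ x y) (T₁ - T₂) := by
  simpa only [sub_eq_add_neg] using h₁.add h₂.neg

/-- The operator `T` is given by the kernel `k`, dominated by `U(x) V(y)`, on all functions that are
integrable against `V`. -/
structure HasWeightedKernel (k : ℝ → ℝ → ℝ) (U V : ℝ → ℝ) (T : L2 →L[ℂ] L2) : Prop where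
  measurable : Measurable (Function.uncurry k)
  measurable_right : Measurable V
  nonneg_left : ∀ x, 0 ≤ U x
  nonneg_right : ∀ y, 0 ≤ V y
  bound : ∀ x y, |k x y| ≤ U x * V y
  coeFn_apply : ∀ F : L2, Integrable (fun y => V y * ‖F y‖) →
    T F =ᵐ[volume] fun x => ∫ y, k x y • F y

lemma HasTestKernel.hasWeightedKernel {k : ℝ → ℝ → ℝ} {U V : ℝ → ℝ} {T : L2 →L[ℂ] L2}
    (h : HasTestKernel k U V T) : HasWeightedKernel k U V T where
  measurable := h.cont.measurable
  measurable_right := h.contV.measurable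
  nonneg_left := h.posU
  nonneg_right := h.posV
  bound := h.bound
  coeFn_apply := h.coeFn_apply

lemma IsDominatedKernel.hasWeightedKernel {k : ℝ → ℝ → ℝ} {u v : ℝ → ℝ}
    (h : IsDominatedKernel k u v) (hu : ∀ x, 0 ≤ u x) (hvm : Measurable v)
    (hv : ∀ y, 0 ≤ v y) : HasWeightedKernel k u v h.op where
  measurable := h.measurable
  measurable_right := hvm
  nonneg_left := hu
  nonneg_right := hv
  bound := h.bound
  coeFn_apply F _ := h.coeFn_op F

namespace HasWeightedKernel

variable {k k₁ k₂ : ℝ → ℝ → ℝ} {U V U₁ V₁ U₂ V₂ : ℝ → ℝ} {T T₁ T₂ : L2 →L[ℂ] L2}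

lemma norm_smul_le (h : HasWeightedKernel k U V T) (F : ℝ → ℂ) (x y : ℝ) :
    ‖k x y • F y‖ ≤ U x * (V y * ‖F y‖) := by
  rw [norm_smul, ← mul_assoc]
  gcongr
  exact h.bound x y

lemma integrable (h : HasWeightedKernel k U V T) {F : ℝ → ℂ} (hF : AEStronglyMeasurable F)
    (hV : Integrable fun y => V y * ‖F y‖) (x : ℝ) : Integrable fun y => k x y • F y :=
  (hV.const_mul (U x)).mono' (h.measurable.of_uncurry_left.aestronglyMeasurable.smul hF)
    (Eventually.of_forall fun y => h.norm_smul_le F x y)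

lemma norm_integral_le (h : HasWeightedKernel k U V T) {F : ℝ → ℂ}
    (hV : Integrable fun y => V y * ‖F y‖) (x : ℝ) :
    ‖∫ y, k x y • F y‖ ≤ U x * ∫ y, V y * ‖F y‖ := by
  rw [← integral_const_mul]
  exact norm_integral_le_of_norm_le (hV.const_mul _)
    (Eventually.of_forall fun y => h.norm_smul_le F x y)

lemma hasKernel (h : HasWeightedKernel k U V T) (hc : Continuous V) : HasKernel k T := by
  intro f hf hs
  have hV : Integrable fun y => V y * ‖f y‖ :=
    (hc.mul hf.norm).integrable_of_hasCompactSupport hs.norm.mul_left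
  have hae := (hf.memLp_of_hasCompactSupport (p := 2) (μ := volume) hs).coeFn_toLp
  refine ⟨Eventually.of_forall fun x => h.integrable hf.aestronglyMeasurable hV x, ?_⟩
  have := h.coeFn_apply ((hf.memLp_of_hasCompactSupport (p := 2) (μ := volume) hs).toLp f)
    (hV.congr (by filter_upwards [hae] with y hy; rw [hy]))
  filter_upwards [this] with x hx
  rw [hx]
  refine integral_congr_ae ?_
  filter_upwards [hae] with y hy
  rw [hy]

lemma integrable_mul (h₁ : HasWeightedKernel k₁ U₁ V₁ T₁) (h₂ : HasWeightedKernel k₂ U₂ V₂ T₂)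
    (hi : Integrable fun z => V₁ z * U₂ z) (x y : ℝ) : Integrable fun z => k₁ x z * k₂ z y := by
  refine ((hi.const_mul (U₁ x)).mul_const (V₂ y)).mono' ?_ (Eventually.of_forall fun z => ?_)
  · exact (h₁.measurable.of_uncurry_left.mul h₂.measurable.of_uncurry_right).aestronglyMeasurable
  · rw [norm_mul]
    calc _ ≤ (U₁ x * V₁ z) * (U₂ z * V₂ y) := by
          gcongr
          · exact mul_nonneg (h₁.nonneg_left x) (h₁.nonneg_right z)
          · exact h₁.bound x z
          · exact h₂.bound z y
      _ = _ := by ring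

/-- The composition of two integral operators. -/
theorem comp (h₁ : HasWeightedKernel k₁ U₁ V₁ T₁) (h₂ : HasWeightedKernel k₂ U₂ V₂ T₂)
    (hi : Integrable fun z => V₁ z * U₂ z) :
    HasWeightedKernel (kernelComp k₁ k₂) (fun x => U₁ x * ∫ z, V₁ z * U₂ z) V₂ (T₁ ∘L T₂) where
  measurable := by
    refine (StronglyMeasurable.integral_prod_right (f := fun (q : ℝ × ℝ) z =>
      k₁ q.1 z * k₂ z q.2) ?_).measurable
    refine Measurable.stronglyMeasurable ?_
    exact (h₁.measurable.comp ((measurable_fst.comp measurable_fst).prodMk measurable_snd)).mul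
      (h₂.measurable.comp (measurable_snd.prodMk (measurable_snd.comp measurable_fst)))
  nonneg_left x := mul_nonneg (h₁.nonneg_left x)
    (integral_nonneg fun z => mul_nonneg (h₁.nonneg_right z) (h₂.nonneg_left z))
  measurable_right := h₂.measurable_right
  nonneg_right := h₂.nonneg_right
  bound x y := by
    rw [kernelComp, ← Real.norm_eq_abs]
    refine (norm_integral_le_of_norm_le ((hi.const_mul (U₁ x)).mul_const (V₂ y))
      (Eventually.of_forall fun z => ?_)).trans (le_of_eq ?_)
    · rw [norm_mul]
      calc _ ≤ (U₁ x * V₁ z) * (U₂ z * V₂ y) := by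
            gcongr
            · exact mul_nonneg (h₁.nonneg_left x) (h₁.nonneg_right z)
            · exact h₁.bound x z
            · exact h₂.bound z y
        _ = _ := by ring
    · rw [integral_mul_const, integral_const_mul]
  coeFn_apply F hF := by
    have hFm := Lp.stronglyMeasurable F
    set J : ℝ := ∫ y, V₂ y * ‖F y‖
    have e₂ := h₂.coeFn_apply F hF
    have hi₂ : Integrable fun z => V₁ z * ‖∫ y, k₂ z y • F y‖ := by
      refine (hi.mul_const J).mono' ?_ (Eventually.of_forall fun z => ?_)
      · have hm : StronglyMeasurable fun z => ∫ y, k₂ z y • F y :=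
          StronglyMeasurable.integral_prod_right (f := fun z y => k₂ z y • F y)
            (h₂.measurable.stronglyMeasurable.smul (hFm.comp_measurable measurable_snd))
        exact (h₁.measurable_right.stronglyMeasurable.mul hm.norm).aestronglyMeasurable
      · rw [norm_mul, norm_norm, Real.norm_eq_abs, abs_of_nonneg (h₁.nonneg_right z), mul_assoc]
        gcongr
        · exact h₁.nonneg_right z
        · exact h₂.norm_integral_le hF z
    have e₁ := h₁.coeFn_apply (T₂ F) (hi₂.congr (by filter_upwards [e₂] with z hz; rw [hz]))
    filter_upwards [e₁] with x hx
    rw [ContinuousLinearMap.comp_apply, hx]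
    have hprod : Integrable (fun p : ℝ × ℝ => (k₁ x p.1 * k₂ p.1 p.2) • F p.2)
        (volume.prod volume) := by
      refine ((hi.const_mul (U₁ x)).mul_prod hF).mono' ?_ (Eventually.of_forall fun p => ?_)
      · have hm : Measurable fun p : ℝ × ℝ => k₁ x p.1 * k₂ p.1 p.2 :=
          (h₁.measurable.of_uncurry_left.comp measurable_fst).mul h₂.measurable
        exact (hm.stronglyMeasurable.smul (hFm.comp_measurable measurable_snd)).aestronglyMeasurable
      · rw [norm_smul, norm_mul]
        calc _ ≤ (U₁ x * V₁ p.1) * (U₂ p.1 * V₂ p.2) * ‖F p.2‖ := by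
              gcongr
              · exact mul_nonneg (h₁.nonneg_left x) (h₁.nonneg_right _)
              · exact h₁.bound x _
              · exact h₂.bound _ _
          _ = _ := by ring
    calc ∫ z, k₁ x z • (T₂ F) z = ∫ z, ∫ y, (k₁ x z * k₂ z y) • F y := by
          refine integral_congr_ae ?_
          filter_upwards [e₂] with z hz
          rw [hz, ← integral_smul]
          simp_rw [smul_smul]
      _ = ∫ y, ∫ z, (k₁ x z * k₂ z y) • F y := integral_integral_swap hprod
      _ = _ := by
          refine integral_congr_ae (Eventually.of_forall fun y => ?_)
          exact integral_smul_const _ _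

/-- Cutting off the output variable. -/
theorem cut (h : HasWeightedKernel k U V T) :
    HasWeightedKernel (fun x y => (Set.Iic (0 : ℝ)).indicator (fun x => k x y) x)
      ((Set.Iic (0 : ℝ)).indicator U) V (cutOp ∘L T) where
  measurable := by
    have := h.measurable.indicator (s := {p : ℝ × ℝ | p.1 ∈ Set.Iic (0 : ℝ)})
      (measurable_fst measurableSet_Iic)
    convert this using 1
    ext p
    by_cases hp : p.1 ≤ 0 <;> simp [Function.uncurry, hp]
  measurable_right := h.measurable_right
  nonneg_left x := Set.indicator_nonneg (fun x _ => h.nonneg_left x) x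
  nonneg_right := h.nonneg_right
  bound x y := by
    by_cases hx : x ∈ Set.Iic (0 : ℝ)
    · rw [Set.indicator_of_mem hx, Set.indicator_of_mem hx]
      exact h.bound x y
    · rw [Set.indicator_of_notMem hx, Set.indicator_of_notMem hx]
      simp
  coeFn_apply F hF := by
    filter_upwards [coeFn_cutOp (T F), h.coeFn_apply F hF] with x h1 h2
    rw [ContinuousLinearMap.comp_apply, h1]
    by_cases hx : x ∈ Set.Iic (0 : ℝ)
    · rw [Set.indicator_of_mem hx, h2]
      simp only [Set.indicator_of_mem hx]
    · rw [Set.indicator_of_notMem hx]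
      simp only [Set.indicator_of_notMem hx, zero_smul, integral_zero]

end HasWeightedKernel

/-! ### The operators -/

/-- The operator `P̄₀ A*`. -/
def airyCut : L2 →L[ℂ] L2 := cutOp ∘L ContinuousLinearMap.adjoint airyA

lemma adjoint_airyCut : ContinuousLinearMap.adjoint airyCut = airyA ∘L cutOp := by
  rw [airyCut, ContinuousLinearMap.adjoint_comp, ContinuousLinearMap.adjoint_adjoint,
    adjoint_cutOp]

lemma airyCut_comp_adjoint : airyCut ∘L ContinuousLinearMap.adjoint airyCut = cutOp := by
  rw [adjoint_airyCut, airyCut]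
  change cutOp * ContinuousLinearMap.adjoint airyA * (airyA * cutOp) = cutOp
  have h1 : ContinuousLinearMap.adjoint airyA * airyA = 1 := adjoint_airyA_comp_airyA
  have h2 : cutOp * cutOp = cutOp := cutOp_comp_cutOp
  rw [mul_assoc, ← mul_assoc _ airyA, h1, one_mul, h2]

lemma hasWeightedKernel_adjoint_airyA : HasWeightedKernel (fun l y => airyAi (y - l))
    (fun l => Real.exp (l / 8)) (fun y => 2 * Real.exp (-y / 8))
    (ContinuousLinearMap.adjoint airyA) :=
  hasTestKernel_airyA.adjoint.hasWeightedKernel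

lemma hasWeightedKernel_airyCut : HasWeightedKernel
    (fun l y => (Set.Iic (0 : ℝ)).indicator (fun l => airyAi (y - l)) l)
    ((Set.Iic (0 : ℝ)).indicator fun l => Real.exp (l / 8)) (fun y => 2 * Real.exp (-y / 8))
    airyCut := hasWeightedKernel_adjoint_airyA.cut

lemma integrable_exp_mul_indicator {a b : ℝ} (hab : 0 < a + b) :
    Integrable fun l => Real.exp (a * l) * (Set.Iic (0 : ℝ)).indicator (fun l => Real.exp (b * l)) l := by
  have h : Integrable ((Set.Iic (0 : ℝ)).indicator fun l => Real.exp ((a + b) * l)) :=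
    (integrable_indicator_iff measurableSet_Iic).2 (integrableOn_exp_mul_Iic hab 0)
  refine h.congr (Eventually.of_forall fun l => ?_)
  simp only
  by_cases hl : l ∈ Set.Iic (0 : ℝ)
  · rw [Set.indicator_of_mem hl, Set.indicator_of_mem hl, ← Real.exp_add, add_mul]
  · rw [Set.indicator_of_notMem hl, Set.indicator_of_notMem hl, mul_zero]

/-- The Airy kernel is the kernel of `A P̄₀ A*`. -/
lemma hasWeightedKernel_airyKernel : HasWeightedKernel airyKernel
    (fun x => 2 * Real.exp (-x / 8) * ∫ l, Real.exp (l / 8) *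
      (Set.Iic (0 : ℝ)).indicator (fun l => Real.exp (l / 8)) l)
    (fun y => 2 * Real.exp (-y / 8)) (airyA ∘L airyCut) := by
  have h := hasTestKernel_airyA.hasWeightedKernel.comp hasWeightedKernel_airyCut (by
    have := integrable_exp_mul_indicator (a := 1 / 8) (b := 1 / 8) (by norm_num)
    simpa only [one_div, inv_mul_eq_div] using this)
  convert h using 1
  ext x y
  rw [airyKernel, kernelComp, ← integral_indicator measurableSet_Iic]
  refine integral_congr_ae (Eventually.of_forall fun l => ?_)
  simp only [airyTransformKernel]
  by_cases hl : l ∈ Set.Iic (0 : ℝ)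
  · rw [Set.indicator_of_mem hl, Set.indicator_of_mem hl]
  · rw [Set.indicator_of_notMem hl, Set.indicator_of_notMem hl, mul_zero]

lemma airyOp_eq : airyOp = airyA ∘L airyCut :=
  (hasWeightedKernel_airyKernel.hasKernel (by fun_prop)).kernelOp_eq

lemma airyKernel_comm (x y : ℝ) : airyKernel x y = airyKernel y x := by
  unfold airyKernel
  simp_rw [mul_comm]

section Brownian

variable {Ω : Type*} [MeasurableSpace Ω] {P : Measure Ω} {W : ℝ≥0 → Ω → ℝ} {g : ℝ → EReal}

/-- The kernel of the hitting term of `P̄₀ Ψ`. -/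
def hitCut (P : Measure Ω) (W : ℝ≥0 → Ω → ℝ) (g : ℝ → EReal) (l y : ℝ) : ℝ :=
  (Set.Iic (0 : ℝ)).indicator (fun l => hitKernel P W g l y) l

lemma measurable_hitCut [IsProbabilityMeasure P] (hW : IsContBM W P) (hg : GoodBarrier g) :
    Measurable (Function.uncurry (hitCut P W g)) := by
  have := (measurable_hitKernel hW hg).indicator (s := {p : ℝ × ℝ | p.1 ∈ Set.Iic (0 : ℝ)})
    (measurable_fst measurableSet_Iic)
  convert this using 1
  ext p
  by_cases hp : p.1 ≤ 0 <;> simp [Function.uncurry, hp, hitCut]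

/-- The weight bounding the hitting kernels in the first variable. -/
def hitWeight (C l : ℝ) : ℝ := 2 * C * (Set.Iic (0 : ℝ)).indicator Real.exp l

lemma hitWeight_nonneg {C : ℝ} (hC : 0 ≤ C) (l : ℝ) : 0 ≤ hitWeight C l :=
  mul_nonneg (by positivity) (Set.indicator_nonneg (fun _ _ => (Real.exp_pos _).le) l)

lemma memLp_hitWeight (C : ℝ) : MemLp (hitWeight C) 2 := memLp_indicator_exp.const_mul _

lemma measurable_hitWeight (C : ℝ) : Measurable (hitWeight C) :=
  (Measurable.indicator (by fun_prop) measurableSet_Iic).const_mul _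

lemma memLp_exp_neg_mul_abs {a : ℝ} (ha : 0 < a) : MemLp (fun y : ℝ => Real.exp (-(a * |y|))) 2 := by
  rw [memLp_two_iff_integrable_sq (by fun_prop)]
  refine (integrable_exp_neg_mul_abs (a := 2 * a) (by positivity)).congr
    (Eventually.of_forall fun y => ?_)
  simp only
  rw [← Real.exp_nat_mul]
  congr 1
  push_cast
  ring

lemma IsContBM.abs_hitCut_le [IsProbabilityMeasure P] (hW : IsContBM W P) (hg : GoodBarrier g)
    {c κ C : ℝ} (hC : IsHitBound c κ C) (h : AboveParabola c κ g) (l y : ℝ) :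
    |hitCut P W g l y| ≤ hitWeight C l * Real.exp (-(1 / 2 * |y|)) := by
  unfold hitCut hitWeight
  by_cases hl : l ∈ Set.Iic (0 : ℝ)
  · rw [Set.indicator_of_mem hl, Set.indicator_of_mem hl]
    refine (hW.abs_hitKernel_le hg hC h hl y).trans (le_of_eq ?_)
    rw [sub_eq_add_neg, Real.exp_add, show -(|y| / 2) = -(1 / 2 * |y|) by ring]
    ring
  · rw [Set.indicator_of_notMem hl, Set.indicator_of_notMem hl]
    simp

lemma IsContBM.isDominatedKernel_hitCut [IsProbabilityMeasure P] (hW : IsContBM W P)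
    (hg : GoodBarrier g) {c κ C : ℝ} (hC : IsHitBound c κ C) (h : AboveParabola c κ g) :
    IsDominatedKernel (hitCut P W g) (hitWeight C) (fun y => Real.exp (-(1 / 2 * |y|))) where
  measurable := measurable_hitCut hW hg
  left := memLp_hitWeight C
  right := memLp_exp_neg_mul_abs (by norm_num)
  bound := hW.abs_hitCut_le hg hC h

/-- The operator `P̄₀ Ψ`. -/
lemma IsContBM.hasKernel_cutPsiKernel [IsProbabilityMeasure P] (hW : IsContBM W P)
    (hg : GoodBarrier g) {c κ C : ℝ} (hC : IsHitBound c κ C) (h : AboveParabola c κ g) :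
    HasKernel (cutPsiKernel P W g) (airyCut - (hW.isDominatedKernel_hitCut hg hC h).op) := by
  have h1 := (hasWeightedKernel_airyCut.hasKernel (by fun_prop)).sub
    (hW.isDominatedKernel_hitCut hg hC h).hasKernel_op
  convert h1 using 1
  ext l y
  rw [cutPsiKernel_eq hW, hitCut]
  by_cases hl : l ∈ Set.Iic (0 : ℝ)
  · simp only [Set.indicator_of_mem hl]
  · simp only [Set.indicator_of_notMem hl, sub_zero]

lemma integrable_exp_mul_hitWeight (C : ℝ) : Integrable fun l => Real.exp (l / 8) * hitWeight C l := by
  have h := (integrable_exp_mul_indicator (a := 1 / 8) (b := 1) (by norm_num)).const_mul (2 * C)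
  refine h.congr (Eventually.of_forall fun l => ?_)
  simp only [hitWeight, one_mul]
  rw [show 1 / 8 * l = l / 8 by ring]
  ring

lemma IsContBM.hasWeightedKernel_hitFlow [IsProbabilityMeasure P] (hW : IsContBM W P)
    (hg : GoodBarrier g) {c κ C : ℝ} (hC : IsHitBound c κ C) (h : AboveParabola c κ g) :
    HasWeightedKernel (hitFlow P W g)
      (fun x => 2 * Real.exp (-x / 8) * ∫ l, Real.exp (l / 8) * hitWeight C l)
      (fun y => Real.exp (-(1 / 2 * |y|)))
      (airyA ∘L (hW.isDominatedKernel_hitCut hg hC h).op) := by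
  have h1 := hasTestKernel_airyA.hasWeightedKernel.comp
    ((hW.isDominatedKernel_hitCut hg hC h).hasWeightedKernel (hitWeight_nonneg hC.pos.le)
      (by fun_prop) fun _ => (Real.exp_pos _).le) (integrable_exp_mul_hitWeight C)
  convert h1 using 1
  ext x y
  rw [hitFlow, kernelComp, ← integral_indicator measurableSet_Iic]
  refine integral_congr_ae (Eventually.of_forall fun l => ?_)
  simp only [airyTransformKernel, hitCut]
  by_cases hl : l ∈ Set.Iic (0 : ℝ)
  · rw [Set.indicator_of_mem hl, Set.indicator_of_mem hl]
  · rw [Set.indicator_of_notMem hl, Set.indicator_of_notMem hl, mul_zero]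

lemma IsContBM.hasWeightedKernel_hitFlow_swap [IsProbabilityMeasure P] (hW : IsContBM W P)
    (hg : GoodBarrier g) {c κ C : ℝ} (hC : IsHitBound c κ C) (h : AboveParabola c κ g) :
    HasWeightedKernel (fun z y => hitFlow P W g y z)
      (fun z => Real.exp (-(1 / 2 * |z|)) * ∫ l, hitWeight C l * Real.exp (l / 8))
      (fun y => 2 * Real.exp (-y / 8))
      (ContinuousLinearMap.adjoint (hW.isDominatedKernel_hitCut hg hC h).op ∘L
        ContinuousLinearMap.adjoint airyA) := by
  rw [IsDominatedKernel.adjoint_op]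
  have h1 := ((hW.isDominatedKernel_hitCut hg hC h).swap.hasWeightedKernel
      (fun _ => (Real.exp_pos _).le) (measurable_hitWeight C)
      (hitWeight_nonneg hC.pos.le)).comp hasWeightedKernel_adjoint_airyA (by
        simpa only [mul_comm] using integrable_exp_mul_hitWeight C)
  convert h1 using 1
  ext z y
  rw [hitFlow, kernelComp, ← integral_indicator measurableSet_Iic]
  refine integral_congr_ae (Eventually.of_forall fun l => ?_)
  simp only [hitCut]
  by_cases hl : l ∈ Set.Iic (0 : ℝ)
  · rw [Set.indicator_of_mem hl, Set.indicator_of_mem hl, mul_comm]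
  · rw [Set.indicator_of_notMem hl, Set.indicator_of_notMem hl, zero_mul]

lemma integrable_exp_abs_mul_exp (K K' : ℝ) :
    Integrable fun z : ℝ => Real.exp (-(1 / 2 * |z|)) * (K * Real.exp (-z / 8) * K') := by
  refine ((integrable_exp_neg_mul_abs (a := 1 / 4) (by norm_num)).const_mul (|K| * |K'|)).mono'
    (by fun_prop) (Eventually.of_forall fun z => ?_)
  rw [norm_mul, norm_mul, norm_mul, Real.norm_eq_abs, Real.norm_eq_abs, Real.norm_eq_abs,
    Real.norm_eq_abs, abs_of_pos (Real.exp_pos _), abs_of_pos (Real.exp_pos _)]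
  have : Real.exp (-(1 / 2 * |z|)) * Real.exp (-z / 8) ≤ Real.exp (-(1 / 4 * |z|)) := by
    rw [← Real.exp_add, Real.exp_le_exp]
    have := neg_abs_le z
    have := abs_nonneg z
    linarith
  calc _ = |K| * |K'| * (Real.exp (-(1 / 2 * |z|)) * Real.exp (-z / 8)) := by ring
    _ ≤ _ := by gcongr

lemma expand_scattering {R : Type*} [Ring R] (A B B' p q A' : R) (e : B * B' * A' = B)
    (eSwap : B' * A' = A * B) : A * ((B - p) * (B' - q) * A') =
      A * B - A * p * (A * B) - A * B * (q * A') + A * p * (q * A') := by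
  calc _ = A * (B * B' * A') - A * p * (B' * A') - A * B * (q * A') + A * p * (q * A') := by
        noncomm_ring
    _ = _ := by rw [e, eSwap]

/-- The operator with kernel `e^{LH} K_Ai Θ e^{LH} K_Ai`. -/
theorem IsContBM.hasKernel_scatLKernel [IsProbabilityMeasure P] (hW : IsContBM W P)
    (hg : GoodBarrier g) {c κ C : ℝ} (hκ : 0 ≤ κ) (hC : IsHitBound c κ C) (h : AboveParabola c κ g)
    {L : ℝ} (hL : 0 < L) :
    HasKernel (scatLKernel P W g L) (airyA ∘L
      ((airyCut - (hW.isDominatedKernel_hitCut (hg.comp_neg.cutBarrier L) hC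
        (h.comp_neg.cutBarrier L)).op) ∘L
      ContinuousLinearMap.adjoint (airyCut - (hW.isDominatedKernel_hitCut (hg.cutBarrier L) hC
        (h.cutBarrier L)).op)) ∘L ContinuousLinearMap.adjoint airyA) := by
  have hm := hW.hasWeightedKernel_hitFlow (hg.comp_neg.cutBarrier L) hC (h.comp_neg.cutBarrier L)
  have hp := hW.hasWeightedKernel_hitFlow_swap (hg.cutBarrier L) hC (h.cutBarrier L)
  set p := (hW.isDominatedKernel_hitCut (hg.comp_neg.cutBarrier L) hC
    (h.comp_neg.cutBarrier L)).op
  set q := (hW.isDominatedKernel_hitCut (hg.cutBarrier L) hC (h.cutBarrier L)).op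
  have i1 := integrable_exp_abs_mul_exp 2 (∫ l, Real.exp (l / 8) *
      (Set.Iic (0 : ℝ)).indicator (fun l => Real.exp (l / 8)) l)
  have i2 : Integrable fun z : ℝ => 2 * Real.exp (-z / 8) *
      (Real.exp (-(1 / 2 * |z|)) * ∫ l, hitWeight C l * Real.exp (l / 8)) := by
    refine (integrable_exp_abs_mul_exp 2 (∫ l, hitWeight C l * Real.exp (l / 8))).congr
      (Eventually.of_forall fun z => ?_)
    simp only
    ring
  have i3 : Integrable fun z : ℝ => Real.exp (-(1 / 2 * |z|)) *
      (Real.exp (-(1 / 2 * |z|)) * ∫ l, hitWeight C l * Real.exp (l / 8)) := by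
    refine ((integrable_exp_neg_mul_abs (a := 1) (by norm_num)).mul_const
      (∫ l, hitWeight C l * Real.exp (l / 8))).congr (Eventually.of_forall fun z => ?_)
    simp only
    rw [← mul_assoc, ← Real.exp_add]
    congr 2
    ring
  have h1 := hm.comp hasWeightedKernel_airyKernel i1
  have h2 := hasWeightedKernel_airyKernel.comp hp i2
  have h3 := hm.comp hp i3
  have hk := ((hasWeightedKernel_airyKernel.hasKernel (by fun_prop)).sub
    (h1.hasKernel (by fun_prop))).sub (h2.hasKernel (by fun_prop)) |>.add
    (h3.hasKernel (by fun_prop))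
  convert hk using 1
  · ext x y
    rw [(hW.scatLKernel_eq hg hκ hC h hL).2 x y]
    have j1 := hm.integrable_mul hasWeightedKernel_airyKernel i1 x y
    have j2 := hasWeightedKernel_airyKernel.integrable_mul hp i2 x y
    have j3 := hm.integrable_mul hp i3 x y
    simp only [airyKernel_comm _ y] at j1
    refine (congrArg (airyKernel x y - ·) ((integral_sub (j1.add j2) j3).trans
      (congrArg (· - _) (integral_add j1 j2)))).trans ?_
    simp only [kernelComp, airyKernel_comm _ y]
    ring
  · have e : airyCut * ContinuousLinearMap.adjoint airyCut * ContinuousLinearMap.adjoint airyA =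
        airyCut := by
      change (airyCut ∘L ContinuousLinearMap.adjoint airyCut) ∘L
        ContinuousLinearMap.adjoint airyA = airyCut
      rw [airyCut_comp_adjoint]
      rfl
    have eSwap : ContinuousLinearMap.adjoint airyCut * ContinuousLinearMap.adjoint airyA =
        airyA * airyCut := by
      rw [adjoint_airyCut]
      rfl
    have ea : ContinuousLinearMap.adjoint (airyCut - q) =
        ContinuousLinearMap.adjoint airyCut - ContinuousLinearMap.adjoint q := map_sub _ _ _
    rw [ea]
    exact expand_scattering _ _ _ _ _ _ e eSwap

end Brownian

/-! ### Trace norm estimates -/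

lemma MemLp.lintegral_enorm_sq_lt_top {u : ℝ → ℝ} (hu : MemLp u 2) : ∫⁻ x, ‖u x‖ₑ ^ 2 < ∞ := by
  have := hu.integrable_sq.2
  rw [hasFiniteIntegral_iff_enorm] at this
  simpa only [enorm_pow] using this

lemma IsDominatedKernel.hsSq_op_le_mul {k : ℝ → ℝ → ℝ} {u v : ℝ → ℝ}
    (h : IsDominatedKernel k u v) :
    hsSq h.op ≤ (∫⁻ x, ‖u x‖ₑ ^ 2) * ∫⁻ y, ‖v y‖ₑ ^ 2 := by
  refine h.hsSq_op_le.trans ?_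
  have hb : ∀ x y, ‖k x y‖ₑ ^ 2 ≤ ‖u x‖ₑ ^ 2 * ‖v y‖ₑ ^ 2 := fun x y => by
    rw [← mul_pow, ← enorm_mul]
    gcongr
    rw [← ofReal_norm, ← ofReal_norm, Real.norm_eq_abs, Real.norm_eq_abs]
    exact ENNReal.ofReal_le_ofReal ((h.bound x y).trans (le_abs_self _))
  calc _ ≤ ∫⁻ x, ∫⁻ y, ‖u x‖ₑ ^ 2 * ‖v y‖ₑ ^ 2 := by
        gcongr with x y
        exact hb x y
    _ = _ := by
        simp_rw [lintegral_const_mul' _ _ (ENNReal.pow_ne_top enorm_ne_top)]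
        rw [lintegral_mul_const' _ _ (MemLp.lintegral_enorm_sq_lt_top h.right).ne]

lemma IsDominatedKernel.hsSq_op_lt_top {k : ℝ → ℝ → ℝ} {u v : ℝ → ℝ}
    (h : IsDominatedKernel k u v) : hsSq h.op < ∞ :=
  h.hsSq_op_le_mul.trans_lt (ENNReal.mul_lt_top (MemLp.lintegral_enorm_sq_lt_top h.left)
    (MemLp.lintegral_enorm_sq_lt_top h.right))

/-- The operator `e^{-|y|/4} A P̄₀`. -/
def airyHS : L2 →L[ℂ] L2 := weightOp ∘L ContinuousLinearMap.adjoint airyCut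

lemma memLp_indicator_exp_div : MemLp ((Set.Iic (0 : ℝ)).indicator fun l => Real.exp (l / 8)) 2 := by
  have hm : Measurable ((Set.Iic (0 : ℝ)).indicator fun l => Real.exp (l / 8)) :=
    Measurable.indicator (by fun_prop) measurableSet_Iic
  rw [memLp_two_iff_integrable_sq hm.aestronglyMeasurable]
  have h1 : Integrable ((Set.Iic (0 : ℝ)).indicator fun l => Real.exp (1 / 4 * l)) :=
    (integrable_indicator_iff measurableSet_Iic).2 (integrableOn_exp_mul_Iic (by norm_num) 0)
  refine h1.congr (Eventually.of_forall fun l => ?_)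
  simp only
  by_cases hl : l ∈ Set.Iic (0 : ℝ)
  · rw [Set.indicator_of_mem hl, Set.indicator_of_mem hl, ← Real.exp_nat_mul]
    congr 1
    push_cast
    ring
  · rw [Set.indicator_of_notMem hl, Set.indicator_of_notMem hl]
    simp

lemma isDominatedKernel_airyHS : IsDominatedKernel
    (fun y l => Real.exp (-|y| / 4) * (Set.Iic (0 : ℝ)).indicator (fun l => airyAi (y - l)) l)
    (fun y => 2 * Real.exp (-(1 / 8 * |y|)))
    ((Set.Iic (0 : ℝ)).indicator fun l => Real.exp (l / 8)) where
  measurable := by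
    have h1 := hasWeightedKernel_airyCut.measurable.comp measurable_swap
    have h2 : Measurable fun p : ℝ × ℝ => Real.exp (-|p.1| / 4) := by fun_prop
    exact h2.mul h1
  left := (memLp_exp_neg_mul_abs (by norm_num)).const_mul 2
  right := memLp_indicator_exp_div
  bound y l := by
    rw [abs_mul, abs_of_pos (Real.exp_pos _)]
    refine (mul_le_mul_of_nonneg_left (hasWeightedKernel_airyCut.bound l y)
      (Real.exp_pos _).le).trans ?_
    have h1 : Real.exp (-|y| / 4) * Real.exp (-y / 8) ≤ Real.exp (-(1 / 8 * |y|)) := by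
      rw [← Real.exp_add, Real.exp_le_exp]
      linarith [neg_abs_le y]
    have h2 : 0 ≤ (Set.Iic (0 : ℝ)).indicator (fun l => Real.exp (l / 8)) l :=
      Set.indicator_nonneg (fun _ _ => (Real.exp_pos _).le) l
    calc _ = 2 * (Real.exp (-|y| / 4) * Real.exp (-y / 8)) *
          (Set.Iic (0 : ℝ)).indicator (fun l => Real.exp (l / 8)) l := by ring
      _ ≤ _ := by gcongr

lemma airyHS_eq : airyHS = isDominatedKernel_airyHS.op := by
  ext1 F
  ext1
  have hi : Integrable fun l => Real.exp (l / 8) * ‖cutOp F l‖ := by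
    have h1 := (memLp_indicator_exp_div.integrable_mul (Lp.memLp F).norm)
    refine h1.congr ?_
    filter_upwards [coeFn_cutOp F] with l hl
    rw [hl, Pi.mul_apply]
    by_cases h : l ∈ Set.Iic (0 : ℝ)
    · rw [Set.indicator_of_mem h, Set.indicator_of_mem h]
    · rw [Set.indicator_of_notMem h, Set.indicator_of_notMem h]
      simp
  rw [airyHS, adjoint_airyCut, ContinuousLinearMap.comp_apply, ContinuousLinearMap.comp_apply]
  filter_upwards [coeFn_weightOp (airyA (cutOp F)), hasTestKernel_airyA.coeFn_apply (cutOp F) hi,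
    isDominatedKernel_airyHS.coeFn_op F] with y h1 h2 h3
  rw [h1, h2, h3, ← integral_smul]
  refine integral_congr_ae ?_
  filter_upwards [coeFn_cutOp F] with l hl
  rw [hl, smul_smul, airyTransformKernel]
  by_cases h : l ∈ Set.Iic (0 : ℝ)
  · rw [Set.indicator_of_mem h, Set.indicator_of_mem h]
  · rw [Set.indicator_of_notMem h, Set.indicator_of_notMem h]
    simp

lemma hsSq_airyHS_lt_top : hsSq airyHS < ∞ := by
  rw [airyHS_eq]
  exact isDominatedKernel_airyHS.hsSq_op_lt_top

lemma norm_weightOp_le : ‖weightOp‖ ≤ 1 := norm_mulOp_le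

lemma scattering_sub_scattering {R : Type*} [Ring R] (A A' B B' w w' ρ ρ₂ σ σ₂ : R) :
    A * (((B - ρ₂ * w) * (B' - w' * σ₂) - (B - ρ * w) * (B' - w' * σ)) * A') =
      A * (ρ - ρ₂) * (w * B' * A') + A * (B * w') * ((σ - σ₂) * A') -
        A * ((ρ - ρ₂) * w) * (w' * σ * A') - A * (ρ₂ * w) * (w' * (σ - σ₂) * A') := by
  noncomm_ring

/-- The operator `(P̄₀ A* - p) (P̄₀ A* - q)*` in Airy transformed variables. -/
def scatteringOp (p q : L2 →L[ℂ] L2) : L2 →L[ℂ] L2 :=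
  airyA ∘L ((airyCut - p) ∘L ContinuousLinearMap.adjoint (airyCut - q)) ∘L
    ContinuousLinearMap.adjoint airyA

lemma nuclearBound_scatteringOp_sub (ρ σ ρ' σ' : L2 →L[ℂ] L2) :
    NuclearBound (scatteringOp (ρ' ∘L weightOp) (σ' ∘L weightOp) -
        scatteringOp (ρ ∘L weightOp) (σ ∘L weightOp))
      (hsSq (ρ - ρ') ^ (1 / 2 : ℝ) * hsSq airyHS ^ (1 / 2 : ℝ) +
        hsSq airyHS ^ (1 / 2 : ℝ) * hsSq (σ - σ') ^ (1 / 2 : ℝ) +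
        hsSq (ρ - ρ') ^ (1 / 2 : ℝ) * hsSq σ ^ (1 / 2 : ℝ) +
        hsSq ρ' ^ (1 / 2 : ℝ) * hsSq (σ - σ') ^ (1 / 2 : ℝ)) := by
  have ad : ∀ τ : L2 →L[ℂ] L2, ContinuousLinearMap.adjoint (airyCut - τ ∘L weightOp) =
      ContinuousLinearMap.adjoint airyCut -
        ContinuousLinearMap.adjoint weightOp * ContinuousLinearMap.adjoint τ := fun τ => by
    rw [map_sub, ContinuousLinearMap.adjoint_comp]
    rfl
  have e : scatteringOp (ρ' ∘L weightOp) (σ' ∘L weightOp) -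
      scatteringOp (ρ ∘L weightOp) (σ ∘L weightOp) =
      (airyA ∘L (ρ - ρ')) ∘L (airyHS ∘L ContinuousLinearMap.adjoint airyA) +
      (airyA ∘L ContinuousLinearMap.adjoint airyHS) ∘L
        (ContinuousLinearMap.adjoint (σ - σ') ∘L ContinuousLinearMap.adjoint airyA) -
      (airyA ∘L ((ρ - ρ') ∘L weightOp)) ∘L
        (ContinuousLinearMap.adjoint (σ ∘L weightOp) ∘L ContinuousLinearMap.adjoint airyA) -
      (airyA ∘L (ρ' ∘L weightOp)) ∘L
        (ContinuousLinearMap.adjoint ((σ - σ') ∘L weightOp) ∘L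
          ContinuousLinearMap.adjoint airyA) := by
    have h := scattering_sub_scattering airyA (ContinuousLinearMap.adjoint airyA) airyCut
      (ContinuousLinearMap.adjoint airyCut) weightOp (ContinuousLinearMap.adjoint weightOp) ρ ρ'
      (ContinuousLinearMap.adjoint σ) (ContinuousLinearMap.adjoint σ')
    have e1 : ContinuousLinearMap.adjoint airyHS =
        airyCut * ContinuousLinearMap.adjoint weightOp := by
      rw [airyHS, ContinuousLinearMap.adjoint_comp, ContinuousLinearMap.adjoint_adjoint]
      rfl
    have e2 : ContinuousLinearMap.adjoint (σ - σ') =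
        ContinuousLinearMap.adjoint σ - ContinuousLinearMap.adjoint σ' := map_sub _ _ _
    rw [e1, ContinuousLinearMap.adjoint_comp, ContinuousLinearMap.adjoint_comp, e2, scatteringOp,
      scatteringOp, ad, ad]
    rw [sub_mul, mul_sub] at h
    exact h
  have half : (0 : ℝ) ≤ 1 / 2 := by norm_num
  have hA := norm_airyA_le
  have hA' := norm_adjoint_airyA_le
  have hw := norm_weightOp_le
  have hadj : ∀ τ : L2 →L[ℂ] L2, hsSq (ContinuousLinearMap.adjoint τ ∘L
      ContinuousLinearMap.adjoint airyA) ≤ hsSq τ := fun τ =>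
    (hsSq_comp_le_right _ _ hA').trans (hsSq_adjoint τ).le
  have hadjw : ∀ τ : L2 →L[ℂ] L2, hsSq (ContinuousLinearMap.adjoint (τ ∘L weightOp) ∘L
      ContinuousLinearMap.adjoint airyA) ≤ hsSq τ := fun τ =>
    (hadj _).trans (hsSq_comp_le_right _ _ hw)
  have hAw : ∀ τ : L2 →L[ℂ] L2, hsSq (airyA ∘L (τ ∘L weightOp)) ≤ hsSq τ := fun τ =>
    (hsSq_comp_le_left _ _ hA).trans (hsSq_comp_le_right _ _ hw)
  have mul_mono : ∀ {a b c d : ℝ≥0∞}, a ≤ c → b ≤ d →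
      a ^ (1 / 2 : ℝ) * b ^ (1 / 2 : ℝ) ≤ c ^ (1 / 2 : ℝ) * d ^ (1 / 2 : ℝ) := fun h1 h2 =>
    mul_le_mul' (ENNReal.rpow_le_rpow h1 half) (ENNReal.rpow_le_rpow h2 half)
  rw [e]
  refine ((NuclearBound.add ?_ ?_).sub ?_).sub ?_
  · exact (nuclearBound_comp _ _).mono (mul_mono (hsSq_comp_le_left _ _ hA)
      (hsSq_comp_le_right _ _ hA'))
  · exact (nuclearBound_comp _ _).mono (mul_mono
      ((hsSq_comp_le_left _ _ hA).trans (hsSq_adjoint _).le) (hadj _))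
  · exact (nuclearBound_comp _ _).mono (mul_mono (hAw _) (hadjw _))
  · exact (nuclearBound_comp _ _).mono (mul_mono (hAw _) (hadjw _))

lemma airyOp_eq_scatteringOp : airyOp = scatteringOp (0 ∘L weightOp) (0 ∘L weightOp) := by
  rw [airyOp_eq, scatteringOp, ContinuousLinearMap.zero_comp, sub_zero, airyCut_comp_adjoint,
    airyCut]

lemma hsSq_zero : hsSq (0 : L2 →L[ℂ] L2) = 0 := by simp [hsSq]

section Brownian

variable {Ω : Type*} [MeasurableSpace Ω] {P : Measure Ω} {W : ℝ≥0 → Ω → ℝ} {g : ℝ → EReal}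

lemma IsContBM.isDominatedKernel_weightedHit [IsProbabilityMeasure P] (hW : IsContBM W P)
    (hg : GoodBarrier g) {c κ C : ℝ} (hC : IsHitBound c κ C) (h : AboveParabola c κ g) :
    IsDominatedKernel (fun l y => Real.exp (1 / 4 * |y|) * hitCut P W g l y) (hitWeight C)
      (fun y => Real.exp (-(1 / 4 * |y|))) where
  measurable := by
    have h2 : Measurable fun p : ℝ × ℝ => Real.exp (1 / 4 * |p.2|) := by fun_prop
    exact h2.mul (measurable_hitCut hW hg)
  left := memLp_hitWeight C
  right := memLp_exp_neg_mul_abs (by norm_num)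
  bound l y := by
    rw [abs_mul, abs_of_pos (Real.exp_pos _)]
    refine (mul_le_mul_of_nonneg_left (hW.abs_hitCut_le hg hC h l y)
      (Real.exp_pos _).le).trans (le_of_eq ?_)
    rw [mul_left_comm, ← Real.exp_add]
    congr 2
    ring

lemma IsContBM.hitCut_op_eq [IsProbabilityMeasure P] (hW : IsContBM W P)
    (hg : GoodBarrier g) {c κ C : ℝ} (hC : IsHitBound c κ C) (h : AboveParabola c κ g) :
    (hW.isDominatedKernel_hitCut hg hC h).op =
      (hW.isDominatedKernel_weightedHit hg hC h).op ∘L weightOp := by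
  ext1 F
  ext1
  rw [ContinuousLinearMap.comp_apply]
  filter_upwards [(hW.isDominatedKernel_hitCut hg hC h).coeFn_op F,
    (hW.isDominatedKernel_weightedHit hg hC h).coeFn_op (weightOp F)] with l h1 h2
  rw [h1, h2]
  refine integral_congr_ae ?_
  filter_upwards [coeFn_weightOp F] with y hy
  rw [hy, smul_smul, mul_right_comm, ← Real.exp_add,
    show 1 / 4 * |y| + -|y| / 4 = 0 by ring, Real.exp_zero, one_mul]

lemma IsContBM.tendsto_hsSq_weightedHit [IsProbabilityMeasure P] (hW : IsContBM W P)
    (hg : GoodBarrier g) {c κ C : ℝ} (hC : IsHitBound c κ C) (h : AboveParabola c κ g) :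
    Tendsto (fun L : ℝ => hsSq ((hW.isDominatedKernel_weightedHit (hg.cutBarrier L) hC
      (h.cutBarrier L)).op - (hW.isDominatedKernel_weightedHit hg hC h).op)) atTop (𝓝 0) := by
  set k : ℝ → ℝ → ℝ → ℝ := fun L l y => Real.exp (1 / 4 * |y|) * hitCut P W (cutBarrier L g) l y -
    Real.exp (1 / 4 * |y|) * hitCut P W g l y with hk
  have hd : ∀ L, IsDominatedKernel (k L) (fun l => 2 * hitWeight C l)
      (fun y => Real.exp (-(1 / 4 * |y|))) := fun L =>
    { measurable := (hW.isDominatedKernel_weightedHit (hg.cutBarrier L) hC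
        (h.cutBarrier L)).measurable.sub (hW.isDominatedKernel_weightedHit hg hC h).measurable
      left := (memLp_hitWeight C).const_mul 2
      right := memLp_exp_neg_mul_abs (by norm_num)
      bound := fun l y => by
        have h1 := (hW.isDominatedKernel_weightedHit (hg.cutBarrier L) hC (h.cutBarrier L)).bound l y
        have h2 := (hW.isDominatedKernel_weightedHit hg hC h).bound l y
        refine (abs_sub _ _).trans ?_
        linarith }
  have hle : ∀ L, hsSq ((hW.isDominatedKernel_weightedHit (hg.cutBarrier L) hC
      (h.cutBarrier L)).op - (hW.isDominatedKernel_weightedHit hg hC h).op) ≤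
      ∫⁻ p : ℝ × ℝ, ‖k L p.1 p.2‖ₑ ^ 2 ∂(volume.prod volume) := fun L => by
    rw [IsDominatedKernel.op_sub _ _ (hd L)]
    refine (hd L).hsSq_op_le.trans (le_of_eq ?_)
    have hm : Measurable fun p : ℝ × ℝ => ‖k L p.1 p.2‖ₑ ^ 2 :=
      (hd L).measurable.enorm.pow_const 2
    rw [lintegral_prod (f := fun p : ℝ × ℝ => ‖k L p.1 p.2‖ₑ ^ 2) hm.aemeasurable]
  refine tendsto_of_tendsto_of_tendsto_of_le_of_le tendsto_const_nhds ?_ (fun _ => zero_le) hle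
  set b : ℝ × ℝ → ℝ≥0∞ := fun p => ‖2 * hitWeight C p.1‖ₑ ^ 2 *
    ‖Real.exp (-(1 / 4 * |p.2|))‖ₑ ^ 2 with hb
  have hlim := tendsto_lintegral_filter_of_dominated_convergence (μ := volume.prod volume)
    (l := atTop) (F := fun (L : ℝ) (p : ℝ × ℝ) => ‖k L p.1 p.2‖ₑ ^ 2) (f := fun _ => 0) b
    (Eventually.of_forall fun L => (hd L).measurable.enorm.pow_const 2)
    (Eventually.of_forall fun L => Eventually.of_forall fun p => by
      change ‖k L p.1 p.2‖ₑ ^ 2 ≤ ‖2 * hitWeight C p.1‖ₑ ^ 2 *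
        ‖Real.exp (-(1 / 4 * |p.2|))‖ₑ ^ 2
      rw [← mul_pow, ← enorm_mul]
      gcongr
      rw [← ofReal_norm, ← ofReal_norm, Real.norm_eq_abs, Real.norm_eq_abs]
      exact ENNReal.ofReal_le_ofReal (((hd L).bound p.1 p.2).trans (le_abs_self _)))
    (by
      rw [lintegral_prod_mul (f := fun l => ‖2 * hitWeight C l‖ₑ ^ 2)
        (g := fun y : ℝ => ‖Real.exp (-(1 / 4 * |y|))‖ₑ ^ 2)
        (((measurable_hitWeight C).const_mul 2).enorm.pow_const 2).aemeasurable
        (by fun_prop)]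
      exact (ENNReal.mul_lt_top (MemLp.lintegral_enorm_sq_lt_top (hd 0).left)
        (MemLp.lintegral_enorm_sq_lt_top (hd 0).right)).ne)
    (Eventually.of_forall fun p => by
      have h1 : Tendsto (fun L => hitCut P W (cutBarrier L g) p.1 p.2) atTop
          (𝓝 (hitCut P W g p.1 p.2)) := by
        unfold hitCut
        by_cases hl : p.1 ∈ Set.Iic (0 : ℝ)
        · simp only [Set.indicator_of_mem hl]
          exact tendsto_hitKernel_cutBarrier hW hg hC h hl p.2
        · simp only [Set.indicator_of_notMem hl]
          exact tendsto_const_nhds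
      have h2 : Tendsto (fun L => k L p.1 p.2) atTop (𝓝 0) := by
        have := ((h1.const_mul (Real.exp (1 / 4 * |p.2|))).sub_const
          (Real.exp (1 / 4 * |p.2|) * hitCut P W g p.1 p.2))
        rwa [sub_self] at this
      have h3 := (ENNReal.continuous_pow 2).tendsto _ |>.comp ((continuous_enorm.tendsto _).comp h2)
      simpa [Function.comp_def] using h3)
  simpa using hlim

end Brownian

section Brownian

variable {Ω : Type*} [MeasurableSpace Ω] {P : Measure Ω} {W : ℝ≥0 → Ω → ℝ} {g : ℝ → EReal}

/-! ### Trace norm convergence -/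

lemma isTraceClass_airyOp_sub_scatteringOp {ρ σ : L2 →L[ℂ] L2} (hρ : hsSq ρ < ∞)
    (hσ : hsSq σ < ∞) :
    IsTraceClass (airyOp - scatteringOp (ρ ∘L weightOp) (σ ∘L weightOp)) := by
  rw [airyOp_eq_scatteringOp]
  refine (nuclearBound_scatteringOp_sub ρ σ 0 0).traceNorm_le.trans_lt ?_
  simp only [sub_zero, hsSq_zero]
  have h1 := (ENNReal.rpow_lt_top_of_nonneg (by norm_num : (0 : ℝ) ≤ 1 / 2) hρ.ne)
  have h2 := (ENNReal.rpow_lt_top_of_nonneg (by norm_num : (0 : ℝ) ≤ 1 / 2) hσ.ne)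
  have h3 := (ENNReal.rpow_lt_top_of_nonneg (by norm_num : (0 : ℝ) ≤ 1 / 2) hsSq_airyHS_lt_top.ne)
  have h4 := (ENNReal.rpow_lt_top_of_nonneg (by norm_num : (0 : ℝ) ≤ 1 / 2) ENNReal.zero_ne_top)
  exact ENNReal.add_lt_top.2 ⟨ENNReal.add_lt_top.2 ⟨ENNReal.add_lt_top.2
    ⟨ENNReal.mul_lt_top h1 h3, ENNReal.mul_lt_top h3 h2⟩, ENNReal.mul_lt_top h1 h2⟩,
    ENNReal.mul_lt_top h4 h2⟩

lemma tendsto_traceNorm_scatteringOp_sub {ρ σ : ℝ → L2 →L[ℂ] L2} {ρ' σ' : L2 →L[ℂ] L2} {M : ℝ≥0∞}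
    (hM : M < ∞) (hσM : ∀ L, hsSq (σ L) ≤ M) (hρ' : hsSq ρ' < ∞)
    (hρ : Tendsto (fun L => hsSq (ρ L - ρ')) atTop (𝓝 0))
    (hσ : Tendsto (fun L => hsSq (σ L - σ')) atTop (𝓝 0)) :
    Tendsto (fun L => traceNorm (scatteringOp (ρ' ∘L weightOp) (σ' ∘L weightOp) -
      scatteringOp (ρ L ∘L weightOp) (σ L ∘L weightOp))) atTop (𝓝 0) := by
  have hhalf : (0 : ℝ) < 1 / 2 := by norm_num
  have hpow : ∀ {u : ℝ → ℝ≥0∞}, Tendsto u atTop (𝓝 0) →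
      Tendsto (fun L => u L ^ (1 / 2 : ℝ)) atTop (𝓝 0) := fun hu => by
    have := ((ENNReal.continuous_rpow_const (y := (1 / 2 : ℝ))).tendsto 0).comp hu
    rwa [ENNReal.zero_rpow_of_pos hhalf] at this
  have h1 := hpow hρ
  have h2 := hpow hσ
  have t1 := (ENNReal.rpow_lt_top_of_nonneg hhalf.le hM.ne).ne
  have t2 := (ENNReal.rpow_lt_top_of_nonneg hhalf.le hρ'.ne).ne
  have t3 := (ENNReal.rpow_lt_top_of_nonneg hhalf.le hsSq_airyHS_lt_top.ne).ne
  have hlim := (((ENNReal.Tendsto.mul_const h1 (Or.inr t3)).add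
    (ENNReal.Tendsto.const_mul h2 (Or.inr t3))).add
    (ENNReal.Tendsto.mul_const h1 (Or.inr t1))).add (ENNReal.Tendsto.const_mul h2 (Or.inr t2))
  simp only [zero_mul, mul_zero, add_zero] at hlim
  refine tendsto_of_tendsto_of_tendsto_of_le_of_le tendsto_const_nhds hlim (fun _ => zero_le)
    fun L => (nuclearBound_scatteringOp_sub (ρ L) (σ L) ρ' σ').traceNorm_le.trans ?_
  gcongr
  exact hσM L

/-- The factor of the hitting operator that remains after splitting off `e^{-|y|/4}`. -/
def IsContBM.hitHS [IsProbabilityMeasure P] (hW : IsContBM W P)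
    (hg : GoodBarrier g) {c κ C : ℝ} (hC : IsHitBound c κ C) (h : AboveParabola c κ g) :
    L2 →L[ℂ] L2 :=
  (hW.isDominatedKernel_weightedHit hg hC h).op

lemma IsContBM.kernelOp_scatLKernel [IsProbabilityMeasure P] (hW : IsContBM W P)
    (hg : GoodBarrier g) {c κ C : ℝ} (hκ : 0 ≤ κ) (hC : IsHitBound c κ C) (h : AboveParabola c κ g)
    {L : ℝ} (hL : 0 < L) :
    kernelOp (scatLKernel P W g L) = scatteringOp
      (hW.hitHS (hg.comp_neg.cutBarrier L) hC (h.comp_neg.cutBarrier L) ∘L weightOp)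
      (hW.hitHS (hg.cutBarrier L) hC (h.cutBarrier L) ∘L weightOp) := by
  rw [(hW.hasKernel_scatLKernel hg hκ hC h hL).kernelOp_eq, hitHS, hitHS,
    ← hW.hitCut_op_eq (hg.comp_neg.cutBarrier L) hC (h.comp_neg.cutBarrier L),
    ← hW.hitCut_op_eq (hg.cutBarrier L) hC (h.cutBarrier L), scatteringOp]

lemma IsContBM.airyTransform_cutScattering [IsProbabilityMeasure P] (hW : IsContBM W P)
    (hg : GoodBarrier g) {c κ C : ℝ} (hC : IsHitBound c κ C) (h : AboveParabola c κ g) :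
    airyTransform ∘L cutScattering P W g ∘L ContinuousLinearMap.adjoint airyTransform =
      scatteringOp (hW.hitHS hg.comp_neg hC h.comp_neg ∘L weightOp)
        (hW.hitHS hg hC h ∘L weightOp) := by
  rw [cutScattering, (hW.hasKernel_cutPsiKernel hg hC h).kernelOp_eq,
    (hW.hasKernel_cutPsiKernel hg.comp_neg hC h.comp_neg).kernelOp_eq, airyTransform_eq,
    hitHS, hitHS, ← hW.hitCut_op_eq hg hC h, ← hW.hitCut_op_eq hg.comp_neg hC h.comp_neg,
    scatteringOp]

lemma IsContBM.tendsto_traceNorm [IsProbabilityMeasure P] (hW : IsContBM W P)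
    (hg : GoodBarrier g) {c κ C : ℝ} (hκ : 0 ≤ κ) (hC : IsHitBound c κ C)
    (h : AboveParabola c κ g) :
    Tendsto (fun L : ℝ => traceNorm ((airyOp - kernelOp (scatLKernel P W g L)) - (airyOp -
        airyTransform ∘L cutScattering P W g ∘L ContinuousLinearMap.adjoint airyTransform)))
      atTop (𝓝 0) := by
  have hd := hW.isDominatedKernel_weightedHit hg hC h
  refine (tendsto_traceNorm_scatteringOp_sub
    (ρ := fun L => hW.hitHS (hg.comp_neg.cutBarrier L) hC (h.comp_neg.cutBarrier L))
    (σ := fun L => hW.hitHS (hg.cutBarrier L) hC (h.cutBarrier L))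
    (ENNReal.mul_lt_top (MemLp.lintegral_enorm_sq_lt_top hd.left)
      (MemLp.lintegral_enorm_sq_lt_top hd.right))
    (fun L => IsDominatedKernel.hsSq_op_le_mul _)
    (IsDominatedKernel.hsSq_op_lt_top _)
    (hW.tendsto_hsSq_weightedHit hg.comp_neg hC h.comp_neg)
    (hW.tendsto_hsSq_weightedHit hg hC h)).congr' ?_
  filter_upwards [eventually_gt_atTop 0] with L hL
  rw [hW.kernelOp_scatLKernel hg hκ hC h hL, hW.airyTransform_cutScattering hg hC h]
  rw [sub_sub_sub_cancel_left]
  rfl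

/-! ### The value of the path at the hitting time -/

lemma IsContBM.path_hitTime_eq (hW : IsContBM W P) (h0 : 0 ∈ {t | g t ≠ ⊤})
    (hD : {t | g t ≠ ⊤}.OrdConnected) (hcont : ContinuousOn g {t | g t ≠ ⊤}) {y : ℝ}
    (hy : (y : EReal) ≤ g 0) {ω : Ω} (hω : ω ∈ hitEvent W g y) :
    g (hitTime W g y ω) =
      ((y + √2 * W (hitTime W g y ω).toNNReal ω : ℝ) : EReal) := by
  set B : ℝ → EReal := fun s => ((y + √2 * W s.toNNReal ω : ℝ) : EReal) with hB
  have hBc : Continuous B := continuous_coe_real_ereal.comp (hW.continuous_path y ω)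
  obtain ⟨t₀, ht₀⟩ := hω
  have ht₀D : t₀ ∈ {t | g t ≠ ⊤} := (ht₀.2.trans_lt (EReal.coe_lt_top _)).ne
  have hg : ContinuousOn g (Set.Icc 0 t₀) := hcont.mono (hD.out h0 ht₀D)
  set S : Set ℝ := {t ∈ Set.Icc 0 t₀ | g t ≤ B t} with hS
  have hSc : IsClosed S := isClosed_Icc.isClosed_le hg hBc.continuousOn
  have hSn : S.Nonempty := ⟨t₀, ⟨ht₀.1, le_rfl⟩, ht₀.2⟩
  have hSb : BddBelow S := ⟨0, fun _ h => h.1.1⟩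
  have hτ : hitTime W g y ω = sInf S := by
    refine le_antisymm (csInf_le_csInf (hitTimes_bddBelow y ω) hSn fun t ht => ⟨ht.1.1, ht.2⟩)
      (le_csInf ⟨t₀, ht₀⟩ fun b hb => ?_)
    rcases le_total b t₀ with h | h
    · exact csInf_le hSb ⟨⟨hb.1, h⟩, hb.2⟩
    · exact (csInf_le hSb ⟨⟨ht₀.1, le_rfl⟩, ht₀.2⟩).trans h
  have hmem : hitTime W g y ω ∈ S := hτ ▸ hSc.csInf_mem hSn hSb
  refine le_antisymm hmem.2 ?_
  have hTc : IsClosed {t ∈ Set.Icc 0 t₀ | B t ≤ g t} :=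
    isClosed_Icc.isClosed_le hBc.continuousOn hg
  have hsub : Set.Ico 0 (hitTime W g y ω) ⊆ {t ∈ Set.Icc 0 t₀ | B t ≤ g t} := fun t ht => by
    refine ⟨⟨ht.1, ht.2.le.trans hmem.1.2⟩, ?_⟩
    by_contra! hlt
    exact (notMem_of_lt_csInf ht.2 (hitTimes_bddBelow y ω)) ⟨ht.1, hlt.le⟩
  rcases (hitTime_nonneg (W := W) (g := g) y ω).eq_or_lt with h | h
  · rw [← h]
    simpa [hW.zero ω] using hy
  · have hcl := hTc.closure_subset_iff.2 hsub
    rw [closure_Ico h.ne] at hcl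
    exact (hcl ⟨h.le, le_rfl⟩).2

lemma IsContBM.psiKernel_eq_psiKernelCurve (hW : IsContBM W P) (hg : GoodBarrier g)
    (h0 : 0 ∈ {t | g t ≠ ⊤}) (hD : {t | g t ≠ ⊤}.OrdConnected)
    (hcont : ContinuousOn g {t | g t ≠ ⊤}) (l : ℝ) {y : ℝ} (hy : (y : EReal) ≤ g 0) :
    psiKernel P W g l y = psiKernelCurve P W g l y := by
  unfold psiKernel psiKernelCurve
  congr 1
  refine setIntegral_congr_fun (hW.measurableSet_hitEvent hg y) fun ω hω => ?_
  simp only [hW.path_hitTime_eq h0 hD hcont hy hω, EReal.toReal_coe]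

/-! ### Dependence on the version of the Brownian motion -/

variable {W' : ℝ≥0 → Ω → ℝ}

lemma thetaKernel_congr (h : ∀ᵐ ω ∂P, ∀ t, W t ω = W' t ω) (g : ℝ → EReal) (L : ℝ) :
    thetaKernel P W g L = thetaKernel P W' g L := by
  ext x₁ x₂
  unfold thetaKernel
  congr 1
  refine measureReal_congr ?_
  filter_upwards [h] with ω hω
  refine propext (forall₂_congr fun t _ => ?_)
  simp only [bridge, hω]

lemma hitTimes_congr {Ω : Type*} {W W' : ℝ≥0 → Ω → ℝ} {ω : Ω} (h : ∀ t, W t ω = W' t ω) (g : ℝ → EReal) (y : ℝ) :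
    hitTimes W g y ω = hitTimes W' g y ω := by
  simp only [hitTimes, h]

lemma psiKernel_congr (h : ∀ᵐ ω ∂P, ∀ t, W t ω = W' t ω) (g : ℝ → EReal) :
    psiKernel P W g = psiKernel P W' g := by
  ext l y
  have hs : {ω | (hitTimes W g y ω).Nonempty} =ᵐ[P] {ω | (hitTimes W' g y ω).Nonempty} := by
    filter_upwards [h] with ω hω
    exact congrArg Set.Nonempty (hitTimes_congr hω g y)
  unfold psiKernel
  rw [Measure.restrict_congr_set hs]
  congr 1
  refine integral_congr_ae (ae_restrict_of_ae ?_)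
  filter_upwards [h] with ω hω
  simp only [hitTime, hitTimes_congr hω, hω]

lemma psiKernelCurve_congr (h : ∀ᵐ ω ∂P, ∀ t, W t ω = W' t ω) (g : ℝ → EReal) :
    psiKernelCurve P W g = psiKernelCurve P W' g := by
  ext l y
  have hs : {ω | (hitTimes W g y ω).Nonempty} =ᵐ[P] {ω | (hitTimes W' g y ω).Nonempty} := by
    filter_upwards [h] with ω hω
    exact congrArg Set.Nonempty (hitTimes_congr hω g y)
  unfold psiKernelCurve
  rw [Measure.restrict_congr_set hs]
  congr 1
  refine integral_congr_ae (ae_restrict_of_ae ?_)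
  filter_upwards [h] with ω hω
  simp only [hitTime, hitTimes_congr hω]

lemma cutPsiKernel_congr (h : ∀ᵐ ω ∂P, ∀ t, W t ω = W' t ω) (g : ℝ → EReal) :
    cutPsiKernel P W g = cutPsiKernel P W' g := by
  ext l y
  simp only [cutPsiKernel, psiKernel_congr h]

lemma scatLKernel_congr (h : ∀ᵐ ω ∂P, ∀ t, W t ω = W' t ω) (g : ℝ → EReal) (L : ℝ) :
    scatLKernel P W g L = scatLKernel P W' g L := by
  simp only [scatLKernel, thetaKernel_congr h]

lemma cutScattering_congr (h : ∀ᵐ ω ∂P, ∀ t, W t ω = W' t ω) (g : ℝ → EReal) :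
    cutScattering P W g = cutScattering P W' g := by
  simp only [cutScattering, cutPsiKernel_congr h]

end Brownian

end AiryHitting

end

open AiryHitting in
theorem theorem3p2 {Ω : Type*} [MeasurableSpace Ω] (P : Measure Ω) [IsProbabilityMeasure P]
    (W : ℝ≥0 → Ω → ℝ) (hW : IsBrownianReal W P)
    (g : ℝ → EReal) (hg : IsH1Ext g) (c κ : ℝ) (hκ₀ : 0 ≤ κ) (hκ : κ < 3 / 4)
    (hlow : ∀ t : ℝ, ((c - κ * t ^ 2 : ℝ) : EReal) ≤ g t) :
    -- all the operators involved are well defined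
    IsBoundedKernel airyKernel ∧ IsBoundedKernel airyTransformKernel ∧
    (∀ L : ℝ, 0 < L →
      Composable (thetaKernel P W g L) (expAiryKernel L) ∧
      Composable (expAiryKernel L) (kernelComp (thetaKernel P W g L) (expAiryKernel L)) ∧
      IsBoundedKernel (scatLKernel P W g L)) ∧
    IsBoundedKernel (cutPsiKernel P W g) ∧ IsBoundedKernel (cutPsiKernel P W fun t => g (-t)) ∧
    -- the operators and their claimed limit are trace class
    (∀ L : ℝ, 0 < L → IsTraceClass (airyOp - kernelOp (scatLKernel P W g L))) ∧
    IsTraceClass (airyOp -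
      airyTransform ∘L cutScattering P W g ∘L ContinuousLinearMap.adjoint airyTransform) ∧
    -- convergence in trace norm
    Tendsto (fun L : ℝ => traceNorm ((airyOp - kernelOp (scatLKernel P W g L)) - (airyOp -
        airyTransform ∘L cutScattering P W g ∘L ContinuousLinearMap.adjoint airyTransform)))
      atTop (𝓝 0) ∧
    -- if `g` is finite and continuous exactly on an interval containing `0`, the Brownian motion
    -- hits the graph of `g`, and `B(τ)` may be replaced by `g(τ)` in the formula for `Ψ`
    (0 ∈ {t | g t ≠ ⊤} → {t | g t ≠ ⊤}.OrdConnected → ContinuousOn g {t | g t ≠ ⊤} →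
      ∀ l y : ℝ, (y : EReal) ≤ g 0 →
        psiKernel P W g l y = psiKernelCurve P W g l y ∧
        psiKernel P W (fun t => g (-t)) l y = psiKernelCurve P W (fun t => g (-t)) l y) := by
  obtain ⟨C, hC0, hCb⟩ := exists_abs_invHeatAiry_parabola_le (c := c) hκ₀ hκ
  have hC : IsHitBound c κ C := ⟨hC0, hCb⟩
  have hb := hg.goodBarrier
  have ha : AboveParabola c κ g := hlow
  obtain ⟨W', hW', hae⟩ := exists_isContBM hW
  simp only [scatLKernel_congr hae, cutPsiKernel_congr hae, thetaKernel_congr hae,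
    cutScattering_congr hae, psiKernel_congr hae, psiKernelCurve_congr hae]
  refine ⟨⟨_, hasWeightedKernel_airyKernel.hasKernel (by fun_prop)⟩,
    ⟨_, hasTestKernel_airyA.hasKernel⟩, fun L hL => ⟨hW'.composable_theta hb hL,
      (hW'.scatLKernel_eq hb hκ₀ hC ha hL).1, _, hW'.hasKernel_scatLKernel hb hκ₀ hC ha hL⟩,
    ⟨_, hW'.hasKernel_cutPsiKernel hb hC ha⟩,
    ⟨_, hW'.hasKernel_cutPsiKernel hb.comp_neg hC ha.comp_neg⟩, fun L hL => ?_, ?_,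
    hW'.tendsto_traceNorm hb hκ₀ hC ha, fun h0 hD hcont l y hy => ⟨?_, ?_⟩⟩
  · rw [hW'.kernelOp_scatLKernel hb hκ₀ hC ha hL]
    exact isTraceClass_airyOp_sub_scatteringOp (IsDominatedKernel.hsSq_op_lt_top _)
      (IsDominatedKernel.hsSq_op_lt_top _)
  · rw [hW'.airyTransform_cutScattering hb hC ha]
    exact isTraceClass_airyOp_sub_scatteringOp (IsDominatedKernel.hsSq_op_lt_top _)
      (IsDominatedKernel.hsSq_op_lt_top _)
  · exact hW'.psiKernel_eq_psiKernelCurve hb h0 hD hcont l hy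
  · refine hW'.psiKernel_eq_psiKernelCurve hb.comp_neg (by simpa using h0) ?_ ?_ l (by simpa using hy)
    · exact hD.preimage_anti fun _ _ h => neg_le_neg h
    · exact hcont.comp continuous_neg.continuousOn fun t ht => ht
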